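/- **Network.** Consider $n$ banks and a societal node. Bank $i$ owes $L_{ij}\ge 0$ to bank $j$ ($L_{ii}=0$) and $L_{i,n+1}>0$ to society. Put $\bar p_i=\sum_{j=1}^{n+1}L_{ij}>0$, $\pi_{ij}=L_{ij}/\bar p_i$ and $\Pi=(\pi_{ij})_{i,j\le n}$. Under full recovery, for endowments $x\in\mathbb R^n_+$, let $V(x)\in\mathbb R^n$ be the greatest solution of $$V_i=x_i+\sum_{j=1}^n\pi_{ji}(\bar p_j-V_j^-)-\bar p_i ,\qquad i=1,\dots,n,$$ and let $p(x)=\bar p-V(x)^-$ be the clearing payments. For $z\in\{0,1\}^n$ let $\Delta(z)=(I-\Pi^\top\mathrm{diag}(z))^{-1}$ and $\delta(z)=(I-\Pi^\top\mathrm{diag}(z))^{-1}(I-\Pi^\top)\bar p$. **Market.** Let $r\ge 0$, $\mu_M\in\mathbb R$, $\sigma_M>0$, $T>0$, $s,\beta\in\mathbb R^n_+$, $\gamma\in\mathbb R^n$. On a probability space $(\Omega,\mathcal F,\mathbb P)$ let $W,B^1,\dots,B^n$ be Brownian motions with $W$ independent of $(B^1,\dots,B^n)$ (the $B^i$ may depend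 on each other). Let $q$ and $\eta^1,\dots,\eta^n$ be continuous adapted solutions of $$\frac{dq_t}{q_t}=\mu_M\,dt+\sigma_M\,dW_t,\qquad \frac{d\eta^i_t}{\eta^i_t}=\bigl(r+\beta_i(\mu_M-r)\bigr)dt+\beta_i\sigma_M\,dW_t+\gamma_i\,dB^i_t,\qquad q_0=\eta^i_0=1,$$ where each equation is posed with respect to a filtration for which its driving noise ($W$, respectively $(W,B^i)$) is a Brownian motion. Put $\sigma_i=\sqrt{\beta_i^2\sigma_M^2+\gamma_i^2}$, and let $\mathbb Q$ be the risk-neutral measure $$\frac{d\mathbb Q}{d\mathbb P}=\exp\Bigl(-\tfrac12\bigl(\tfrac{\mu_M-r}{\sigma_M}\bigr)^2T-\tfrac{\mu_M-r}{\sigma_M}W_T\Bigr),\qquad \tilde W_t=W_t+\tfrac{\mu_M-r}{\sigma_M}t .$$ For $z\in\mathbb R^n$ define $\hat\eta_T(z)$ by $\hat\eta^i_T(z)=\exp\bigl((r-\tfrac{z_i^2}{2})T+z_i\tilde W_T\bigr)$. **Claim.** $\mathbb Q$ is a probability measure, the $\hat\eta_T^i(z)$ are $\mathbb Q$-integrable,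 the payments appearing below are $\mathbb Q$-integrable, and the following hold. 1. For every bank $i$, $$\mathbb E^{\mathbb Q}\Bigl[e^{-rT}\tfrac{p_i(\mathrm{diag}(s)\hat\eta_T(\sigma))}{\bar p_i}\Bigr]\le\mathbb E^{\mathbb Q}\Bigl[e^{-rT}\tfrac{p_i(\mathrm{diag}(s)\eta_T)}{\bar p_i}\Bigr]\le\mathbb E^{\mathbb Q}\Bigl[e^{-rT}\tfrac{p_i(\mathrm{diag}(s)\hat\eta_T(\beta\sigma_M))}{\bar p_i}\Bigr].$$ 2. For every $z\in\mathbb R^n$, almost surely, $\hat\eta^i_T(z)=\exp\bigl((1-\tfrac{z_i}{\sigma_M})(r+\tfrac{z_i\sigma_M}{2})T\bigr)\,q_T^{z_i/\sigma_M}$ for all $i$. 3. $\hat\eta_T(\sigma)$ is the comonotonic version of $\eta_T$ under $\mathbb Q$: it is comonotonic (equal in distribution to a nondecreasing function of one real random variable) and each $\hat\eta_T^i(\sigma)$ has the law of $\eta_T^i$. Moreover $\hat\eta_T(\beta\sigma_M)$ is comonotonic under $\mathbb Q$ and $\hat\eta_T^i(\beta\sigma_M)=\mathbb E^{\mathbb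 Q}[\eta_T^i\mid q_T]$ $\mathbb Q$-a.s. for every $i$. 4. Let $z\in\mathbb R^n_+$ (for example $z=\sigma$ or $z=\beta\sigma_M$). Let $f^z_i(y)=s_i\exp\bigl((1-\tfrac{z_i}{\sigma_M})(r+\tfrac{z_i\sigma_M}{2})T\bigr)y^{z_i/\sigma_M}$ for $y\ge0$ (with $0^0=1$), and let $$\hat q^*_i(z)=\inf\{y\ge 0: V_i(f^z(y))\ge 0\}\in[0,\infty],\qquad \inf\emptyset=\infty .$$ Number the banks, for this $z$, so that $\hat q_1^*(z)\ge\dots\ge\hat q_n^*(z)$ (ties in any order), and put $\hat q^*_{n+1}(z)=0$. Let $\Delta_k=\Delta(\sum_{j\le k}e_j)$ and $\delta_k=\delta(\sum_{j\le k}e_j)$. Let $\Phi$ be the standard normal distribution function, with $\Phi(-\infty)=0$ and $\Phi(\infty)=1$, and for $k=1,\dots,n+1$ let $$\hat d_k^1(z)=\frac{\log(1/\hat q_k^*(z))\vec 1+(r\vec 1-\frac12(\sigma_M\vec 1-2z)\sigma_M)T}{\sigma_M\sqrt T},\qquad \hat d_k^2(z)=\frac{\log(1/\hat q_k^*(z))+(r-\frac12\sigma_M^2)T}{\sigma_M\sqrt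 T},$$ with values in $[-\infty,\infty]$ ($\log 0=-\infty$, $\log\infty=\infty$), $\Phi$ acting componentwise on vectors. Then for every bank $i$ $$\mathbb E^{\mathbb Q}\Bigl[e^{-rT}\tfrac{p_i(\mathrm{diag}(s)\hat\eta_T(z))}{\bar p_i}\Bigr]=e^{-rT}+\frac1{\bar p_i}e_i^\top\sum_{k=i}^n\Bigl[\Delta_k\,\mathrm{diag}(s)\bigl(\Phi(-\hat d_k^1(z))-\Phi(-\hat d_{k+1}^1(z))\bigr)-e^{-rT}\delta_k\bigl(\Phi(-\hat d_k^2(z))-\Phi(-\hat d_{k+1}^2(z))\bigr)\Bigr].$$ -/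

import Mathlib

open MeasureTheory ProbabilityTheory Filter Matrix
open scoped NNReal ENNReal Topology

noncomputable section

namespace NetworkPricing

/-! ### Financial networks and Eisenberg-Noe clearing (full recovery) -/

/-- A network of `n` banks. `L i j` is the nominal liability of bank `i` to bank `j`, and `Lsoc i`
the nominal liability of bank `i` to the societal node. Every bank owes something to society. -/
structure FinancialNetwork (n : ℕ) where
  L : Fin n → Fin n → ℝ
  Lsoc : Fin n → ℝ
  L_nonneg : ∀ i j, 0 ≤ L i j
  L_self : ∀ i, L i i = 0
  Lsoc_pos : ∀ i, 0 < Lsoc i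

namespace FinancialNetwork

variable {n : ℕ} (N : FinancialNetwork n)

/-- Total liabilities of bank `i`, to the other banks and to society. -/
def pbar (i : Fin n) : ℝ := ∑ j, N.L i j + N.Lsoc i

/-- The matrix of relative liabilities `π i j = L i j / pbar i`. -/
def relLiab : Matrix (Fin n) (Fin n) ℝ := Matrix.of fun i j => N.L i j / N.pbar i

/-- The clearing process in wealths with endowments `x`, for full recovery:
`Ψ_i(V) = x_i + ∑_j π_ji (pbar_j - V_j⁻) - pbar_i`. -/
def clearingMap (x V : Fin n → ℝ) : Fin n → ℝ := fun i =>
  x i + ∑ j, N.relLiab j i * (N.pbar j - max (-V j) 0) - N.pbar i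

/-- The maximal clearing wealths: the greatest fixed point of the clearing process
(see `isGreatest_wealth`). -/
def wealth (x : Fin n → ℝ) : Fin n → ℝ := sSup {V | N.clearingMap x V = V}

/-- Clearing payments `p(x) = pbar - V(x)⁻`. -/
def payment (x : Fin n → ℝ) : Fin n → ℝ := fun i => N.pbar i - max (-N.wealth x i) 0

/-- The matrix `Δ(z) = (I - Πᵀ diag z)⁻¹` for the default indicator `z` (full recovery). -/
def Delta (z : Fin n → ℝ) : Matrix (Fin n) (Fin n) ℝ :=
  (1 - N.relLiabᵀ * Matrix.diagonal z)⁻¹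

/-- The vector `δ(z) = (I - Πᵀ diag z)⁻¹ (I - Πᵀ) pbar` for the default indicator `z`
(full recovery). -/
def delta (z : Fin n → ℝ) : Fin n → ℝ :=
  (1 - N.relLiabᵀ * Matrix.diagonal z)⁻¹ *ᵥ ((1 - N.relLiabᵀ) *ᵥ N.pbar)

lemma pbar_pos (i : Fin n) : 0 < N.pbar i :=
  add_pos_of_nonneg_of_pos (Finset.sum_nonneg fun j _ => N.L_nonneg i j) (N.Lsoc_pos i)

lemma relLiab_nonneg (i j : Fin n) : 0 ≤ N.relLiab i j :=
  div_nonneg (N.L_nonneg i j) (N.pbar_pos i).le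

lemma clearingMap_mono (x : Fin n → ℝ) : Monotone (N.clearingMap x) := by
  intro V W h i
  have hsum : ∑ j, N.relLiab j i * (N.pbar j - max (-V j) 0) ≤
      ∑ j, N.relLiab j i * (N.pbar j - max (-W j) 0) :=
    Finset.sum_le_sum fun j _ => mul_le_mul_of_nonneg_left
      (sub_le_sub_left (max_le_max_right 0 (neg_le_neg (h j))) _) (N.relLiab_nonneg j i)
  simp only [clearingMap]
  linarith

/-- For nonnegative endowments, `wealth` is the greatest clearing solution. -/
theorem isGreatest_wealth {x : Fin n → ℝ} (hx : 0 ≤ x) :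
    IsGreatest {V | N.clearingMap x V = V} (N.wealth x) := by
  set S : Set (Fin n → ℝ) := {V | V ≤ N.clearingMap x V} with hS
  have hbd : ∀ V, N.clearingMap x V ≤ fun i => x i + ∑ j, N.relLiab j i * N.pbar j - N.pbar i := by
    intro V i
    have hsum : ∑ j, N.relLiab j i * (N.pbar j - max (-V j) 0) ≤
        ∑ j, N.relLiab j i * N.pbar j :=
      Finset.sum_le_sum fun j _ => mul_le_mul_of_nonneg_left
        (by linarith [le_max_right (-V j) 0]) (N.relLiab_nonneg j i)
    simp only [clearingMap]
    linarith
  have hSb : BddAbove S := ⟨_, fun V hV => le_trans hV (hbd V)⟩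
  have hSn : S.Nonempty := by
    refine ⟨fun i => -N.pbar i, fun i => ?_⟩
    have h : ∀ j, max (- -N.pbar j) 0 = N.pbar j := fun j => by
      simp [(N.pbar_pos j).le]
    have := hx i
    simp only [clearingMap, h, sub_self, mul_zero, Finset.sum_const_zero, add_zero]
    simp at this
    linarith
  have h1 : sSup S ≤ N.clearingMap x (sSup S) :=
    csSup_le hSn fun V hV => le_trans hV (N.clearingMap_mono x (le_csSup hSb hV))
  have h2 : N.clearingMap x (sSup S) ≤ sSup S := le_csSup hSb (N.clearingMap_mono x h1)
  have hG : IsGreatest {V | N.clearingMap x V = V} (sSup S) :=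
    ⟨le_antisymm h2 h1, fun V hV => le_csSup hSb (le_of_eq (Eq.symm hV))⟩
  have : N.wealth x = sSup S := hG.csSup_eq
  rw [this]
  exact hG

end FinancialNetwork

/-! ### The stochastic differential equation -/

section Sde

variable {Ω : Type*} {m : MeasurableSpace Ω}

/-- Left-endpoint sums `∑_k Y_{kt/K} (X_{(k+1)t/K} - X_{kt/K})` over the uniform partition of
`[0,t]` into `K` intervals. -/
def itoSum (Y X : ℝ≥0 → Ω → ℝ) (t : ℝ≥0) (K : ℕ) (ω : Ω) : ℝ :=
  ∑ k ∈ Finset.range K, Y (k * t / K) ω * (X ((k + 1) * t / K) ω - X (k * t / K) ω)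

/-- `J` is the Itô integral process `J_t = ∫_0^t Y dX`, for continuous adapted `Y` and a Brownian
motion `X`: for each `t`, the limit in probability of the left-endpoint sums. -/
def IsItoIntegral (P : Measure Ω) (Y X J : ℝ≥0 → Ω → ℝ) : Prop :=
  ∀ t, TendstoInMeasure P (itoSum Y X t) atTop (J t)

/-- Relative to the filtration `ℱ`, `Y` is a continuous adapted solution of
`dY_t = Y_t (a dt + ∑_j b_j dX^j_t)`, `Y_0 = 1`; here `X` is adapted, and its vector increments
after time `s` are independent of `ℱ s`. -/
structure SolvesLinearSDEWrt (ℱ : Filtration ℝ≥0 m) (P : Measure Ω) {d : ℕ} (a : ℝ)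
    (b : Fin d → ℝ) (X : Fin d → ℝ≥0 → Ω → ℝ) (Y : ℝ≥0 → Ω → ℝ) : Prop where
  noise_adapted : ∀ j, StronglyAdapted ℱ (X j)
  noise_indep : ∀ s t, s ≤ t →
    Indep (MeasurableSpace.comap (fun ω (j : Fin d) => X j t ω - X j s ω) inferInstance) (ℱ s) P
  adapted : StronglyAdapted ℱ Y
  continuous_paths : ∀ᵐ ω ∂P, Continuous fun t => Y t ω
  initial : ∀ᵐ ω ∂P, Y 0 ω = 1
  sde : ∃ J : Fin d → ℝ≥0 → Ω → ℝ, (∀ j, IsItoIntegral P Y (X j) (J j)) ∧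
    ∀ t : ℝ≥0, ∀ᵐ ω ∂P,
      Y t ω = 1 + a * (∫ u in (0 : ℝ)..t, Y u.toNNReal ω) + ∑ j, b j * J j t ω

/-- `Y` solves `dY_t / Y_t = a dt + ∑_j b_j dX^j_t`, `Y_0 = 1`, for some filtration. -/
def SolvesLinearSDE (P : Measure Ω) {d : ℕ} (a : ℝ)
    (b : Fin d → ℝ) (X : Fin d → ℝ≥0 → Ω → ℝ) (Y : ℝ≥0 → Ω → ℝ) : Prop :=
  ∃ ℱ : Filtration ℝ≥0 m, SolvesLinearSDEWrt ℱ P a b X Y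

/-! ### Risk-neutral measure and comonotonic endowments -/

/-- The risk-neutral measure `Q`, with
`dQ/dP = exp (-((μM - r)/σM)² T / 2 - ((μM - r)/σM) W_T)`. -/
def riskNeutral (P : Measure Ω) (W : ℝ≥0 → Ω → ℝ) (r μM σM : ℝ) (T : ℝ≥0) : Measure Ω :=
  P.withDensity fun ω =>
    ENNReal.ofReal (Real.exp (-(1 / 2) * ((μM - r) / σM) ^ 2 * T - (μM - r) / σM * W T ω))

/-- `W̃_t = W_t + ((μM - r)/σM) t`, the Brownian motion under the risk-neutral measure. -/
def wTilde (W : ℝ≥0 → Ω → ℝ) (r μM σM : ℝ) (t : ℝ≥0) (ω : Ω) : ℝ :=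
  W t ω + (μM - r) / σM * t

/-- `η̂_T^i(z) = exp ((r - z_i²/2) T + z_i W̃_T)`. -/
def etaHat {n : ℕ} (W : ℝ≥0 → Ω → ℝ) (r μM σM : ℝ) (T : ℝ≥0) (z : Fin n → ℝ) (ω : Ω) :
    Fin n → ℝ :=
  fun i => Real.exp ((r - z i ^ 2 / 2) * T + z i * wTilde W r μM σM T ω)

/-- A random vector is comonotonic if it is equal in distribution to `f(q)` for a real random
variable `q` (with law `ν`) and a nondecreasing `f`. -/
def IsComonotonic {n : ℕ} (μ : Measure Ω) (X : Ω → Fin n → ℝ) : Prop :=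
  AEMeasurable X μ ∧ ∃ (ν : Measure ℝ) (f : ℝ → Fin n → ℝ),
    IsProbabilityMeasure ν ∧ Monotone f ∧ μ.map X = ν.map f

end Sde

/-- The firm volatilities `σ_i = √(β_i² σM² + γ_i²)`. -/
def firmVol {n : ℕ} (β γ : Fin n → ℝ) (σM : ℝ) (i : Fin n) : ℝ :=
  Real.sqrt (β i ^ 2 * σM ^ 2 + γ i ^ 2)

/-- `η̂_T(z)` as a function of the market price `y = q_T`:
`exp ((1 - z_i/σM) (r + z_i σM/2) T) y^(z_i/σM)`. -/
def marketMap {n : ℕ} (r σM T : ℝ) (z : Fin n → ℝ) (y : ℝ) : Fin n → ℝ :=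
  fun i => Real.exp ((1 - z i / σM) * (r + z i * σM / 2) * T) * y ^ (z i / σM)

/-! ### Closed form -/

/-- `q̂*_i(z)`, the minimal market price at which bank `i` is solvent under the endowments
`diag(s) η̂_T(z)`; it is `∞` if bank `i` is solvent at no price. -/
def qStar {n : ℕ} (N : FinancialNetwork n) (s : Fin n → ℝ) (r σM T : ℝ) (z : Fin n → ℝ)
    (i : Fin n) : ℝ≥0∞ :=
  ⨅ (y : ℝ≥0) (_ : 0 ≤ N.wealth (fun j => s j * marketMap r σM T z y j) i), (y : ℝ≥0∞)

/-- Thresholds `v` listed in the order `τ` with the conventions `v_0 = ∞` and `v_{n+1} = 0`: the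
value at `k = 1, …, n` belongs to the `k`-th bank, which is `τ (k - 1)` as `Fin n` starts at `0`. -/
def ordered {n : ℕ} (v : Fin n → ℝ≥0∞) (τ : Equiv.Perm (Fin n)) : ℕ → ℝ≥0∞
  | 0 => ⊤
  | k + 1 => if h : k < n then v (τ ⟨k, h⟩) else 0

/-- The indicator of the first `k` banks in the order `τ`. -/
def firstBanks {n : ℕ} (τ : Equiv.Perm (Fin n)) (k : ℕ) (j : Fin n) : ℝ :=
  if (τ.symm j : ℕ) < k then 1 else 0

/-- The standard normal distribution function, extended by `Φ(-∞) = 0` and `Φ(∞) = 1`. -/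
def Phi (x : EReal) : ℝ := (gaussianReal 0 1).real {y : ℝ | (y : EReal) ≤ x}

/-- The `j`-th entry of the vector `d̂¹(z)` at the threshold `v ∈ [0,∞]`. -/
def d1 {n : ℕ} (r σM T : ℝ) (z : Fin n → ℝ) (v : ℝ≥0∞) (j : Fin n) : EReal :=
  (ENNReal.log (1 / v) + (((r - 1 / 2 * (σM - 2 * z j) * σM) * T : ℝ) : EReal)) /
    ((σM * Real.sqrt T : ℝ) : EReal)

/-- The number `d̂²(z)` at the threshold `v ∈ [0,∞]`. -/
def d2 (r σM T : ℝ) (v : ℝ≥0∞) : EReal :=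
  (ENNReal.log (1 / v) + (((r - 1 / 2 * σM ^ 2) * T : ℝ) : EReal)) /
    ((σM * Real.sqrt T : ℝ) : EReal)

/-- The closed form of the price of the debt of the `k₀`-th bank in the order `τ`, that is of bank
`i = τ (k₀ - 1)`. Here `Δ_k` and `δ_k` are `Δ` and `δ` at the indicator of the first `k` banks. -/
def closedForm {n : ℕ} (N : FinancialNetwork n) (s : Fin n → ℝ) (r σM T : ℝ) (z : Fin n → ℝ)
    (τ : Equiv.Perm (Fin n)) (i : Fin n) : ℝ :=
  let v : ℕ → ℝ≥0∞ := ordered (qStar N s r σM T z) τ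
  let k₀ : ℕ := (τ.symm i : ℕ) + 1
  Real.exp (-r * T) + 1 / N.pbar i *
    ∑ k ∈ Finset.Icc k₀ n,
      ((N.Delta (firstBanks τ k) *ᵥ
          (fun j => s j * (Phi (-d1 r σM T z (v k) j) - Phi (-d1 r σM T z (v (k + 1)) j)))) i
        - Real.exp (-r * T) * (N.delta (firstBanks τ k) i *
            (Phi (-d2 r σM T (v k)) - Phi (-d2 r σM T (v (k + 1))))))

/-- The price `E^Q[e^{-rT} p_i(diag(s) Y) / pbar_i]` of the debt of bank `i`. -/
def debtPrice {Ω : Type*} {m : MeasurableSpace Ω} {n : ℕ} (N : FinancialNetwork n)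
    (Q : Measure Ω) (s : Fin n → ℝ) (r T : ℝ) (Y : Ω → Fin n → ℝ) (i : Fin n) : ℝ :=
  ∫ ω, Real.exp (-r * T) * (N.payment (fun j => s j * Y ω j) i / N.pbar i) ∂Q

end NetworkPricing

end

open NetworkPricing

/-! Everything is reduced to explicit functions of Gaussian variables. Absorb drift and noise of a
linear equation into one driver A with variance rate v. A continuous adapted solution of dY = Y dA,
Y_0 = 1, must be exp(A_T - vT/2) (`SolvesExpSDE.ae_eq_exp`). The Itô integral is given only as a
limit in measure of left-endpoint sums, so uniqueness is proved from a discrete Itô isometry: on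
events where the paths are bounded, a discrete product rule along a grid shows that Y times the
reciprocal of the candidate differs from 1 by terms of vanishing second moment.

Under Q the variable W̃_T is N(0,T) and independent of (B^1_T, ..., B^n_T), whose law is unchanged
(`map_riskNeutral_prod`). Hence η^j_T can be read in two ways. It is exp((r - σ_j²/2)T + σ_j U_j)
with U_j of law N(0,T), and it is η̂^j_T(βσM) times an independent factor of mean one. The second
reading gives the conditional expectation given q_T.

For the bounds, the clearing payments are the limit of iterating a map made of nonnegative linear
combinations and truncation from above. Each iterate is nondecreasing, submodular and concave in the
endowments, hence so are the payments. Among couplings with given marginals the comonotonic one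
minimizes the mean of a submodular function (`integral_diagonal_le_of_submodular`); replacing every
U_j by W̃_T therefore gives the lower bound. Jensen's inequality in the independent noise, with the
market fixed, gives the upper bound (`integral_payment_mul_le`).

For the closed form, nonnegative z makes the endowments nondecreasing in the market price, so each
bank defaults exactly below its threshold (`wealth_neg_iff_lt_qStar`). Between consecutive
thresholds the set of defaulting banks is constant and the wealths are affine in the endowments. The
payment is thus a finite sum of lognormal variables restricted to price intervals, and a shift of
the Gaussian mean evaluates each of them (`integral_below_mul_exp`). -/

open NetworkPricing

/-! ### Second moments of discrete stochastic integrals. -/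

section DiscreteIsometry

variable {Ω : Type*} {m : MeasurableSpace Ω} {P : Measure Ω}

theorem indepFun_of_measurable_of_indep_comap {G : MeasurableSpace Ω} {f g : Ω → ℝ}
    (hf : Measurable[G] f) (hg : Indep (MeasurableSpace.comap g inferInstance) G P) :
    IndepFun f g P :=
  (IndepFun_iff_Indep _ _ _).2 (indep_of_indep_of_le_left hg.symm hf.comap_le)

theorem memLp_two_mul_of_indepFun {f g : Ω → ℝ} (hfg : IndepFun f g P)
    (hf : MemLp f 2 P) (hg : MemLp g 2 P) : MemLp (fun ω => f ω * g ω) 2 P := by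
  refine (memLp_two_iff_integrable_sq (hf.1.mul hg.1)).2 ?_
  have h := (hfg.comp (φ := fun x => x ^ 2) (ψ := fun x => x ^ 2) (by fun_prop)
    (by fun_prop)).integrable_mul hf.integrable_sq hg.integrable_sq
  refine h.congr (ae_of_all _ fun ω => ?_)
  simp [mul_pow]

/-- Discrete Itô isometry for centred noise. -/
theorem integral_sq_sum_mul_eq [IsProbabilityMeasure P] (G : ℕ → MeasurableSpace Ω)
    (hmono : Monotone G) {θ ζ : ℕ → Ω → ℝ} {v : ℝ}
    (hζ : ∀ k, Measurable[G (k + 1)] (ζ k))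
    (hind : ∀ k, Indep (MeasurableSpace.comap (ζ k) inferInstance) (G k) P)
    (hζ2 : ∀ k, MemLp (ζ k) 2 P) (hμ : ∀ k, ∫ ω, ζ k ω ∂P = 0)
    (hv : ∀ k, ∫ ω, ζ k ω ^ 2 ∂P = v) (K : ℕ)
    (hθ : ∀ k < K, Measurable[G k] (θ k)) (hθ2 : ∀ k < K, MemLp (θ k) 2 P) :
    Measurable[G K] (fun ω => ∑ k ∈ Finset.range K, θ k ω * ζ k ω) ∧
    MemLp (fun ω => ∑ k ∈ Finset.range K, θ k ω * ζ k ω) 2 P ∧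
    ∫ ω, (∑ k ∈ Finset.range K, θ k ω * ζ k ω) ^ 2 ∂P =
      v * ∑ k ∈ Finset.range K, ∫ ω, θ k ω ^ 2 ∂P := by
  induction K with
  | zero => simp
  | succ K ih =>
    obtain ⟨h1, h2, h3⟩ := ih (fun k hk => hθ k (hk.trans K.lt_succ_self))
      (fun k hk => hθ2 k (hk.trans K.lt_succ_self))
    have hθK := hθ K K.lt_succ_self
    have hθ2K := hθ2 K K.lt_succ_self
    have hi := indepFun_of_measurable_of_indep_comap hθK (hind K)
    have hp := memLp_two_mul_of_indepFun hi hθ2K (hζ2 K)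
    simp only [Finset.sum_range_succ]
    refine ⟨?_, h2.add hp, ?_⟩
    · have h1' := h1.mono (hmono K.le_succ) le_rfl
      have hθ' := hθK.mono (hmono K.le_succ) le_rfl
      exact h1'.add (hθ'.mul (hζ K))
    · set M : Ω → ℝ := fun ω => ∑ k ∈ Finset.range K, θ k ω * ζ k ω with hM
      -- The past sum times the new integrand is known at time K, while the new noise is independent
      -- of that past and centred; hence the cross term vanishes.
      have hMθ : IndepFun (fun ω => M ω * θ K ω) (ζ K) P :=
        indepFun_of_measurable_of_indep_comap (h1.mul hθK) (hind K)
      have hMθi : Integrable (fun ω => M ω * θ K ω) P := h2.integrable_mul hθ2K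
      have hcross : ∫ ω, M ω * θ K ω * ζ K ω ∂P = 0 := by
        rw [hMθ.integral_fun_mul_eq_mul_integral hMθi.1 (hζ2 K).1, hμ, mul_zero]
      have hci : Integrable (fun ω => M ω * θ K ω * ζ K ω) P :=
        hMθ.integrable_mul hMθi ((hζ2 K).integrable (by norm_num))
      have hsq : ∫ ω, (θ K ω * ζ K ω) ^ 2 ∂P = (∫ ω, θ K ω ^ 2 ∂P) * v := by
        simp_rw [mul_pow]
        rw [← hv K]
        exact (hi.comp (φ := fun x => x ^ 2) (ψ := fun x => x ^ 2) (by fun_prop)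
          (by fun_prop)).integral_fun_mul_eq_mul_integral hθ2K.integrable_sq.1
            (hζ2 K).integrable_sq.1
      have hexp : ∀ ω, (M ω + θ K ω * ζ K ω) ^ 2 =
          M ω ^ 2 + 2 * (M ω * θ K ω * ζ K ω) + (θ K ω * ζ K ω) ^ 2 := fun ω => by ring
      change ∫ ω, (M ω + θ K ω * ζ K ω) ^ 2 ∂P = _
      simp_rw [hexp]
      have hA : Integrable (fun ω => M ω ^ 2 + 2 * (M ω * θ K ω * ζ K ω)) P :=
        h2.integrable_sq.add (hci.const_mul 2)
      rw [integral_add hA hp.integrable_sq,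
        integral_add h2.integrable_sq (hci.const_mul 2), integral_const_mul, hcross, hsq, h3]
      ring

/-- Second moment of a discrete stochastic integral against independent noise with drift. -/
theorem integral_sq_sum_mul_le [IsProbabilityMeasure P] (G : ℕ → MeasurableSpace Ω)
    (hmono : Monotone G) {θ ζ : ℕ → Ω → ℝ} {μ v : ℝ}
    (hζ : ∀ k, Measurable[G (k + 1)] (ζ k))
    (hind : ∀ k, Indep (MeasurableSpace.comap (ζ k) inferInstance) (G k) P)
    (hζ2 : ∀ k, MemLp (ζ k) 2 P) (hμ : ∀ k, ∫ ω, ζ k ω ∂P = μ)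
    (hv : ∀ k, ∫ ω, ζ k ω ^ 2 ∂P = v) (K : ℕ)
    (hθ : ∀ k < K, Measurable[G k] (θ k)) (hθ2 : ∀ k < K, MemLp (θ k) 2 P) :
    MemLp (fun ω => ∑ k ∈ Finset.range K, θ k ω * ζ k ω) 2 P ∧
    ∫ ω, (∑ k ∈ Finset.range K, θ k ω * ζ k ω) ^ 2 ∂P ≤
      2 * (v + K * μ ^ 2) * ∑ k ∈ Finset.range K, ∫ ω, θ k ω ^ 2 ∂P := by
  have hζ2' : ∀ k, MemLp (fun ω => ζ k ω - μ) 2 P := fun k => (hζ2 k).sub (memLp_const μ)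
  have hv' : ∀ k, ∫ ω, (ζ k ω - μ) ^ 2 ∂P = v - μ ^ 2 := fun k => by
    have hexp : ∀ ω, (ζ k ω - μ) ^ 2 = ζ k ω ^ 2 - 2 * μ * ζ k ω + μ ^ 2 := fun ω => by ring
    have hz := (hζ2 k).integrable (by norm_num : (1 : ℝ≥0∞) ≤ 2)
    have hA : Integrable (fun ω => ζ k ω ^ 2 - 2 * μ * ζ k ω) P :=
      (hζ2 k).integrable_sq.sub (hz.const_mul _)
    simp_rw [hexp]
    rw [integral_add hA (integrable_const _), integral_sub (hζ2 k).integrable_sq (hz.const_mul _),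
      integral_const_mul, hμ, hv]
    simp
    ring
  obtain ⟨-, hM2, hM⟩ := integral_sq_sum_mul_eq (P := P) G hmono (θ := θ)
    (ζ := fun k ω => ζ k ω - μ) (v := v - μ ^ 2)
    (fun k => (hζ k).sub_const μ)
    (fun k => indep_of_indep_of_le_left (hind k) (by
      have : (fun ω => ζ k ω - μ) = (fun x => x - μ) ∘ ζ k := rfl
      rw [this, ← MeasurableSpace.comap_comp]
      exact MeasurableSpace.comap_mono (Measurable.comap_le (by fun_prop))))
    hζ2' (fun k => by
      rw [integral_sub ((hζ2 k).integrable (by norm_num)) (integrable_const _), hμ]; simp)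
    hv' K hθ hθ2
  have hS2 : MemLp (fun ω => ∑ k ∈ Finset.range K, θ k ω) 2 P :=
    memLp_finsetSum _ fun k hk => hθ2 k (Finset.mem_range.1 hk)
  -- The centred part falls under the isometry, with variance v - μ². The drift part is handled by
  -- Cauchy–Schwarz, which costs the factor K.
  have hdec : ∀ ω, ∑ k ∈ Finset.range K, θ k ω * ζ k ω =
      ∑ k ∈ Finset.range K, θ k ω * (ζ k ω - μ) + μ * ∑ k ∈ Finset.range K, θ k ω := fun ω => by
    rw [Finset.mul_sum, ← Finset.sum_add_distrib]
    exact Finset.sum_congr rfl fun k _ => by ring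
  simp_rw [hdec]
  refine ⟨hM2.add (hS2.const_mul μ), ?_⟩
  have hb : ∀ ω, (∑ k ∈ Finset.range K, θ k ω * (ζ k ω - μ) +
        μ * ∑ k ∈ Finset.range K, θ k ω) ^ 2 ≤
      2 * (∑ k ∈ Finset.range K, θ k ω * (ζ k ω - μ)) ^ 2 +
        2 * μ ^ 2 * (K * ∑ k ∈ Finset.range K, θ k ω ^ 2) := fun ω => by
    have h1 := add_sq_le (a := ∑ k ∈ Finset.range K, θ k ω * (ζ k ω - μ))
      (b := μ * ∑ k ∈ Finset.range K, θ k ω)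
    have h2 := sq_sum_le_card_mul_sum_sq (s := Finset.range K) (f := fun k => θ k ω)
    rw [Finset.card_range] at h2
    nlinarith [mul_le_mul_of_nonneg_left h2 (sq_nonneg μ)]
  have hsum : Integrable (fun ω => ∑ k ∈ Finset.range K, θ k ω ^ 2) P :=
    integrable_finsetSum _ fun k hk => (hθ2 k (Finset.mem_range.1 hk)).integrable_sq
  have hnn : 0 ≤ ∑ k ∈ Finset.range K, ∫ ω, θ k ω ^ 2 ∂P :=
    Finset.sum_nonneg fun k _ => integral_nonneg fun ω => sq_nonneg _
  calc _ ≤ ∫ ω, (2 * (∑ k ∈ Finset.range K, θ k ω * (ζ k ω - μ)) ^ 2 +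
        2 * μ ^ 2 * (K * ∑ k ∈ Finset.range K, θ k ω ^ 2)) ∂P :=
        integral_mono (hM2.add (hS2.const_mul μ)).integrable_sq
          ((hM2.integrable_sq.const_mul 2).add ((hsum.const_mul _).const_mul _)) hb
    _ = 2 * ((v - μ ^ 2) * ∑ k ∈ Finset.range K, ∫ ω, θ k ω ^ 2 ∂P) +
        2 * μ ^ 2 * (K * ∑ k ∈ Finset.range K, ∫ ω, θ k ω ^ 2 ∂P) := by
        rw [integral_add (hM2.integrable_sq.const_mul 2) ((hsum.const_mul _).const_mul _),
          integral_const_mul, integral_const_mul, integral_const_mul, hM,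
          integral_finsetSum _ fun k hk => (hθ2 k (Finset.mem_range.1 hk)).integrable_sq]
    _ ≤ _ := by nlinarith [mul_nonneg (sq_nonneg μ) hnn]

end DiscreteIsometry

/-! ### Exponential tilting of Gaussian measures. -/

section GaussianTilt

/-- Exponential tilting of a Gaussian measure shifts its mean. -/
theorem gaussianReal_withDensity_exp (μ t : ℝ) (v : ℝ≥0) :
    (gaussianReal μ v).withDensity
      (fun x => ENNReal.ofReal (Real.exp (t * x - μ * t - v * t ^ 2 / 2))) =
      gaussianReal (μ + v * t) v := by
  by_cases hv : v = 0
  · subst hv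
    simp only [gaussianReal_zero_var]
    ext s hs
    rw [withDensity_apply _ hs, ← lintegral_indicator hs, lintegral_dirac' _ (by
      refine Measurable.indicator (by fun_prop) hs)]
    rw [Measure.dirac_apply' _ hs]
    simp only [Set.indicator]
    split_ifs <;> simp_all [mul_comm]
  · rw [gaussianReal_of_var_ne_zero _ hv, gaussianReal_of_var_ne_zero _ hv,
      ← withDensity_mul _ (measurable_gaussianPDF _ _) (by fun_prop)]
    congr 1
    ext x
    simp only [Pi.mul_apply, gaussianPDF, gaussianPDFReal]
    rw [← ENNReal.ofReal_mul (by positivity), mul_assoc, ← Real.exp_add]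
    congr 3
    have : (v : ℝ) ≠ 0 := by exact_mod_cast hv
    field_simp
    ring

/-- Tilting turns the exponential weight into a shift of the mean. The moments of the one-step
factors and the lognormal prices below are all computed this way. -/
theorem integral_exp_mul_gaussianReal (f : ℝ → ℝ) (μ t : ℝ) (v : ℝ≥0) :
    ∫ x, Real.exp (t * x) * f x ∂gaussianReal μ v =
      Real.exp (μ * t + v * t ^ 2 / 2) * ∫ x, f x ∂gaussianReal (μ + v * t) v := by
  rw [← gaussianReal_withDensity_exp,
    integral_withDensity_eq_integral_toReal_smul (by fun_prop) (by simp), ← integral_const_mul]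
  refine integral_congr_ae (ae_of_all _ fun x => ?_)
  simp only [smul_eq_mul]
  rw [ENNReal.toReal_ofReal (Real.exp_pos _).le, ← mul_assoc, ← Real.exp_add]
  ring_nf

theorem integrable_exp_mul_gaussianReal_iff (f : ℝ → ℝ) (μ t : ℝ) (v : ℝ≥0) :
    Integrable (fun x => Real.exp (t * x) * f x) (gaussianReal μ v) ↔
      Integrable f (gaussianReal (μ + v * t) v) := by
  rw [← gaussianReal_withDensity_exp,
    integrable_withDensity_iff_integrable_smul' (by fun_prop) (by simp)]
  have hc : Real.exp (- μ * t - v * t ^ 2 / 2) ≠ 0 := (Real.exp_pos _).ne'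
  rw [← integrable_const_mul_iff (IsUnit.mk0 _ hc)]
  refine integrable_congr (ae_of_all _ fun x => ?_)
  simp only [smul_eq_mul]
  rw [ENNReal.toReal_ofReal (Real.exp_pos _).le, ← mul_assoc, ← Real.exp_add]
  ring_nf

theorem integrable_sq_add_one_gaussianReal (μ : ℝ) (v : ℝ≥0) :
    Integrable (fun x => (1 + x) ^ 2) (gaussianReal μ v) := by
  have h2 : MemLp (fun x : ℝ => x) 2 (gaussianReal μ v) := memLp_id_gaussianReal' 2 (by simp)
  exact MemLp.integrable_sq ((memLp_const (1 : ℝ)).add h2)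

theorem integral_sq_add_one_gaussianReal (μ : ℝ) (v : ℝ≥0) :
    ∫ x, (1 + x) ^ 2 ∂gaussianReal μ v = (1 + μ) ^ 2 + v := by
  have h2 : MemLp (fun x : ℝ => x) 2 (gaussianReal μ v) := memLp_id_gaussianReal' 2 (by simp)
  have h := variance_eq_sub h2
  rw [variance_fun_id_gaussianReal, integral_id_gaussianReal] at h
  have hexp : ∀ x : ℝ, (1 + x) ^ 2 = 1 + 2 * x + x ^ 2 := fun x => by ring
  have h1 := h2.integrable (by norm_num : (1 : ℝ≥0∞) ≤ 2)
  have hA : Integrable (fun x : ℝ => 1 + 2 * x) (gaussianReal μ v) :=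
    (integrable_const 1).add (h1.const_mul 2)
  simp_rw [hexp]
  rw [integral_add hA h2.integrable_sq, integral_add (integrable_const _) (h1.const_mul 2),
    integral_const_mul, integral_id_gaussianReal]
  simp only [Pi.pow_apply] at h
  simp
  linarith

end GaussianTilt

/-! ### Moments of the one-step factors. -/

section GaussianMoments

/-- Here x stands for the increment of the driver over one grid cell and c for its variance. The
exponential is the factor gained by `invSol` and 1 + x is the factor of an Euler step, so the
product should be close to 1. -/
theorem memLp_two_exp_mul_add_one (μ : ℝ) (c : ℝ≥0) :
    MemLp (fun x : ℝ => Real.exp (-(x - c / 2)) * (1 + x)) 2 (gaussianReal μ c) := by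
  refine (memLp_two_iff_integrable_sq (by fun_prop)).2 ?_
  have h := ((integrable_exp_mul_gaussianReal_iff (fun x => (1 + x) ^ 2) μ (-2) c).2
    (integrable_sq_add_one_gaussianReal _ _)).const_mul (Real.exp c)
  refine h.congr (ae_of_all _ fun x => ?_)
  simp only [mul_pow, ← Real.exp_nat_mul]
  rw [← mul_assoc, ← Real.exp_add]
  congr 2
  push_cast
  ring

theorem integral_exp_mul_add_one (μ : ℝ) (c : ℝ≥0) :
    ∫ x : ℝ, Real.exp (-(x - c / 2)) * (1 + x) ∂gaussianReal μ c =
      Real.exp (c - μ) * (1 + μ - c) := by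
  have h := integral_exp_mul_gaussianReal (fun x => 1 + x) μ (-1) c
  have h2 : MemLp (fun x : ℝ => x) 2 (gaussianReal (μ + c * (-1)) c) :=
    memLp_id_gaussianReal' 2 (by simp)
  rw [integral_add (integrable_const _) (h2.integrable (by norm_num)),
    integral_id_gaussianReal] at h
  have hx : ∀ x : ℝ, Real.exp (-(x - c / 2)) * (1 + x) =
      Real.exp (c / 2) * (Real.exp (-1 * x) * (1 + x)) := fun x => by
    rw [← mul_assoc, ← Real.exp_add]; ring_nf
  simp_rw [hx]
  rw [integral_const_mul, h, ← mul_assoc, ← Real.exp_add]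
  simp
  ring_nf

theorem integral_sq_exp_mul_add_one (μ : ℝ) (c : ℝ≥0) :
    ∫ x : ℝ, (Real.exp (-(x - c / 2)) * (1 + x)) ^ 2 ∂gaussianReal μ c =
      Real.exp (3 * c - 2 * μ) * ((1 + μ - 2 * c) ^ 2 + c) := by
  have h := integral_exp_mul_gaussianReal (fun x => (1 + x) ^ 2) μ (-2) c
  rw [integral_sq_add_one_gaussianReal] at h
  have hx : ∀ x : ℝ, (Real.exp (-(x - c / 2)) * (1 + x)) ^ 2 =
      Real.exp c * (Real.exp (-2 * x) * (1 + x) ^ 2) := fun x => by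
    rw [mul_pow, ← mul_assoc, ← Real.exp_add, ← Real.exp_nat_mul]; push_cast; ring_nf
  simp_rw [hx]
  rw [integral_const_mul, h, ← mul_assoc, ← Real.exp_add]
  ring_nf

theorem memLp_two_exp_neg (μ : ℝ) (c : ℝ≥0) :
    MemLp (fun x : ℝ => Real.exp (-(x - c / 2))) 2 (gaussianReal μ c) := by
  refine (memLp_two_iff_integrable_sq (by fun_prop)).2 ?_
  refine ((integrable_exp_mul_gaussianReal (-2)).const_mul (Real.exp c)).congr
    (ae_of_all _ fun x => ?_)
  simp only [← Real.exp_nat_mul]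
  rw [← Real.exp_add]
  push_cast
  ring_nf

theorem integral_exp_neg (μ : ℝ) (c : ℝ≥0) :
    ∫ x : ℝ, Real.exp (-(x - c / 2)) ∂gaussianReal μ c = Real.exp (c - μ) := by
  have h := integral_exp_mul_gaussianReal (fun _ => 1) μ (-1) c
  have hx : ∀ x : ℝ, Real.exp (-(x - c / 2)) =
      Real.exp (c / 2) * (Real.exp (-1 * x) * 1) := fun x => by
    rw [mul_one, ← Real.exp_add]; ring_nf
  simp_rw [hx]
  rw [integral_const_mul, h, ← mul_assoc, ← Real.exp_add]
  simp
  ring_nf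

theorem integral_sq_exp_neg (μ : ℝ) (c : ℝ≥0) :
    ∫ x : ℝ, Real.exp (-(x - c / 2)) ^ 2 ∂gaussianReal μ c = Real.exp (3 * c - 2 * μ) := by
  have h := integral_exp_mul_gaussianReal (fun _ => 1) μ (-2) c
  have hx : ∀ x : ℝ, Real.exp (-(x - c / 2)) ^ 2 =
      Real.exp c * (Real.exp (-2 * x) * 1) := fun x => by
    rw [mul_one, ← Real.exp_add, ← Real.exp_nat_mul]; push_cast; ring_nf
  simp_rw [hx]
  rw [integral_const_mul, h, ← mul_assoc, ← Real.exp_add]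
  simp
  ring_nf

theorem integral_sub_one {P : Measure ℝ} [IsProbabilityMeasure P] {f : ℝ → ℝ} (hf : MemLp f 2 P) :
    ∫ x, (f x - 1) ∂P = ∫ x, f x ∂P - 1 := by
  rw [integral_sub (hf.integrable (by norm_num)) (integrable_const _)]; simp

theorem integral_sq_sub_one {P : Measure ℝ} [IsProbabilityMeasure P] {f : ℝ → ℝ}
    (hf : MemLp f 2 P) :
    ∫ x, (f x - 1) ^ 2 ∂P = ∫ x, f x ^ 2 ∂P - 2 * ∫ x, f x ∂P + 1 := by
  have hexp : ∀ x, (f x - 1) ^ 2 = f x ^ 2 - 2 * f x + 1 := fun x => by ring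
  have h1 := hf.integrable (by norm_num : (1 : ℝ≥0∞) ≤ 2)
  have hA : Integrable (fun x => f x ^ 2 - 2 * f x) P := hf.integrable_sq.sub (h1.const_mul 2)
  simp_rw [hexp]
  rw [integral_add hA (integrable_const _), integral_sub hf.integrable_sq (h1.const_mul 2),
    integral_const_mul]
  simp

theorem integral_sq_id_gaussianReal (μ : ℝ) (c : ℝ≥0) :
    ∫ x : ℝ, x ^ 2 ∂gaussianReal μ c = μ ^ 2 + c := by
  have h2 : MemLp (fun x : ℝ => x) 2 (gaussianReal μ c) := memLp_id_gaussianReal' 2 (by simp)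
  have h := variance_eq_sub h2
  rw [variance_fun_id_gaussianReal, integral_id_gaussianReal] at h
  simp only [Pi.pow_apply] at h
  linarith

/-- The left side is T times a difference quotient of F at 0. It serves to add up K equal
contributions F(T/K), one for each cell. -/
theorem tendsto_natCast_mul_of_hasDerivAt {F : ℝ → ℝ} {c T : ℝ} (hT : 0 < T) (h0 : F 0 = 0)
    (hF : HasDerivAt F c 0) :
    Tendsto (fun K : ℕ => K * F (T / K)) atTop (𝓝 (T * c)) := by
  have h1 := hF.tendsto_slope_zero
  have h2 : Tendsto (fun K : ℕ => T / (K : ℝ)) atTop (𝓝[≠] 0) := by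
    refine tendsto_nhdsWithin_iff.2 ⟨tendsto_const_div_atTop_nhds_zero_nat T, ?_⟩
    filter_upwards [eventually_gt_atTop 0] with K hK
    have : (0 : ℝ) < K := by exact_mod_cast hK
    exact (div_pos hT this).ne'
  refine ((h1.comp h2).const_mul T).congr' ?_
  filter_upwards [eventually_gt_atTop 0] with K hK
  have : (0 : ℝ) < K := by exact_mod_cast hK
  simp only [Function.comp, h0, zero_add, sub_zero, smul_eq_mul]
  field_simp

end GaussianMoments

/-! ### Second moment bounds under convergence in measure. -/

section Fatou

variable {Ω : Type*} {m : MeasurableSpace Ω} {P : Measure Ω}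

theorem eLpNorm_two_le_of_integral_sq_le {f : Ω → ℝ} {B : ℝ} (hf : MemLp f 2 P)
    (h : ∫ ω, f ω ^ 2 ∂P ≤ B) : eLpNorm f 2 P ≤ ENNReal.ofReal (√B) := by
  rw [hf.eLpNorm_eq_integral_rpow_norm (by norm_num) (by norm_num)]
  refine ENNReal.ofReal_le_ofReal ?_
  simp only [ENNReal.toReal_ofNat, Real.rpow_ofNat, Real.norm_eq_abs, sq_abs]
  rw [Real.sqrt_eq_rpow, one_div]
  gcongr

theorem integral_sq_le_of_eLpNorm_two_le {f : Ω → ℝ} {B : ℝ} (hB : 0 ≤ B)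
    (hf : AEStronglyMeasurable f P) (h : eLpNorm f 2 P ≤ ENNReal.ofReal (√B)) :
    MemLp f 2 P ∧ ∫ ω, f ω ^ 2 ∂P ≤ B := by
  have hm : MemLp f 2 P := ⟨hf, h.trans_lt ENNReal.ofReal_lt_top⟩
  refine ⟨hm, ?_⟩
  rw [hm.eLpNorm_eq_integral_rpow_norm (by norm_num) (by norm_num)] at h
  rw [ENNReal.ofReal_le_ofReal_iff (Real.sqrt_nonneg _)] at h
  simp only [ENNReal.toReal_ofNat, Real.rpow_ofNat, Real.norm_eq_abs, sq_abs] at h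
  rw [inv_eq_one_div, ← Real.sqrt_eq_rpow] at h
  exact (Real.sqrt_le_sqrt_iff hB).1 h

/-- The L² norm is lower semicontinuous for convergence in measure. This carries bounds for Itô sums
on ever finer grids over to the Itô integral. -/
theorem integral_sq_le_of_tendstoInMeasure {f : ℕ → Ω → ℝ} {g : Ω → ℝ} {B : ℝ} (hB : 0 ≤ B)
    (hf : ∀ i, MemLp (f i) 2 P) (hfB : ∀ i, ∫ ω, f i ω ^ 2 ∂P ≤ B)
    (h : TendstoInMeasure P f atTop g) : MemLp g 2 P ∧ ∫ ω, g ω ^ 2 ∂P ≤ B :=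
  integral_sq_le_of_eLpNorm_two_le hB (h.aestronglyMeasurable fun i => (hf i).1)
    (eLpNorm_le_of_tendstoInMeasure
      (Eventually.of_forall fun i => eLpNorm_two_le_of_integral_sq_le (hf i) (hfB i)) h
      fun i => (hf i).1)

end Fatou

/-! ### The equation dY = Y dA: grids, localization and truncation. -/

section LinearSde

/-- The point `l T / N` of the uniform grid with `N` intervals on `[0, T]`. -/
noncomputable def grid (T : ℝ≥0) (N l : ℕ) : ℝ≥0 := l * T / N

theorem grid_mono (T : ℝ≥0) (N : ℕ) : Monotone (grid T N) := fun k l h => by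
  unfold grid; gcongr

@[simp] theorem grid_zero (T : ℝ≥0) (N : ℕ) : grid T N 0 = 0 := by simp [grid]

theorem grid_self (T : ℝ≥0) {N : ℕ} (hN : 0 < N) : grid T N N = T := by
  have : (N : ℝ≥0) ≠ 0 := by exact_mod_cast hN.ne'
  unfold grid; field_simp

theorem grid_mul_mul (T : ℝ≥0) (K k : ℕ) {M : ℕ} (hM : 0 < M) :
    grid T (K * M) (k * M) = grid T K k := by
  have : (M : ℝ≥0) ≠ 0 := by exact_mod_cast hM.ne'
  unfold grid; push_cast
  rw [mul_right_comm, mul_div_mul_right _ _ this]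

theorem grid_succ (T : ℝ≥0) (N l : ℕ) : grid T N (l + 1) = grid T N l + T / N := by
  unfold grid; push_cast; rw [add_mul, add_div, one_mul]

theorem grid_le (T : ℝ≥0) {N l : ℕ} (h : l ≤ N) : grid T N l ≤ T := by
  rcases N.eq_zero_or_pos with rfl | hN
  · simp [grid]
  · exact (grid_mono T N h).trans_eq (grid_self T hN)

variable {Ω : Type*} {m : MeasurableSpace Ω}

/-- Cutting [0, kT/K] into kM intervals produces cells of length T/(KM), so these sums run over an
initial piece of a refinement of the coarse grid on [0, T]. -/
theorem itoSum_grid (Y A : ℝ≥0 → Ω → ℝ) (T : ℝ≥0) (K : ℕ) {k M : ℕ} (hk : 0 < k) (ω : Ω) :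
    itoSum Y A (grid T K k) (k * M) ω = ∑ l ∈ Finset.range (k * M),
      Y (grid T (K * M) l) ω * (A (grid T (K * M) (l + 1)) ω - A (grid T (K * M) l) ω) := by
  have hk' : (k : ℝ≥0) ≠ 0 := by exact_mod_cast hk.ne'
  have h : ∀ x : ℝ≥0, x * grid T K k / ((k * M : ℕ) : ℝ≥0) = x * T / ((K * M : ℕ) : ℝ≥0) := by
    intro x
    unfold grid
    push_cast
    rw [← mul_div_assoc, mul_left_comm, mul_div_assoc, mul_div_mul_left _ _ hk', div_div]
  unfold itoSum
  refine Finset.sum_congr rfl fun l _ => ?_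
  rw [h, h]
  unfold grid
  push_cast
  rfl

/-- The factor f depends only on the coarse cell, so the fine increments inside each cell telescope.
-/
theorem sum_range_mul_div (f : ℕ → ℝ) (g : ℕ → ℝ) (k : ℕ) {M : ℕ} (hM : 0 < M) :
    ∑ l ∈ Finset.range (k * M), f (l / M) * (g (l + 1) - g l) =
      ∑ l ∈ Finset.range k, f l * (g ((l + 1) * M) - g (l * M)) := by
  induction k with
  | zero => simp
  | succ k ih =>
    rw [add_mul, one_mul, Finset.sum_range_add, ih, Finset.sum_range_succ]
    congr 1
    have h : ∀ i ∈ Finset.range M, f ((k * M + i) / M) * (g (k * M + i + 1) - g (k * M + i)) =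
        f k * (g (k * M + (i + 1)) - g (k * M + i)) := fun i hi => by
      rw [add_comm (k * M) i, Nat.add_mul_div_right _ _ hM,
        Nat.div_eq_of_lt (Finset.mem_range.1 hi), zero_add]
      congr 3
      ring
    rw [Finset.sum_congr rfl h, ← Finset.mul_sum,
      Finset.sum_range_sub (fun i => g (k * M + i)) M]
    congr 3
    ring

/-- `Y` solves `dY = Y dA`, `Y_0 = 1`, where `A` is a Brownian motion with drift `a` and variance
`v` per unit of time. -/
structure SolvesExpSDE (ℱ : Filtration ℝ≥0 m) (P : Measure Ω) (a : ℝ) (v : ℝ≥0)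
    (A Y : ℝ≥0 → Ω → ℝ) : Prop where
  noise_adapted : ∀ t, Measurable[ℱ t] (A t)
  noise_indep : ∀ s t, s ≤ t →
    Indep (MeasurableSpace.comap (fun ω => A t ω - A s ω) inferInstance) (ℱ s) P
  noise_law : ∀ s u, P.map (fun ω => A (s + u) ω - A s ω) = gaussianReal (a * u) (v * u)
  noise_zero : ∀ᵐ ω ∂P, A 0 ω = 0
  noise_cont : ∀ᵐ ω ∂P, Continuous fun t => A t ω
  adapted : ∀ t, Measurable[ℱ t] (Y t)
  cont : ∀ᵐ ω ∂P, Continuous fun t => Y t ω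
  initial : ∀ᵐ ω ∂P, Y 0 ω = 1
  sde : ∀ t, TendstoInMeasure P (itoSum Y A t) atTop fun ω => Y t ω - 1

/-- The reciprocal of the explicit solution of `dY = Y dA`. -/
noncomputable def invSol (v : ℝ≥0) (A : ℝ≥0 → Ω → ℝ) (t : ℝ≥0) (ω : Ω) : ℝ :=
  Real.exp (-(A t ω - v * t / 2))

/-- Both processes are bounded by `C` at the rational multiples of `T` up to time `t`. -/
def locSet (T v : ℝ≥0) (A Y : ℝ≥0 → Ω → ℝ) (C : ℝ) (t : ℝ≥0) : Set Ω :=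
  ⋂ (N : ℕ) (l : ℕ) (_ : grid T N l ≤ t),
    {ω | |Y (grid T N l) ω| ≤ C ∧ invSol v A (grid T N l) ω ≤ C}

/-- The difference of `Y - 1` and the Riemann sum over the coarse grid. -/
noncomputable def stepErr (T : ℝ≥0) (A Y : ℝ≥0 → Ω → ℝ) (K k : ℕ) (ω : Ω) : ℝ :=
  Y (grid T K k) ω - 1 -
    ∑ l ∈ Finset.range k, Y (grid T K l) ω * (A (grid T K (l + 1)) ω - A (grid T K l) ω)

/-- Truncation to `[-C, C]`. -/
def clip (C x : ℝ) : ℝ := max (-C) (min C x)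

theorem continuous_clip (C : ℝ) : Continuous (clip C) := by unfold clip; fun_prop

theorem abs_clip_le {C : ℝ} (hC : 0 ≤ C) (x : ℝ) : |clip C x| ≤ C := by
  unfold clip
  rw [abs_le]
  exact ⟨le_max_left _ _, max_le (by linarith) (min_le_left _ _)⟩

theorem clip_eq_self {C x : ℝ} (h : |x| ≤ C) : clip C x = x := by
  rw [abs_le] at h
  unfold clip
  rw [min_eq_right h.2, max_eq_right h.1]

theorem locSet_antitone (T v : ℝ≥0) (A Y : ℝ≥0 → Ω → ℝ) (C : ℝ) :
    Antitone (locSet T v A Y C) := fun s t hst ω h => by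
  simp only [locSet, Set.mem_iInter] at h ⊢
  exact fun N l hl => h N l (hl.trans hst)

theorem locSet_spec {T v : ℝ≥0} {A Y : ℝ≥0 → Ω → ℝ} {C : ℝ} {t : ℝ≥0} {ω : Ω}
    (h : ω ∈ locSet T v A Y C t) {N l : ℕ} (hl : grid T N l ≤ t) :
    |Y (grid T N l) ω| ≤ C ∧ invSol v A (grid T N l) ω ≤ C := by
  simp only [locSet, Set.mem_iInter] at h
  exact h N l hl

variable {ℱ : Filtration ℝ≥0 m} {P : Measure Ω} {a : ℝ} {v : ℝ≥0}
  {A Y : ℝ≥0 → Ω → ℝ}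

namespace SolvesExpSDE

theorem measurable_noise (h : SolvesExpSDE ℱ P a v A Y) (t : ℝ≥0) : Measurable (A t) := (h.noise_adapted t).mono (ℱ.le t) le_rfl

theorem measurable (h : SolvesExpSDE ℱ P a v A Y) (t : ℝ≥0) : Measurable (Y t) := (h.adapted t).mono (ℱ.le t) le_rfl

theorem measurable_invSol (h : SolvesExpSDE ℱ P a v A Y) (t : ℝ≥0) : Measurable[ℱ t] (invSol v A t) := by
  have := h.noise_adapted t
  unfold invSol
  fun_prop

/-- Only countably many deterministic times up to t enter the localization, so it is an event known
at time t and no stopping times are needed. -/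
theorem measurableSet_locSet (h : SolvesExpSDE ℱ P a v A Y) (T : ℝ≥0) (C : ℝ) (t : ℝ≥0) :
    MeasurableSet[ℱ t] (locSet T v A Y C t) := by
  refine MeasurableSet.iInter fun N => MeasurableSet.iInter fun l => MeasurableSet.iInter fun hl =>
    ?_
  have h1 := (h.adapted (grid T N l)).mono (ℱ.mono hl) le_rfl
  have h2 := (h.measurable_invSol (grid T N l)).mono (ℱ.mono hl) le_rfl
  exact (measurableSet_le (continuous_abs.measurable.comp h1) measurable_const).inter
    (measurableSet_le h2 measurable_const)

theorem measurable_stepErr (h : SolvesExpSDE ℱ P a v A Y) (T : ℝ≥0) (K k : ℕ) :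
    Measurable[ℱ (grid T K k)] (stepErr T A Y K k) := by
  have hY : ∀ l ≤ k, Measurable[ℱ (grid T K k)] (Y (grid T K l)) := fun l hl =>
    (h.adapted _).mono (ℱ.mono (grid_mono T K hl)) le_rfl
  have hA : ∀ l ≤ k, Measurable[ℱ (grid T K k)] (A (grid T K l)) := fun l hl =>
    (h.noise_adapted _).mono (ℱ.mono (grid_mono T K hl)) le_rfl
  refine ((hY k le_rfl).sub_const 1).sub (Finset.measurable_fun_sum _ fun l hl => ?_)
  have hl' := Finset.mem_range.1 hl
  exact (hY l hl'.le).mul ((hA (l + 1) hl').sub (hA l hl'.le))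

theorem increment_law (h : SolvesExpSDE ℱ P a v A Y) (T : ℝ≥0) (N l : ℕ) :
    P.map (fun ω => A (grid T N (l + 1)) ω - A (grid T N l) ω) =
      gaussianReal (a * (T / N)) (v * (T / N)) := by
  have := h.noise_law (grid T N l) (T / N)
  rw [grid_succ]
  simpa using this

theorem increment_indep (h : SolvesExpSDE ℱ P a v A Y) (f : ℝ → ℝ) (hf : Measurable f) (T : ℝ≥0) (N l : ℕ) :
    Indep (MeasurableSpace.comap
      (fun ω => f (A (grid T N (l + 1)) ω - A (grid T N l) ω)) inferInstance)
      (ℱ (grid T N l)) P := by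
  refine indep_of_indep_of_le_left
    (h.noise_indep (grid T N l) (grid T N (l + 1)) (grid_mono T N l.le_succ)) ?_
  have : (fun ω => f (A (grid T N (l + 1)) ω - A (grid T N l) ω)) =
    f ∘ fun ω => A (grid T N (l + 1)) ω - A (grid T N l) ω := rfl
  rw [this, ← MeasurableSpace.comap_comp]
  exact MeasurableSpace.comap_mono hf.comap_le

/-- The discrete second moment bound for sums against a function of the increments of `A`. -/
theorem integral_sq_sum_le [IsProbabilityMeasure P] (h : SolvesExpSDE ℱ P a v A Y) {f : ℝ → ℝ} (hf : Measurable f) (T : ℝ≥0) (N : ℕ)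
    (hf2 : MemLp f 2 (gaussianReal (a * (T / N)) (v * (T / N)))) (K : ℕ) {θ : ℕ → Ω → ℝ}
    (hθ : ∀ k < K, Measurable[ℱ (grid T N k)] (θ k)) (hθ2 : ∀ k < K, MemLp (θ k) 2 P) :
    MemLp (fun ω => ∑ k ∈ Finset.range K,
        θ k ω * f (A (grid T N (k + 1)) ω - A (grid T N k) ω)) 2 P ∧
    ∫ ω, (∑ k ∈ Finset.range K,
        θ k ω * f (A (grid T N (k + 1)) ω - A (grid T N k) ω)) ^ 2 ∂P ≤
      2 * (∫ x, f x ^ 2 ∂gaussianReal (a * (T / N)) (v * (T / N)) +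
        K * (∫ x, f x ∂gaussianReal (a * (T / N)) (v * (T / N))) ^ 2) *
        ∑ k ∈ Finset.range K, ∫ ω, θ k ω ^ 2 ∂P := by
  have hinc : ∀ k, Measurable (fun ω => A (grid T N (k + 1)) ω - A (grid T N k) ω) := fun k =>
    (h.measurable_noise _).sub (h.measurable_noise _)
  refine integral_sq_sum_mul_le (fun k => ℱ (grid T N k))
    (fun k l hkl => ℱ.mono (grid_mono T N hkl)) (θ := θ)
    (ζ := fun k ω => f (A (grid T N (k + 1)) ω - A (grid T N k) ω)) (fun k => ?_)
    (fun k => h.increment_indep f hf T N k) (fun k => ?_) (fun k => ?_) (fun k => ?_) K hθ hθ2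
  · have h1 := h.noise_adapted (grid T N (k + 1))
    have h2 := (h.noise_adapted (grid T N k)).mono (ℱ.mono (grid_mono T N k.le_succ)) le_rfl
    exact hf.comp (h1.sub h2)
  · rw [← h.increment_law T N k] at hf2
    exact (memLp_map_measure_iff hf2.1 (hinc k).aemeasurable).1 hf2
  · rw [← h.increment_law T N k, integral_map (hinc k).aemeasurable hf.aestronglyMeasurable]
  · rw [← h.increment_law T N k,
      integral_map (hinc k).aemeasurable (hf.pow_const 2).aestronglyMeasurable]

/-- Clipping makes the process bounded, so dominated convergence turns continuity of the paths into
continuity of the mean squared difference as a function of (s, t). This function vanishes on the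
diagonal and is uniformly continuous on the compact square. -/
theorem exists_modulus [IsProbabilityMeasure P] (h : SolvesExpSDE ℱ P a v A Y) {C : ℝ} (hC : 0 ≤ C) (T : ℝ≥0) {ε : ℝ} (hε : 0 < ε) :
    ∃ δ > 0, ∀ s t : ℝ≥0, s ≤ T → t ≤ T → dist s t < δ →
      ∫ ω, (clip C (Y s ω) - clip C (Y t ω)) ^ 2 ∂P ≤ ε := by
  set ψ : ℝ≥0 × ℝ≥0 → ℝ := fun p => ∫ ω, (clip C (Y p.1 ω) - clip C (Y p.2 ω)) ^ 2 ∂P with hψ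
  have hcont : Continuous ψ := by
    refine continuous_of_dominated (bound := fun _ => (2 * C) ^ 2) (fun p => ?_) (fun p => ?_)
      (integrable_const _) ?_
    · have h1 := h.measurable p.1
      have h2 := h.measurable p.2
      have h3 := (continuous_clip C).measurable
      exact (((h3.comp h1).sub (h3.comp h2)).pow_const 2).aestronglyMeasurable
    · refine ae_of_all _ fun ω => ?_
      rw [Real.norm_eq_abs, abs_pow]
      have h1 := abs_clip_le hC (Y p.1 ω)
      have h2 := abs_clip_le hC (Y p.2 ω)
      have h3 := abs_sub (clip C (Y p.1 ω)) (clip C (Y p.2 ω))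
      gcongr
      linarith
    · filter_upwards [h.cont] with ω hω
      have h3 := continuous_clip C
      fun_prop
  have hu := (isCompact_Icc (a := (0 : ℝ≥0)) (b := T)).prod (isCompact_Icc (a := (0 : ℝ≥0)) (b := T))
    |>.uniformContinuousOn_of_continuous hcont.continuousOn
  rw [Metric.uniformContinuousOn_iff] at hu
  obtain ⟨δ, hδ, H⟩ := hu ε hε
  refine ⟨δ, hδ, fun s t hs ht hst => ?_⟩
  have := H (s, t) ⟨⟨zero_le, hs⟩, zero_le, ht⟩ (t, t) ⟨⟨zero_le, ht⟩, zero_le, ht⟩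
    (by rw [Prod.dist_eq, dist_self]; exact max_lt hst hδ)
  have h0 : ψ (t, t) = 0 := by simp [hψ]
  rw [h0, Real.dist_eq, sub_zero] at this
  exact (le_abs_self _).trans this.le

end SolvesExpSDE
end LinearSde

/-! ### The error of coarse Riemann sums and the discrete product rule. -/

section LinearSde

variable {Ω : Type*} {m : MeasurableSpace Ω} {ℱ : Filtration ℝ≥0 m} {P : Measure Ω} {a : ℝ}
  {v : ℝ≥0} {A Y : ℝ≥0 → Ω → ℝ}

theorem dist_grid_le (T : ℝ≥0) (K l : ℕ) {M : ℕ} (hM : 0 < M) :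
    dist (grid T (K * M) l) (grid T K (l / M)) ≤ T / K := by
  have h1 : grid T K (l / M) ≤ grid T (K * M) l := by
    rw [← grid_mul_mul T K (l / M) hM]
    exact grid_mono T _ (Nat.div_mul_le_self l M)
  have h2 : grid T (K * M) l ≤ grid T K (l / M) + T / K := by
    rw [← grid_succ, ← grid_mul_mul T K (l / M + 1) hM]
    refine grid_mono T _ ?_
    have := Nat.div_add_mod l M
    have h3 := Nat.mod_lt l hM
    nlinarith
  have h1' : (grid T K (l / M) : ℝ) ≤ grid T (K * M) l := by exact_mod_cast h1
  have h2' : (grid T (K * M) l : ℝ) ≤ grid T K (l / M) + T / K := by exact_mod_cast h2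
  rw [NNReal.dist_eq, abs_le]
  constructor
  · have : (0 : ℝ) ≤ T / K := by positivity
    linarith
  · linarith

theorem MeasureTheory.TendstoInMeasure.sub_fun {f : ℕ → Ω → ℝ} {g : Ω → ℝ}
    (hf : TendstoInMeasure P f atTop g) (c : Ω → ℝ) :
    TendstoInMeasure P (fun i ω => f i ω - c ω) atTop (fun ω => g ω - c ω) := by
  intro ε hε
  simpa only [edist_sub_right] using hf ε hε

namespace SolvesExpSDE

/-- On the localization event the error is the limit of Itô sums over refinements whose integrand is
Y at the fine point minus Y at the preceding coarse point. Clipping changes nothing there. The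
clipped integrand is small in L² by `exists_modulus`, the second moment bound makes the sums small
uniformly in the refinement, and Fatou's lemma passes to the limit. -/
theorem stepErr_bound [IsProbabilityMeasure P] (h : SolvesExpSDE ℱ P a v A Y) (T : ℝ≥0) {C : ℝ}
    (hC : 0 ≤ C) {ε : ℝ} (hε : 0 < ε) :
    ∀ᶠ K : ℕ in atTop, ∀ k ≤ K,
      MemLp ((locSet T v A Y C (grid T K k)).indicator (stepErr T A Y K k)) 2 P ∧
      ∫ ω, (locSet T v A Y C (grid T K k)).indicator (stepErr T A Y K k) ω ^ 2 ∂P ≤ ε := by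
  -- For N = KM cells the second moment bound has prefactor at most 2(2a²T² + vT)/N, and the squared
  -- integrands sum to at most Nε/D. The summand 1 keeps D positive.
  set D : ℝ := 2 * (2 * a ^ 2 * T ^ 2 + v * T) + 1 with hD
  have hDpos : 0 < D := by positivity
  obtain ⟨δ, hδ, H⟩ := h.exists_modulus hC T (div_pos hε hDpos)
  have hlim : Tendsto (fun K : ℕ => (T : ℝ) / K) atTop (𝓝 0) :=
    tendsto_const_div_atTop_nhds_zero_nat _
  filter_upwards [hlim.eventually_lt_const hδ, eventually_gt_atTop 0] with K hKδ hK k hk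
  rcases k.eq_zero_or_pos with rfl | hk0
  · have h0 : (locSet T v A Y C (grid T K 0)).indicator (stepErr T A Y K 0) =ᵐ[P] 0 := by
      filter_upwards [h.initial] with ω hω
      simp [Set.indicator, stepErr, hω]
    refine ⟨(memLp_congr_ae h0).2 MemLp.zero, ?_⟩
    rw [integral_congr_ae (g := fun _ => 0) (by filter_upwards [h0] with ω hω; rw [hω]; simp)]
    simp [hε.le]
  set S := locSet T v A Y C (grid T K k) with hS
  have hSm : MeasurableSet S := ℱ.le _ _ (h.measurableSet_locSet T C _)
  -- Clipping, unlike multiplication by the indicator of `S`, keeps the integrands adapted: `S` is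
  -- known only at the final time. The indicator is applied after summation.
  set θ : ℕ → ℕ → Ω → ℝ := fun M l ω =>
    clip C (Y (grid T (K * M) l) ω) - clip C (Y (grid T K (l / M)) ω) with hθ
  set g : ℕ → Ω → ℝ := fun M ω => ∑ l ∈ Finset.range (k * M), θ M l ω *
    (A (grid T (K * M) (l + 1)) ω - A (grid T (K * M) l) ω) with hg
  have hθm : ∀ M, 0 < M → ∀ l, Measurable[ℱ (grid T (K * M) l)] (θ M l) := fun M hM l => by
    have h1 := h.adapted (grid T (K * M) l)
    have hle : grid T K (l / M) ≤ grid T (K * M) l := by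
      rw [← grid_mul_mul T K (l / M) hM]
      exact grid_mono T _ (Nat.div_mul_le_self l M)
    have h2 := (h.adapted (grid T K (l / M))).mono (ℱ.mono hle) le_rfl
    have h3 := (continuous_clip C).measurable
    exact (h3.comp h1).sub (h3.comp h2)
  have hθ2 : ∀ M, 0 < M → ∀ l, MemLp (θ M l) 2 P := fun M hM l => by
    refine MemLp.of_bound (C := 2 * C)
      ((hθm M hM l).mono (ℱ.le _) le_rfl).aestronglyMeasurable (ae_of_all _ fun ω => ?_)
    have h1 := abs_clip_le hC (Y (grid T (K * M) l) ω)
    have h2 := abs_clip_le hC (Y (grid T K (l / M)) ω)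
    have h3 := abs_sub (clip C (Y (grid T (K * M) l) ω)) (clip C (Y (grid T K (l / M)) ω))
    rw [Real.norm_eq_abs]
    simp only [hθ]
    linarith
  have hgb : ∀ M, 0 < M → MemLp (g M) 2 P ∧ ∫ ω, g M ω ^ 2 ∂P ≤ ε := fun M hM => by
    obtain ⟨h1, h2⟩ := h.integral_sq_sum_le (f := fun x => x) measurable_id T (K * M)
      (memLp_id_gaussianReal' 2 (by simp)) (k * M) (fun l _ => hθm M hM l) (fun l _ => hθ2 M hM l)
    refine ⟨h1, h2.trans ?_⟩
    rw [integral_sq_id_gaussianReal, integral_id_gaussianReal]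
    have hN : (0 : ℝ) < (K * M : ℕ) := by exact_mod_cast Nat.mul_pos hK hM
    have hkN : ((k * M : ℕ) : ℝ) ≤ (K * M : ℕ) := by exact_mod_cast Nat.mul_le_mul_right M hk
    have h1N : (1 : ℝ) ≤ (K * M : ℕ) := by exact_mod_cast Nat.mul_pos hK hM
    have hsum : ∑ l ∈ Finset.range (k * M), ∫ ω, θ M l ω ^ 2 ∂P ≤ (K * M : ℕ) * (ε / D) := by
      calc _ ≤ ∑ l ∈ Finset.range (k * M), ε / D := by
            refine Finset.sum_le_sum fun l hl => ?_
            have hl' := (Finset.mem_range.1 hl).le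
            have hle : grid T (K * M) l ≤ T := grid_le T (hl'.trans (Nat.mul_le_mul_right M hk))
            refine H _ _ hle ?_ ((dist_grid_le T K l hM).trans_lt hKδ)
            refine grid_le T ((Nat.div_le_of_le_mul ?_).trans hk)
            rwa [mul_comm]
        _ = (k * M : ℕ) * (ε / D) := by simp
        _ ≤ _ := by gcongr
    set N : ℝ := ((K * M : ℕ) : ℝ) with hNdef
    have hsum0 : 0 ≤ ∑ l ∈ Finset.range (k * M), ∫ ω, θ M l ω ^ 2 ∂P :=
      Finset.sum_nonneg fun l _ => integral_nonneg fun ω => sq_nonneg _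
    calc 2 * ((a * (T / N)) ^ 2 + ((v * (T / (K * M : ℕ)) : ℝ≥0) : ℝ) +
            (k * M : ℕ) * (a * (T / N)) ^ 2) *
          ∑ l ∈ Finset.range (k * M), ∫ ω, θ M l ω ^ 2 ∂P
        ≤ 2 * (N * (a * (T / N)) ^ 2 + v * (T / N) + N * (a * (T / N)) ^ 2) * (N * (ε / D)) := by
          have hv : ((v * (T / (K * M : ℕ)) : ℝ≥0) : ℝ) = v * (T / N) := by
            rw [hNdef]; push_cast; rfl
          rw [hv]
          have : (a * (T / N)) ^ 2 ≤ N * (a * (T / N)) ^ 2 :=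
            le_mul_of_one_le_left (sq_nonneg _) h1N
          gcongr
      _ = 2 * (2 * a ^ 2 * T ^ 2 + v * T) * (ε / D) := by
          field_simp
          ring
      _ ≤ D * (ε / D) := by
          gcongr
          linarith
      _ = ε := by field_simp
  have hlim2 : TendstoInMeasure P (fun M => S.indicator (g (M + 1))) atTop
      (S.indicator (stepErr T A Y K k)) := by
    -- Only partitions whose number of intervals is a multiple of k are used, since these refine the
    -- coarse grid.
    have h1 := (h.sde (grid T K k)).comp (v := atTop) (ns := fun M => k * (M + 1)) (by
      refine tendsto_atTop_mono (fun M => ?_) tendsto_id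
      simp only [id]
      nlinarith)
    have h2 := (h1.sub_fun (fun ω => ∑ l ∈ Finset.range k,
      Y (grid T K l) ω * (A (grid T K (l + 1)) ω - A (grid T K l) ω))).indicator S
    refine h2.congr_left fun M => ae_of_all _ fun ω => ?_
    by_cases hω : ω ∈ S
    · simp only [Set.indicator_of_mem hω, Function.comp]
      rw [itoSum_grid Y A T K hk0]
      have h3 := sum_range_mul_div (fun l => Y (grid T K l) ω)
        (fun l => A (grid T (K * (M + 1)) l) ω) k M.succ_pos
      simp only [Nat.succ_eq_add_one, grid_mul_mul T K _ M.succ_pos] at h3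
      rw [← h3, ← Finset.sum_sub_distrib]
      refine Finset.sum_congr rfl fun l hl => ?_
      have hl' := (Finset.mem_range.1 hl).le
      have e1 : clip C (Y (grid T (K * (M + 1)) l) ω) = Y (grid T (K * (M + 1)) l) ω :=
        clip_eq_self (locSet_spec hω (by
          rw [← grid_mul_mul T K k M.succ_pos]; exact grid_mono T _ hl')).1
      have e2 : clip C (Y (grid T K (l / (M + 1))) ω) = Y (grid T K (l / (M + 1))) ω :=
        clip_eq_self (locSet_spec hω (grid_mono T _ (Nat.div_le_of_le_mul (by
          rwa [mul_comm])))).1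
      simp only [hθ, e1, e2]
      ring
    · simp [Set.indicator_of_notMem hω]
  refine integral_sq_le_of_tendstoInMeasure hε.le (fun M => (hgb (M + 1) M.succ_pos).1.indicator hSm)
    (fun M => ?_) hlim2
  obtain ⟨h1, h2⟩ := hgb (M + 1) M.succ_pos
  refine le_trans (integral_mono (h1.indicator hSm).integrable_sq h1.integrable_sq fun ω => ?_) h2
  by_cases hω : ω ∈ S <;> simp [hω, sq_nonneg]

/-- Product rule for `invSol * Y` along the coarse grid. -/
theorem invSol_mul_sum_eq (T : ℝ≥0) (K k : ℕ) (ω : Ω) :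
    invSol v A (grid T K k) ω * (Y (grid T K k) ω - stepErr T A Y K k ω) =
      invSol v A 0 ω +
      ∑ l ∈ Finset.range k, invSol v A (grid T K l) ω * Y (grid T K l) ω *
        (Real.exp (-(A (grid T K (l + 1)) ω - A (grid T K l) ω - (v * (T / K) : ℝ≥0) / 2)) *
          (1 + (A (grid T K (l + 1)) ω - A (grid T K l) ω)) - 1) -
      ∑ l ∈ Finset.range k, invSol v A (grid T K l) ω * stepErr T A Y K l ω *
        (Real.exp (-(A (grid T K (l + 1)) ω - A (grid T K l) ω - (v * (T / K) : ℝ≥0) / 2)) - 1) := by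
  induction k with
  | zero => simp [stepErr]
  | succ k ih =>
    rw [Finset.sum_range_succ, Finset.sum_range_succ]
    set x := A (grid T K (k + 1)) ω - A (grid T K k) ω with hx
    set e := Real.exp (-(x - (v * (T / K) : ℝ≥0) / 2)) with he
    have hE : invSol v A (grid T K (k + 1)) ω = invSol v A (grid T K k) ω * e := by
      rw [he, hx]
      unfold invSol
      rw [← Real.exp_add, grid_succ]
      push_cast
      ring_nf
    have hU : Y (grid T K (k + 1)) ω - stepErr T A Y K (k + 1) ω =
        Y (grid T K k) ω - stepErr T A Y K k ω + Y (grid T K k) ω * x := by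
      unfold stepErr
      rw [Finset.sum_range_succ]
      ring
    rw [hE, hU]
    linear_combination e * ih + (ih - e * ih)

end SolvesExpSDE
end LinearSde

/-! ### Asymptotics of the one-step moments as the mesh tends to zero. -/

section NoiseMoments

variable (a : ℝ) (v T : ℝ≥0)

/-- The mean of one factor is exp((v - a)h)(1 + (a - v)h) for step h, whose first-order terms
cancel. This cancellation is the Itô correction: it relies on the term c/2 in the exponent. -/
theorem tendsto_mul_integral_exp_mul_sub_one (hT : 0 < T) :
    Tendsto (fun K : ℕ => (K : ℝ) * ∫ x : ℝ, (Real.exp (-(x - (v * (T / K) : ℝ≥0) / 2)) *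
      (1 + x) - 1) ∂gaussianReal (a * (T / K)) (v * (T / K))) atTop (𝓝 0) := by
  have hF : HasDerivAt (fun x : ℝ => Real.exp ((v - a) * x) * (1 + (a - v) * x) - 1) 0 0 := by
    have h1 := ((hasDerivAt_id (0 : ℝ)).const_mul (v - a : ℝ)).exp
    have h2 := ((hasDerivAt_id (0 : ℝ)).const_mul (a - v : ℝ)).const_add 1
    refine HasDerivAt.congr_deriv ((h1.mul h2).sub_const 1) ?_
    simp
  have h := tendsto_natCast_mul_of_hasDerivAt (T := T) (by exact_mod_cast hT) (by simp) hF
  rw [mul_zero] at h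
  refine h.congr fun K => ?_
  rw [integral_sub_one (memLp_two_exp_mul_add_one _ _), integral_exp_mul_add_one]
  push_cast
  ring_nf

/-- The leading term of the factor minus one is (c - x²)/2, so its second moment is of second order
in the step. -/
theorem tendsto_mul_integral_sq_exp_mul_sub_one (hT : 0 < T) :
    Tendsto (fun K : ℕ => (K : ℝ) * ∫ x : ℝ, (Real.exp (-(x - (v * (T / K) : ℝ≥0) / 2)) *
      (1 + x) - 1) ^ 2 ∂gaussianReal (a * (T / K)) (v * (T / K))) atTop (𝓝 0) := by
  have hF : HasDerivAt (fun x : ℝ => Real.exp ((3 * v - 2 * a) * x) *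
      ((1 + (a - 2 * v) * x) ^ 2 + v * x) -
      2 * (Real.exp ((v - a) * x) * (1 + (a - v) * x)) + 1) 0 0 := by
    have h1 := ((hasDerivAt_id (0 : ℝ)).const_mul (v - a : ℝ)).exp
    have h2 := ((hasDerivAt_id (0 : ℝ)).const_mul (a - v : ℝ)).const_add 1
    have h3 := ((hasDerivAt_id (0 : ℝ)).const_mul (3 * v - 2 * a : ℝ)).exp
    have h4 := (((hasDerivAt_id (0 : ℝ)).const_mul (a - 2 * v : ℝ)).const_add 1).pow 2
    have h5 := (hasDerivAt_id (0 : ℝ)).const_mul (v : ℝ)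
    refine HasDerivAt.congr_deriv (((h3.mul (h4.add h5)).sub ((h1.mul h2).const_mul 2)).add_const 1) ?_
    simp
    ring
  have h := tendsto_natCast_mul_of_hasDerivAt (T := T) (by exact_mod_cast hT)
    (by simp; norm_num) hF
  rw [mul_zero] at h
  refine h.congr fun K => ?_
  rw [integral_sq_sub_one (memLp_two_exp_mul_add_one _ _), integral_exp_mul_add_one,
    integral_sq_exp_mul_add_one]
  push_cast
  ring_nf

/-- Without the Euler factor the first order survives. A finite limit suffices, because these
factors only multiply `stepErr`, which is itself small. -/
theorem tendsto_mul_integral_exp_sub_one (hT : 0 < T) :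
    Tendsto (fun K : ℕ => (K : ℝ) * ∫ x : ℝ, (Real.exp (-(x - (v * (T / K) : ℝ≥0) / 2)) - 1)
      ∂gaussianReal (a * (T / K)) (v * (T / K))) atTop (𝓝 (T * (v - a))) := by
  have hF : HasDerivAt (fun x : ℝ => Real.exp ((v - a) * x) - 1) (v - a) 0 := by
    have h1 := ((hasDerivAt_id (0 : ℝ)).const_mul (v - a : ℝ)).exp
    refine HasDerivAt.congr_deriv (h1.sub_const 1) ?_
    simp
  have h := tendsto_natCast_mul_of_hasDerivAt (T := T) (by exact_mod_cast hT) (by simp) hF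
  refine h.congr fun K => ?_
  rw [integral_sub_one (memLp_two_exp_neg _ _), integral_exp_neg]
  push_cast
  ring_nf

theorem tendsto_mul_integral_sq_exp_sub_one (hT : 0 < T) :
    Tendsto (fun K : ℕ => (K : ℝ) * ∫ x : ℝ, (Real.exp (-(x - (v * (T / K) : ℝ≥0) / 2)) - 1) ^ 2
      ∂gaussianReal (a * (T / K)) (v * (T / K))) atTop (𝓝 (T * v)) := by
  have hF : HasDerivAt (fun x : ℝ => Real.exp ((3 * v - 2 * a) * x) -
      2 * Real.exp ((v - a) * x) + 1) v 0 := by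
    have h1 := ((hasDerivAt_id (0 : ℝ)).const_mul (v - a : ℝ)).exp
    have h3 := ((hasDerivAt_id (0 : ℝ)).const_mul (3 * v - 2 * a : ℝ)).exp
    refine HasDerivAt.congr_deriv ((h3.sub (h1.const_mul 2)).add_const 1) ?_
    simp
    ring
  have h := tendsto_natCast_mul_of_hasDerivAt (T := T) (by exact_mod_cast hT)
    (by simp; norm_num) hF
  refine h.congr fun K => ?_
  rw [integral_sq_sub_one (memLp_two_exp_neg _ _), integral_exp_neg, integral_sq_exp_neg]
  push_cast
  ring_nf

end NoiseMoments

/-! ### Uniqueness for dY = Y dA. -/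

namespace SolvesExpSDE

variable {Ω : Type*} {m : MeasurableSpace Ω} {ℱ : Filtration ℝ≥0 m} {P : Measure Ω} {a : ℝ}
  {v : ℝ≥0} {A Y : ℝ≥0 → Ω → ℝ}

theorem invSol_pos (t : ℝ≥0) (ω : Ω) : 0 < invSol v A t ω := Real.exp_pos _

/-- By the product rule, `invSol` times Y minus 1 is a multiple of the last step error, plus a sum
against factors of vanishing mean and variance, minus a sum of small integrands against factors with
bounded accumulated moments. The three summands on the right bound these in turn, the number 3
coming from the square of a sum of three terms. -/
theorem integral_sq_locSet_le [IsProbabilityMeasure P] (h : SolvesExpSDE ℱ P a v A Y) {T : ℝ≥0}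
    (hT : 0 < T) {C : ℝ} (hC : 0 ≤ C) {ε : ℝ} (hε : 0 < ε) :
    ∫ ω, (locSet T v A Y C T).indicator (fun ω => invSol v A T ω * Y T ω - 1) ω ^ 2 ∂P ≤
      3 * C ^ 2 * ε + 3 * ε + 3 * (2 * (T * v + (T * (v - a)) ^ 2 + 1) * (C ^ 2 * ε)) := by
  have hR1 := tendsto_mul_integral_exp_mul_sub_one a v T hT
  have hR2 := tendsto_mul_integral_sq_exp_mul_sub_one a v T hT
  have hZ1 := tendsto_mul_integral_exp_sub_one a v T hT
  have hZ2 := tendsto_mul_integral_sq_exp_sub_one a v T hT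
  have hR := ((hR2.add (hR1.pow 2)).const_mul (2 * C ^ 4)).eventually_le_const
    (u := ε) (by simpa using hε)
  have hZ := (hZ2.add (hZ1.pow 2)).eventually_le_const
    (u := T * v + (T * (v - a)) ^ 2 + 1) (by linarith)
  obtain ⟨K, hKe, hKR, hKZ, hK⟩ := ((h.stepErr_bound T hC hε).and
    (hR.and (hZ.and (eventually_gt_atTop 0)))).exists
  set f : ℝ → ℝ := fun x => Real.exp (-(x - (v * (T / K) : ℝ≥0) / 2)) * (1 + x) - 1 with hf
  set g : ℝ → ℝ := fun x => Real.exp (-(x - (v * (T / K) : ℝ≥0) / 2)) - 1 with hg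
  set S : ℕ → Set Ω := fun l => locSet T v A Y C (grid T K l) with hS
  have hSm : ∀ l, MeasurableSet[ℱ (grid T K l)] (S l) := fun l => h.measurableSet_locSet T C _
  -- Each integrand is cut off by the event known at its own time, which keeps it adapted and square
  -- integrable. On the final event no cut-off is active, since the localization events decrease in
  -- time.
  set θ₁ : ℕ → Ω → ℝ := fun l => (S l).indicator
    fun ω => invSol v A (grid T K l) ω * Y (grid T K l) ω with hθ₁
  set θ₂ : ℕ → Ω → ℝ := fun l => (S l).indicator
    fun ω => invSol v A (grid T K l) ω * stepErr T A Y K l ω with hθ₂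
  have hb₁ : ∀ l ω, |θ₁ l ω| ≤ C ^ 2 := fun l ω => by
    by_cases hω : ω ∈ S l
    · simp only [hθ₁, Set.indicator_of_mem hω]
      obtain ⟨h1, h2⟩ := locSet_spec hω (le_refl (grid T K l))
      rw [abs_mul, abs_of_pos (invSol_pos _ _), sq]
      exact mul_le_mul h2 h1 (abs_nonneg _) hC
    · simp only [hθ₁, Set.indicator_of_notMem hω, abs_zero]
      positivity
  have hm₁ : ∀ l, Measurable[ℱ (grid T K l)] (θ₁ l) := fun l =>
    Measurable.indicator ((h.measurable_invSol _).mul (h.adapted _)) (hSm l)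
  have hm₂ : ∀ l, Measurable[ℱ (grid T K l)] (θ₂ l) := fun l =>
    Measurable.indicator ((h.measurable_invSol _).mul (h.measurable_stepErr T K l)) (hSm l)
  have hL₁ : ∀ l, MemLp (θ₁ l) 2 P := fun l =>
    MemLp.of_bound ((hm₁ l).mono (ℱ.le _) le_rfl).aestronglyMeasurable (C ^ 2)
      (ae_of_all _ (hb₁ l))
  have hb₂ : ∀ l ω, |θ₂ l ω| ≤ C * |(S l).indicator (stepErr T A Y K l) ω| := fun l ω => by
    by_cases hω : ω ∈ S l
    · simp only [hθ₂, Set.indicator_of_mem hω]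
      obtain ⟨-, h2⟩ := locSet_spec hω (le_refl (grid T K l))
      rw [abs_mul, abs_of_pos (invSol_pos _ _)]
      gcongr
    · simp [hθ₂, Set.indicator_of_notMem hω]
  have hL₂ : ∀ l ≤ K, MemLp (θ₂ l) 2 P := fun l hl =>
    ((hKe l hl).1).of_le_mul (c := C) ((hm₂ l).mono (ℱ.le _) le_rfl).aestronglyMeasurable
      (ae_of_all _ (hb₂ l))
  have hI₁ : ∀ l, ∫ ω, θ₁ l ω ^ 2 ∂P ≤ C ^ 4 := fun l => by
    have := integral_mono (μ := P) (hL₁ l).integrable_sq (integrable_const (C ^ 4)) fun ω => by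
      change θ₁ l ω ^ 2 ≤ C ^ 4
      rw [← sq_abs, show C ^ 4 = (C ^ 2) ^ 2 by ring]
      gcongr
      exact hb₁ l ω
    simpa using this
  have hI₂ : ∀ l ≤ K, ∫ ω, θ₂ l ω ^ 2 ∂P ≤ C ^ 2 * ε := fun l hl => by
    calc _ ≤ ∫ ω, C ^ 2 * (S l).indicator (stepErr T A Y K l) ω ^ 2 ∂P := by
          refine integral_mono (hL₂ l hl).integrable_sq ((hKe l hl).1.integrable_sq.const_mul _)
            fun ω => ?_
          change θ₂ l ω ^ 2 ≤ C ^ 2 * (S l).indicator (stepErr T A Y K l) ω ^ 2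
          rw [← sq_abs (θ₂ l ω), ← sq_abs ((S l).indicator _ ω), ← mul_pow]
          gcongr
          exact hb₂ l ω
      _ ≤ _ := by
          rw [integral_const_mul]
          gcongr
          exact (hKe l hl).2
  obtain ⟨hS₁, hB₁⟩ := h.integral_sq_sum_le (f := f) (by fun_prop) T K
    ((memLp_two_exp_mul_add_one _ _).sub (memLp_const 1)) K (fun l _ => hm₁ l) (fun l _ => hL₁ l)
  obtain ⟨hS₂, hB₂⟩ := h.integral_sq_sum_le (f := g) (by fun_prop) T K
    ((memLp_two_exp_neg _ _).sub (memLp_const 1)) K (fun l _ => hm₂ l) (fun l hl => hL₂ l hl.le)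
  have hK' : (0 : ℝ) < K := by exact_mod_cast hK
  have hB₁' : ∫ ω, (∑ l ∈ Finset.range K,
      θ₁ l ω * f (A (grid T K (l + 1)) ω - A (grid T K l) ω)) ^ 2 ∂P ≤ ε := by
    refine hB₁.trans (le_trans ?_ hKR)
    have hs : ∑ l ∈ Finset.range K, ∫ ω, θ₁ l ω ^ 2 ∂P ≤ K * C ^ 4 :=
      (Finset.sum_le_sum fun l _ => hI₁ l).trans (by simp)
    have hnn : 0 ≤ ∫ x, f x ^ 2 ∂gaussianReal (a * (T / K)) (v * (T / K)) :=
      integral_nonneg fun x => sq_nonneg _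
    refine (mul_le_mul_of_nonneg_left hs (by positivity)).trans (le_of_eq ?_)
    ring
  have hB₂' : ∫ ω, (∑ l ∈ Finset.range K,
      θ₂ l ω * g (A (grid T K (l + 1)) ω - A (grid T K l) ω)) ^ 2 ∂P ≤
      2 * (T * v + (T * (v - a)) ^ 2 + 1) * (C ^ 2 * ε) := by
    refine hB₂.trans ?_
    have hs : ∑ l ∈ Finset.range K, ∫ ω, θ₂ l ω ^ 2 ∂P ≤ K * (C ^ 2 * ε) :=
      (Finset.sum_le_sum fun l hl => hI₂ l (Finset.mem_range.1 hl).le).trans (by simp)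
    have hnn : 0 ≤ ∫ x, g x ^ 2 ∂gaussianReal (a * (T / K)) (v * (T / K)) :=
      integral_nonneg fun x => sq_nonneg _
    refine (mul_le_mul_of_nonneg_left hs (by positivity)).trans ?_
    refine le_trans (le_of_eq ?_) (mul_le_mul_of_nonneg_right
      (mul_le_mul_of_nonneg_left hKZ (by norm_num : (0 : ℝ) ≤ 2)) (by positivity))
    ring
  have hTm : MeasurableSet (locSet T v A Y C T) := ℱ.le _ _ (h.measurableSet_locSet T C T)
  have hbd : ∀ᵐ ω ∂P, (locSet T v A Y C T).indicator (fun ω => invSol v A T ω * Y T ω - 1) ω ^ 2 ≤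
      3 * C ^ 2 * (S K).indicator (stepErr T A Y K K) ω ^ 2 +
      3 * (∑ l ∈ Finset.range K, θ₁ l ω * f (A (grid T K (l + 1)) ω - A (grid T K l) ω)) ^ 2 +
      3 * (∑ l ∈ Finset.range K,
        θ₂ l ω * g (A (grid T K (l + 1)) ω - A (grid T K l) ω)) ^ 2 := by
    filter_upwards [h.noise_zero] with ω hω0
    by_cases hω : ω ∈ locSet T v A Y C T
    · have hSl : ∀ l ≤ K, ω ∈ S l := fun l hl => locSet_antitone T v A Y C (grid_le T hl) hω
      have hE0 : invSol v A 0 ω = 1 := by simp [invSol, hω0]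
      have key := invSol_mul_sum_eq (v := v) (A := A) (Y := Y) T K K ω
      rw [hE0, grid_self T hK] at key
      have e1 : ∑ l ∈ Finset.range K, θ₁ l ω * f (A (grid T K (l + 1)) ω - A (grid T K l) ω) =
          ∑ l ∈ Finset.range K, invSol v A (grid T K l) ω * Y (grid T K l) ω *
            f (A (grid T K (l + 1)) ω - A (grid T K l) ω) :=
        Finset.sum_congr rfl fun l hl => by
          simp only [hθ₁, Set.indicator_of_mem (hSl l (Finset.mem_range.1 hl).le)]
      have e2 : ∑ l ∈ Finset.range K, θ₂ l ω * g (A (grid T K (l + 1)) ω - A (grid T K l) ω) =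
          ∑ l ∈ Finset.range K, invSol v A (grid T K l) ω * stepErr T A Y K l ω *
            g (A (grid T K (l + 1)) ω - A (grid T K l) ω) :=
        Finset.sum_congr rfl fun l hl => by
          simp only [hθ₂, Set.indicator_of_mem (hSl l (Finset.mem_range.1 hl).le)]
      rw [Set.indicator_of_mem hω, Set.indicator_of_mem (hSl K le_rfl), e1, e2]
      obtain ⟨-, hEC⟩ := locSet_spec (hSl K le_rfl) (le_refl (grid T K K))
      rw [grid_self T hK] at hEC
      have hE := invSol_pos (v := v) (A := A) T ω
      set x := ∑ l ∈ Finset.range K, invSol v A (grid T K l) ω * Y (grid T K l) ω *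
            f (A (grid T K (l + 1)) ω - A (grid T K l) ω)
      set y := ∑ l ∈ Finset.range K, invSol v A (grid T K l) ω * stepErr T A Y K l ω *
            g (A (grid T K (l + 1)) ω - A (grid T K l) ω)
      set z := stepErr T A Y K K ω
      have hxyz : invSol v A T ω * Y T ω - 1 = invSol v A T ω * z + x - y := by
        linear_combination key
      rw [hxyz]
      have h3 : (invSol v A T ω * z) ^ 2 ≤ C ^ 2 * z ^ 2 := by
        rw [mul_pow]; gcongr
      nlinarith [sq_nonneg (invSol v A T ω * z - x), sq_nonneg (invSol v A T ω * z + y),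
        sq_nonneg (x + y)]
    · rw [Set.indicator_of_notMem hω, zero_pow two_ne_zero]
      positivity
  have hLm : Integrable (fun ω =>
      3 * C ^ 2 * (S K).indicator (stepErr T A Y K K) ω ^ 2 +
      3 * (∑ l ∈ Finset.range K,
        θ₁ l ω * f (A (grid T K (l + 1)) ω - A (grid T K l) ω)) ^ 2) P :=
    ((hKe K le_rfl).1.integrable_sq.const_mul _).add (hS₁.integrable_sq.const_mul 3)
  refine (integral_mono_of_nonneg (ae_of_all _ fun ω => sq_nonneg _)
    (hLm.add (hS₂.integrable_sq.const_mul 3)) hbd).trans ?_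
  rw [integral_add' hLm (hS₂.integrable_sq.const_mul 3),
    integral_add ((hKe K le_rfl).1.integrable_sq.const_mul _) (hS₁.integrable_sq.const_mul 3),
    integral_const_mul, integral_const_mul, integral_const_mul]
  have := (hKe K le_rfl).2
  gcongr

/-- Uniqueness for the linear stochastic differential equation `dY = Y dA`. -/
theorem ae_eq_exp [IsProbabilityMeasure P] (h : SolvesExpSDE ℱ P a v A Y) {T : ℝ≥0}
    (hT : 0 < T) : ∀ᵐ ω ∂P, Y T ω = Real.exp (A T ω - v * T / 2) := by
  have hloc : ∀ C : ℕ, ∀ᵐ ω ∂P, ω ∈ locSet T v A Y C T → invSol v A T ω * Y T ω - 1 = 0 := by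
    intro C
    have hTm : MeasurableSet (locSet T v A Y (C : ℝ) T) := ℱ.le _ _ (h.measurableSet_locSet T C T)
    set F : Ω → ℝ := (locSet T v A Y (C : ℝ) T).indicator
      (fun ω => invSol v A T ω * Y T ω - 1) with hF
    have hFm : AEStronglyMeasurable F P := by
      have h1 := (h.measurable_invSol T).mono (ℱ.le _) le_rfl
      have h2 := h.measurable T
      exact (Measurable.indicator ((h1.mul h2).sub_const 1) hTm).aestronglyMeasurable
    have hFb : ∀ ω, |F ω| ≤ (C : ℝ) ^ 2 + 1 := fun ω => by
      by_cases hω : ω ∈ locSet T v A Y (C : ℝ) T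
      · obtain ⟨h1, h2⟩ := locSet_spec hω (grid_self T Nat.one_pos).le
        rw [grid_self T Nat.one_pos] at h1 h2
        rw [hF, Set.indicator_of_mem hω]
        refine (abs_sub _ _).trans ?_
        rw [abs_one, abs_mul, abs_of_pos (invSol_pos _ _), sq]
        gcongr
      · rw [hF, Set.indicator_of_notMem hω, abs_zero]
        positivity
    have hFL : MemLp F 2 P := MemLp.of_bound hFm _ (ae_of_all _ hFb)
    have hle : ∫ ω, F ω ^ 2 ∂P ≤ 0 := by
      -- The bound of `integral_sq_locSet_le` is linear in ε with this slope, so letting ε tend to 0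
      -- makes the integral vanish.
      set κ : ℝ := 3 * (C : ℝ) ^ 2 + 3 + 6 * (T * v + (T * (v - a)) ^ 2 + 1) * (C : ℝ) ^ 2 with hκ
      have hlim : Tendsto (fun ε : ℝ => κ * ε) (𝓝[>] 0) (𝓝 0) := by
        have : Tendsto (fun ε : ℝ => κ * ε) (𝓝 0) (𝓝 (κ * 0)) := tendsto_id.const_mul κ
        rw [mul_zero] at this
        exact this.mono_left nhdsWithin_le_nhds
      refine ge_of_tendsto hlim ?_
      filter_upwards [self_mem_nhdsWithin] with ε hε
      refine (h.integral_sq_locSet_le hT (Nat.cast_nonneg C) hε).trans (le_of_eq ?_)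
      rw [hκ]; ring
    have h0 := (integral_eq_zero_iff_of_nonneg (fun ω => sq_nonneg (F ω)) hFL.integrable_sq).1
      (le_antisymm hle (integral_nonneg fun ω => sq_nonneg (F ω)))
    filter_upwards [h0] with ω hω hmem
    have : F ω = 0 := by simpa using hω
    rwa [hF, Set.indicator_of_mem hmem] at this
  filter_upwards [ae_all_iff.2 hloc, h.cont, h.noise_cont] with ω h1 h2 h3
  have hE : Continuous fun t => invSol v A t ω := by unfold invSol; fun_prop
  -- Continuous paths are bounded on [0, T], so almost every ω belongs to the localization event of
  -- some natural number C; the countably many null sets were collected before.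
  obtain ⟨C₁, hC₁⟩ := (isCompact_Icc (a := (0 : ℝ≥0)) (b := T)).exists_bound_of_continuousOn
    h2.continuousOn
  obtain ⟨C₂, hC₂⟩ := (isCompact_Icc (a := (0 : ℝ≥0)) (b := T)).exists_bound_of_continuousOn
    hE.continuousOn
  obtain ⟨C, hC⟩ := exists_nat_ge (max C₁ C₂)
  have hmem : ω ∈ locSet T v A Y C T := by
    simp only [locSet, Set.mem_iInter]
    intro N l hl
    have hI : grid T N l ∈ Set.Icc 0 T := ⟨zero_le, hl⟩
    exact ⟨(hC₁ _ hI).trans ((le_max_left _ _).trans hC),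
      (le_abs_self _).trans ((hC₂ _ hI).trans ((le_max_right _ _).trans hC))⟩
  have h4 := h1 C hmem
  have h5 : invSol v A T ω * Real.exp (A T ω - v * T / 2) = 1 := by
    unfold invSol
    rw [← Real.exp_add]
    simp
  have h6 := (invSol_pos (v := v) (A := A) T ω).ne'
  exact mul_left_cancel₀ h6 (by linarith)

end SolvesExpSDE

/-! ### Reduction of the linear equation to a single driver. -/

section ConvergenceInMeasure

variable {Ω : Type*} {m : MeasurableSpace Ω} {P : Measure Ω}

theorem MeasureTheory.TendstoInMeasure.add_real {f g : ℕ → Ω → ℝ} {f' g' : Ω → ℝ}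
    (hf : TendstoInMeasure P f atTop f') (hg : TendstoInMeasure P g atTop g') :
    TendstoInMeasure P (fun i ω => f i ω + g i ω) atTop (fun ω => f' ω + g' ω) := by
  rw [tendstoInMeasure_iff_norm] at hf hg ⊢
  intro ε hε
  have h := (hf (ε / 2) (half_pos hε)).add (hg (ε / 2) (half_pos hε))
  rw [add_zero] at h
  refine tendsto_of_tendsto_of_tendsto_of_le_of_le tendsto_const_nhds h (fun _ => zero_le)
    fun i => (measure_mono fun ω hω => ?_).trans (measure_union_le _ _)
  simp only [Set.mem_ofPred_eq, Set.mem_union, Real.norm_eq_abs] at hω ⊢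
  by_contra! hcon
  have := abs_add_le (f i ω - f' ω) (g i ω - g' ω)
  have h2 : f i ω + g i ω - (f' ω + g' ω) = f i ω - f' ω + (g i ω - g' ω) := by ring
  rw [h2] at hω
  linarith [hcon.1, hcon.2]

theorem MeasureTheory.TendstoInMeasure.const_mul_real {f : ℕ → Ω → ℝ} {f' : Ω → ℝ}
    (hf : TendstoInMeasure P f atTop f') (c : ℝ) :
    TendstoInMeasure P (fun i ω => c * f i ω) atTop (fun ω => c * f' ω) := by
  rw [tendstoInMeasure_iff_norm] at hf ⊢
  intro ε hε
  refine tendsto_of_tendsto_of_tendsto_of_le_of_le tendsto_const_nhds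
    (hf (ε / (|c| + 1)) (by positivity)) (fun _ => zero_le) fun i => measure_mono fun ω hω => ?_
  simp only [Set.mem_ofPred_eq, Real.norm_eq_abs] at hω ⊢
  rw [← mul_sub, abs_mul] at hω
  rw [div_le_iff₀ (by positivity)]
  nlinarith [abs_nonneg (f i ω - f' ω)]

theorem tendstoInMeasure_finset_sum_real {ι : Type*} (s : Finset ι) {f : ι → ℕ → Ω → ℝ}
    {f' : ι → Ω → ℝ} (hf : ∀ j ∈ s, TendstoInMeasure P (f j) atTop (f' j)) :
    TendstoInMeasure P (fun i ω => ∑ j ∈ s, f j i ω) atTop (fun ω => ∑ j ∈ s, f' j ω) := by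
  classical
  induction s using Finset.induction_on with
  | empty =>
    intro ε hε
    simp [hε.ne']
  | insert j s hj ih =>
    simp only [Finset.sum_insert hj]
    exact (hf j (Finset.mem_insert_self _ _)).add_real
      (ih fun i hi => hf i (Finset.mem_insert_of_mem hi))

end ConvergenceInMeasure

/-- Left Riemann sums over uniform partitions converge to the integral. -/
theorem tendsto_riemann_sum {F : ℝ → ℝ} (hF : Continuous F) {t : ℝ} (ht : 0 ≤ t) :
    Tendsto (fun K : ℕ => ∑ k ∈ Finset.range K, F (k * t / K) * (t / K)) atTop
      (𝓝 (∫ u in (0 : ℝ)..t, F u)) := by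
  rw [Metric.tendsto_atTop']
  intro ε hε
  have hu := (isCompact_Icc (a := (0 : ℝ)) (b := t)).uniformContinuousOn_of_continuous
    hF.continuousOn
  rw [Metric.uniformContinuousOn_iff] at hu
  obtain ⟨δ, hδ, H⟩ := hu (ε / (t + 1)) (by positivity)
  have hlim : Tendsto (fun K : ℕ => t / (K : ℝ)) atTop (𝓝 0) :=
    tendsto_const_div_atTop_nhds_zero_nat t
  obtain ⟨K₀, hK₀⟩ := eventually_atTop.1 (hlim.eventually_lt_const hδ)
  refine ⟨K₀, fun K hK => ?_⟩
  have hKpos : (0 : ℝ) < K := by exact_mod_cast (Nat.zero_le _).trans_lt hK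
  have hKδ := hK₀ K hK.le
  have hx : ∀ k : ℕ, ((k + 1 : ℕ) : ℝ) * t / K = k * t / K + t / K := fun k => by
    push_cast; ring
  have hsum := intervalIntegral.sum_integral_adjacent_intervals (μ := volume) (f := F)
    (a := fun k : ℕ => k * t / K) (n := K) fun k _ => hF.intervalIntegrable _ _
  have hend : (K : ℝ) * t / K = t := by field_simp
  simp only [hend, Nat.cast_zero, zero_mul, zero_div] at hsum
  rw [← hsum, Real.dist_eq, ← Finset.sum_sub_distrib]
  have htK : 0 ≤ t / K := by positivity
  have hterm : ∀ k ∈ Finset.range K,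
      |F (k * t / K) * (t / K) - ∫ u in (k * t / K : ℝ)..((k + 1 : ℕ) * t / K), F u| ≤
        ε / (t + 1) * (t / K) := fun k hk => by
    have hkK : ((k + 1 : ℕ) : ℝ) ≤ K := by exact_mod_cast Finset.mem_range.1 hk
    have h0 : 0 ≤ (k : ℝ) * t / K := by positivity
    have h1 : (k : ℝ) * t / K + t / K ≤ t := by
      rw [← hx, div_le_iff₀ hKpos]
      nlinarith
    have hconst : F (k * t / K) * (t / K) =
        ∫ u in (k * t / K : ℝ)..((k + 1 : ℕ) * t / K), F (k * t / K) := by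
      rw [intervalIntegral.integral_const, hx, smul_eq_mul]; ring
    rw [hconst, ← intervalIntegral.integral_sub (continuous_const.intervalIntegrable _ _)
      (hF.intervalIntegrable _ _)]
    have := intervalIntegral.norm_integral_le_of_norm_le_const
      (a := (k * t / K : ℝ)) (b := (k + 1 : ℕ) * t / K) (C := ε / (t + 1))
      (f := fun u => F (k * t / K) - F u) fun u hu => by
        rw [hx, Set.uIoc_of_le (by linarith)] at hu
        rw [← dist_eq_norm]
        refine (H _ ⟨h0, by linarith⟩ u ⟨h0.trans hu.1.le, hu.2.trans h1⟩ ?_).le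
        rw [Real.dist_eq, abs_lt]
        constructor <;> linarith [hu.1, hu.2]
    rwa [Real.norm_eq_abs, hx, add_sub_cancel_left, abs_of_nonneg htK, ← hx] at this
  calc _ ≤ ∑ k ∈ Finset.range K, ε / (t + 1) * (t / K) :=
        (Finset.abs_sum_le_sum_abs _ _).trans (Finset.sum_le_sum hterm)
    _ = ε * (t / (t + 1)) := by
        rw [Finset.sum_const, Finset.card_range, nsmul_eq_mul]; field_simp
    _ < ε * 1 := by
        gcongr
        rw [div_lt_one (by linarith)]
        linarith
    _ = ε := mul_one ε

section

variable {Ω : Type*} {m : MeasurableSpace Ω} {P : Measure Ω} [IsProbabilityMeasure P]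
  {ℱ : Filtration ℝ≥0 m} {d : ℕ} {a : ℝ} {b : Fin d → ℝ} {X : Fin d → ℝ≥0 → Ω → ℝ}
  {Y : ℝ≥0 → Ω → ℝ}

theorem itoSum_drift_add (t : ℝ≥0) (K : ℕ) (ω : Ω) :
    itoSum Y (fun t ω => a * t + ∑ j, b j * X j t ω) t K ω =
      a * ∑ k ∈ Finset.range K, Y (k * t / K) ω * ((t : ℝ) / K) +
        ∑ j, b j * itoSum Y (X j) t K ω := by
  unfold itoSum
  simp_rw [Finset.mul_sum]
  rw [Finset.sum_comm, ← Finset.sum_add_distrib]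
  refine Finset.sum_congr rfl fun k _ => ?_
  have h : ∑ j, b j * (Y (k * t / K) ω * (X j ((k + 1) * t / K) ω - X j (k * t / K) ω)) =
      Y (k * t / K) ω * (∑ j, b j * X j ((k + 1) * t / K) ω - ∑ j, b j * X j (k * t / K) ω) := by
    rw [← Finset.sum_sub_distrib, Finset.mul_sum]
    exact Finset.sum_congr rfl fun j _ => by ring
  rw [h]
  push_cast
  ring

/-- Drift and noises merge into one driver. The Itô sums of Y against it split into Riemann sums,
which converge along every continuous path, and a linear combination of the given Itô sums. The
equation identifies the limit as Y - 1. -/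
theorem NetworkPricing.SolvesLinearSDEWrt.solvesExpSDE (h : SolvesLinearSDEWrt ℱ P a b X Y) {v : ℝ≥0}
    (hcont : ∀ j, ∀ᵐ ω ∂P, Continuous fun t => X j t ω) (hzero : ∀ j, ∀ᵐ ω ∂P, X j 0 ω = 0)
    (hlaw : ∀ s u, P.map (fun ω => ∑ j, b j * (X j (s + u) ω - X j s ω)) =
      gaussianReal 0 (v * u)) :
    SolvesExpSDE ℱ P a v (fun t ω => a * t + ∑ j, b j * X j t ω) Y := by
  have hXm : ∀ j t, Measurable (X j t) := fun j t =>
    ((h.noise_adapted j t).mono (ℱ.le t)).measurable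
  have hYm : ∀ t, Measurable (Y t) := fun t => ((h.adapted t).mono (ℱ.le t)).measurable
  refine ⟨fun t => ?_, fun s t hst => ?_, fun s u => ?_, ?_, ?_, fun t => (h.adapted t).measurable,
    h.continuous_paths, h.initial, fun t => ?_⟩
  · have := fun j => (h.noise_adapted j t).measurable
    fun_prop
  · refine indep_of_indep_of_le_left (h.noise_indep s t hst) ?_
    have : (fun ω => (a * t + ∑ j, b j * X j t ω) - (a * s + ∑ j, b j * X j s ω)) =
        (fun x : Fin d → ℝ => a * (t - s) + ∑ j, b j * x j) ∘
          fun ω j => X j t ω - X j s ω := by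
      ext ω
      simp only [Function.comp, mul_sub, Finset.sum_sub_distrib]
      ring
    rw [this, ← MeasurableSpace.comap_comp]
    exact MeasurableSpace.comap_mono (Measurable.comap_le (by fun_prop))
  · have : (fun ω => (a * (s + u : ℝ≥0) + ∑ j, b j * X j (s + u) ω) -
        (a * s + ∑ j, b j * X j s ω)) =
        (fun x => a * u + x) ∘ fun ω => ∑ j, b j * (X j (s + u) ω - X j s ω) := by
      ext ω
      simp only [Function.comp, mul_sub, Finset.sum_sub_distrib]
      push_cast
      ring
    rw [this, ← Measure.map_map (by fun_prop) (by fun_prop), hlaw, gaussianReal_map_const_add,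
      zero_add]
  · filter_upwards [ae_all_iff.2 hzero] with ω hω
    simp [hω]
  · filter_upwards [ae_all_iff.2 hcont] with ω hω
    fun_prop
  · obtain ⟨J, hJ, hY⟩ := h.sde
    have hR : TendstoInMeasure P
        (fun (K : ℕ) ω => ∑ k ∈ Finset.range K, Y (k * t / K) ω * ((t : ℝ) / K)) atTop
        (fun ω => ∫ u in (0 : ℝ)..t, Y u.toNNReal ω) := by
      refine tendstoInMeasure_of_tendsto_ae (fun K => ?_) ?_
      · exact (Finset.measurable_fun_sum _ fun k _ => (hYm _).mul_const _).aestronglyMeasurable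
      · filter_upwards [h.continuous_paths] with ω hω
        have hc : Continuous fun u : ℝ => Y u.toNNReal ω := hω.comp continuous_real_toNNReal
        refine (tendsto_riemann_sum hc t.coe_nonneg).congr fun K => ?_
        refine Finset.sum_congr rfl fun k _ => ?_
        congr 2
        have : ((k : ℝ) * t / K) = ((k * t / K : ℝ≥0) : ℝ) := by push_cast; rfl
        rw [this, Real.toNNReal_coe]
    have hS := tendstoInMeasure_finset_sum_real Finset.univ
      (f := fun j K ω => b j * itoSum Y (X j) t K ω) (f' := fun j ω => b j * J j t ω)
      fun j _ => (hJ j t).const_mul_real (b j)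
    refine ((hR.const_mul_real a).add_real hS).congr (fun K => ae_of_all _ fun ω => ?_) ?_
    · exact (itoSum_drift_add t K ω).symm
    · filter_upwards [hY t] with ω hω
      rw [hω]
      ring

end

/-! ### Explicit solutions driven by Brownian motions. -/

section BrownianLaws

variable {Ω : Type*} {m : MeasurableSpace Ω} {P : Measure Ω}

theorem ProbabilityTheory.IsBrownianReal.map_increment {W : ℝ≥0 → Ω → ℝ} (hW : IsBrownianReal W P) (s u : ℝ≥0) :
    P.map (fun ω => W (s + u) ω - W s ω) = gaussianReal 0 u := by
  have h := (hW.hasLaw_sub (s + u) s).map_eq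
  have h2 : nndist ((s + u : ℝ≥0) : ℝ) s = u := by
    rw [← NNReal.coe_inj, coe_nndist, Real.dist_eq]
    push_cast
    rw [add_sub_cancel_left, abs_of_nonneg u.coe_nonneg]
  change P.map (W (s + u) - W s) = _
  rw [h]
  exact congrArg _ h2

theorem ProbabilityTheory.IsBrownianReal.map_const_mul_increment {W : ℝ≥0 → Ω → ℝ}
    (hW : IsBrownianReal W P) (hWm : ∀ t, Measurable (W t)) (c : ℝ) (s u : ℝ≥0) :
    P.map (fun ω => c * (W (s + u) ω - W s ω)) =
      gaussianReal 0 (NNReal.mk (c ^ 2) (sq_nonneg c) * u) := by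
  have h := gaussianReal_map_const_mul (μ := 0) (v := u) c
  have hm : Measurable fun ω => W (s + u) ω - W s ω := (hWm _).sub (hWm _)
  rw [← hW.map_increment s u, Measure.map_map (by fun_prop) hm, mul_zero] at h
  exact h

theorem NetworkPricing.SolvesLinearSDE.ae_eq_exp_of_single [IsProbabilityMeasure P] {W q : ℝ≥0 → Ω → ℝ} (hW : IsBrownianReal W P)
    {a σ : ℝ} (hq : SolvesLinearSDE P a ![σ] ![W] q) {T : ℝ≥0} (hT : 0 < T) :
    Measurable (q T) ∧ Measurable (W T) ∧
      ∀ᵐ ω ∂P, q T ω = Real.exp ((a - σ ^ 2 / 2) * T + σ * W T ω) := by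
  obtain ⟨ℱ, h⟩ := hq
  have hWm : ∀ t, Measurable (W t) := fun t => ((h.noise_adapted 0 t).mono (ℱ.le t)).measurable
  have h' := h.solvesExpSDE (v := NNReal.mk (σ ^ 2) (sq_nonneg σ)) (fun j => by
    fin_cases j; exact hW.cont) (fun j => by
    fin_cases j; exact hW.eval_zero_ae_eq_zero) (fun s u => by
    simpa using hW.map_const_mul_increment hWm σ s u)
  refine ⟨h'.measurable T, hWm T, ?_⟩
  filter_upwards [h'.ae_eq_exp hT] with ω hω
  rw [hω]
  simp [NNReal.coe_mk]
  ring

/-- Independence of the increments of W and B over each common interval gives the combined driver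
the variance rate b² + c². -/
theorem NetworkPricing.SolvesLinearSDE.ae_eq_exp_of_pair [IsProbabilityMeasure P] {W B η : ℝ≥0 → Ω → ℝ} (hW : IsBrownianReal W P)
    (hB : IsBrownianReal B P) (hWB : ∀ s t, IndepFun (fun ω => W t ω - W s ω)
      (fun ω => B t ω - B s ω) P)
    {a b c : ℝ} (hη : SolvesLinearSDE P a ![b, c] ![W, B] η) {T : ℝ≥0} (hT : 0 < T) :
    Measurable (η T) ∧ Measurable (B T) ∧
      ∀ᵐ ω ∂P, η T ω = Real.exp ((a - (b ^ 2 + c ^ 2) / 2) * T + b * W T ω + c * B T ω) := by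
  obtain ⟨ℱ, h⟩ := hη
  have hWm : ∀ t, Measurable (W t) := fun t => ((h.noise_adapted 0 t).mono (ℱ.le t)).measurable
  have hBm : ∀ t, Measurable (B t) := fun t => ((h.noise_adapted 1 t).mono (ℱ.le t)).measurable
  have h' := h.solvesExpSDE (v := NNReal.mk (b ^ 2) (sq_nonneg b) + NNReal.mk (c ^ 2) (sq_nonneg c)) (fun j => by
    fin_cases j
    · exact hW.cont
    · exact hB.cont) (fun j => by
    fin_cases j
    · exact hW.eval_zero_ae_eq_zero
    · exact hB.eval_zero_ae_eq_zero) (fun s u => by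
    have h3 := gaussianReal_add_gaussianReal_of_indepFun
      ((hWB s (s + u)).comp (φ := fun x => b * x) (ψ := fun x => c * x) (by fun_prop)
        (by fun_prop)) (hW.map_const_mul_increment hWm b s u) (hB.map_const_mul_increment hBm c s u)
    rw [add_zero, ← add_mul] at h3
    simp only [Fin.sum_univ_two]
    exact h3)
  refine ⟨h'.measurable T, hBm T, ?_⟩
  filter_upwards [h'.ae_eq_exp hT] with ω hω
  rw [hω]
  simp [NNReal.coe_mk]
  ring

end BrownianLaws

/-! ### Clearing payments: contraction, monotonicity, submodularity and concavity. -/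

namespace NetworkPricing.FinancialNetwork

variable {n : ℕ} (N : FinancialNetwork n)

theorem sum_relLiab_lt_one (j : Fin n) : ∑ i, N.relLiab j i < 1 := by
  simp only [relLiab, Matrix.of_apply, ← Finset.sum_div]
  rw [div_lt_one (N.pbar_pos j)]
  have := N.Lsoc_pos j
  simp only [pbar]
  linarith

/-- Every bank owes something to society, so each row of relative liabilities sums to less than 1,
uniformly by finiteness. This makes clearing a contraction in the ℓ¹ norm with factor κ. -/
theorem exists_sum_relLiab_le : ∃ κ : ℝ, 0 ≤ κ ∧ κ < 1 ∧ ∀ j, ∑ i, N.relLiab j i ≤ κ := by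
  rcases isEmpty_or_nonempty (Fin n) with hn | hn
  · exact ⟨0, le_rfl, zero_lt_one, fun j => (hn.false j).elim⟩
  · obtain ⟨j, hj⟩ := Finite.exists_max fun j => ∑ i, N.relLiab j i
    exact ⟨_, Finset.sum_nonneg fun i _ => N.relLiab_nonneg j i, N.sum_relLiab_lt_one j, hj⟩

theorem sum_abs_relLiab_mul_le {κ : ℝ} (hκ : ∀ j, ∑ i, N.relLiab j i ≤ κ) (u : Fin n → ℝ) :
    ∑ i, |∑ j, N.relLiab j i * u j| ≤ κ * ∑ j, |u j| := by
  calc _ ≤ ∑ i, ∑ j, N.relLiab j i * |u j| := Finset.sum_le_sum fun i _ =>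
        (Finset.abs_sum_le_sum_abs _ _).trans (Finset.sum_le_sum fun j _ => by
          rw [abs_mul, abs_of_nonneg (N.relLiab_nonneg j i)])
    _ = ∑ j, (∑ i, N.relLiab j i) * |u j| := by
        rw [Finset.sum_comm]; simp only [Finset.sum_mul]
    _ ≤ ∑ j, κ * |u j| := Finset.sum_le_sum fun j _ =>
        mul_le_mul_of_nonneg_right (hκ j) (abs_nonneg _)
    _ = _ := by rw [Finset.mul_sum]

/-- The clearing map in terms of payments. -/
noncomputable def paymentMap (x p : Fin n → ℝ) : Fin n → ℝ := fun i =>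
  min (N.pbar i) (x i + ∑ j, N.relLiab j i * p j)

theorem wealth_eq {x : Fin n → ℝ} (hx : 0 ≤ x) (i : Fin n) :
    N.wealth x i = x i + ∑ j, N.relLiab j i * N.payment x j - N.pbar i :=
  (congrFun (N.isGreatest_wealth hx).1 i).symm

theorem payment_eq_min (x : Fin n → ℝ) (i : Fin n) :
    N.payment x i = min (N.pbar i) (N.pbar i + N.wealth x i) := by
  unfold payment
  rcases le_total 0 (N.wealth x i) with h | h
  · rw [max_eq_right (by linarith), min_eq_left (by linarith), sub_zero]
  · rw [max_eq_left (by linarith), min_eq_right (by linarith), sub_neg_eq_add]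

theorem paymentMap_payment {x : Fin n → ℝ} (hx : 0 ≤ x) :
    N.paymentMap x (N.payment x) = N.payment x := by
  ext i
  rw [payment_eq_min, N.wealth_eq hx, paymentMap]
  congr 1
  ring

theorem sum_abs_paymentMap_sub_le {κ : ℝ} (hκ : ∀ j, ∑ i, N.relLiab j i ≤ κ)
    (x y p q : Fin n → ℝ) :
    ∑ i, |N.paymentMap x p i - N.paymentMap y q i| ≤
      ∑ i, |x i - y i| + κ * ∑ j, |p j - q j| := by
  refine le_trans ?_ (add_le_add_right (N.sum_abs_relLiab_mul_le hκ fun j => p j - q j) _)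
  rw [← Finset.sum_add_distrib]
  refine Finset.sum_le_sum fun i _ => ?_
  refine (abs_min_sub_min_le_max _ _ _ _).trans ?_
  rw [sub_self, abs_zero, max_eq_right (abs_nonneg _)]
  refine le_trans (le_of_eq ?_) (abs_add_le _ _)
  congr 1
  simp only [mul_sub, Finset.sum_sub_distrib]
  ring

/-- Both payment vectors are fixed points, so the term with factor κ can be absorbed on the left,
leaving the Lipschitz constant 1/(1 - κ). -/
theorem exists_sum_abs_payment_sub_le : ∃ c : ℝ, ∀ x y : Fin n → ℝ, 0 ≤ x → 0 ≤ y →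
    ∑ i, |N.payment x i - N.payment y i| ≤ c * ∑ i, |x i - y i| := by
  obtain ⟨κ, -, hκ1, hκ⟩ := N.exists_sum_relLiab_le
  refine ⟨(1 - κ)⁻¹, fun x y hx hy => ?_⟩
  have h := N.sum_abs_paymentMap_sub_le hκ x y (N.payment x) (N.payment y)
  rw [N.paymentMap_payment hx, N.paymentMap_payment hy] at h
  rw [inv_mul_eq_div, le_div_iff₀ (by linarith)]
  linarith

theorem continuousOn_payment : ContinuousOn N.payment {x | 0 ≤ x} := by
  obtain ⟨c, hc⟩ := N.exists_sum_abs_payment_sub_le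
  refine continuousOn_pi.2 fun i x hx => ?_
  rw [ContinuousWithinAt, tendsto_iff_dist_tendsto_zero]
  have hlim : Tendsto (fun y : Fin n → ℝ => c * ∑ i, |y i - x i|) (𝓝[{x | 0 ≤ x}] x) (𝓝 0) := by
    have hcont : Continuous fun y : Fin n → ℝ => c * ∑ i, |y i - x i| := by fun_prop
    have := hcont.tendsto x
    simp only [sub_self, abs_zero, Finset.sum_const_zero, mul_zero] at this
    exact this.mono_left nhdsWithin_le_nhds
  refine squeeze_zero' (Eventually.of_forall fun _ => dist_nonneg) ?_ hlim
  filter_upwards [self_mem_nhdsWithin] with y hy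
  exact (Finset.single_le_sum (f := fun i => |N.payment y i - N.payment x i|)
    (fun i _ => abs_nonneg _) (Finset.mem_univ i)).trans (hc y x hy hx)

theorem continuousOn_wealth : ContinuousOn N.wealth {x | 0 ≤ x} := by
  have h : ContinuousOn (fun x : Fin n → ℝ => fun i =>
      x i + ∑ j, N.relLiab j i * N.payment x j - N.pbar i) {x | 0 ≤ x} := by
    have hp := fun j => continuousOn_pi.1 N.continuousOn_payment j
    refine continuousOn_pi.2 fun i => ?_
    refine ContinuousOn.sub (ContinuousOn.add (by fun_prop) ?_) continuousOn_const
    exact continuousOn_finsetSum _ fun j _ => continuousOn_const.mul (hp j)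
  exact h.congr fun x hx => funext fun i => N.wealth_eq hx i

/-- Iterates of the clearing map started at full payment. -/
noncomputable def paymentIter (x : Fin n → ℝ) : ℕ → Fin n → ℝ
  | 0 => N.pbar
  | k + 1 => N.paymentMap x (paymentIter x k)

/-- The contraction gives geometric convergence. Order and convexity properties can then be proved
by induction along the iterates and survive in the limit. -/
theorem tendsto_paymentIter {x : Fin n → ℝ} (hx : 0 ≤ x) (i : Fin n) :
    Tendsto (fun k => N.paymentIter x k i) atTop (𝓝 (N.payment x i)) := by
  obtain ⟨κ, hκ0, hκ1, hκ⟩ := N.exists_sum_relLiab_le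
  have h : ∀ k, ∑ i, |N.paymentIter x k i - N.payment x i| ≤
      κ ^ k * ∑ i, |N.pbar i - N.payment x i| := by
    intro k
    induction k with
    | zero => simp [paymentIter]
    | succ k ih =>
      have h1 := N.sum_abs_paymentMap_sub_le hκ x x (N.paymentIter x k) (N.payment x)
      rw [N.paymentMap_payment hx] at h1
      simp only [sub_self, abs_zero, Finset.sum_const_zero, zero_add] at h1
      refine h1.trans ?_
      rw [pow_succ', mul_assoc]
      exact mul_le_mul_of_nonneg_left ih hκ0
  rw [tendsto_iff_dist_tendsto_zero]
  have hlim := (tendsto_pow_atTop_nhds_zero_of_lt_one hκ0 hκ1).mul_const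
    (∑ i, |N.pbar i - N.payment x i|)
  rw [zero_mul] at hlim
  refine squeeze_zero (fun _ => dist_nonneg) (fun k => ?_) hlim
  exact (Finset.single_le_sum (f := fun i => |N.paymentIter x k i - N.payment x i|)
    (fun i _ => abs_nonneg _) (Finset.mem_univ i)).trans (h k)

theorem paymentIter_nonneg {x : Fin n → ℝ} (hx : 0 ≤ x) (k : ℕ) (i : Fin n) :
    0 ≤ N.paymentIter x k i := by
  induction k generalizing i with
  | zero => exact (N.pbar_pos i).le
  | succ k ih =>
    exact le_min (N.pbar_pos i).le (add_nonneg (hx i)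
      (Finset.sum_nonneg fun j _ => mul_nonneg (N.relLiab_nonneg j i) (ih j)))

theorem paymentIter_mono (k : ℕ) (i : Fin n) : Monotone fun x => N.paymentIter x k i := by
  induction k generalizing i with
  | zero => exact monotone_const
  | succ k ih =>
    intro x y hxy
    exact min_le_min_left _ (add_le_add (hxy i) (Finset.sum_le_sum fun j _ =>
      mul_le_mul_of_nonneg_left (ih j hxy) (N.relLiab_nonneg j i)))

/-- Truncation from above is concave and nondecreasing, so it preserves submodularity of a monotone
function. The letters s and i stand for the values at the supremum and the infimum of the two
arguments. -/
theorem min_add_min_le_of_submodular {c s i x y : ℝ} (h : s + i ≤ x + y) (hix : i ≤ x)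
    (hiy : i ≤ y) (hxs : x ≤ s) : min c s + min c i ≤ min c x + min c y := by
  rcases le_total c x with h1 | h1 <;> rcases le_total c y with h2 | h2 <;>
    rcases le_total c s with h3 | h3 <;> rcases le_total c i with h4 | h4 <;>
    simp only [min_eq_left, min_eq_right, h1, h2, h3, h4] <;> linarith

theorem paymentIter_submodular (k : ℕ) (i : Fin n) (x y : Fin n → ℝ) :
    N.paymentIter (x ⊔ y) k i + N.paymentIter (x ⊓ y) k i ≤
      N.paymentIter x k i + N.paymentIter y k i := by
  induction k generalizing i with
  | zero => exact le_rfl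
  | succ k ih =>
    have hmono : ∀ u w : Fin n → ℝ, u ≤ w → u i + ∑ j, N.relLiab j i * N.paymentIter u k j ≤
        w i + ∑ j, N.relLiab j i * N.paymentIter w k j := fun u w h =>
      add_le_add (h i) (Finset.sum_le_sum fun j _ =>
        mul_le_mul_of_nonneg_left (N.paymentIter_mono k j h) (N.relLiab_nonneg j i))
    refine min_add_min_le_of_submodular ?_ (hmono _ _ inf_le_left) (hmono _ _ inf_le_right)
      (hmono _ _ le_sup_left)
    have h1 : (x ⊔ y) i + (x ⊓ y) i = x i + y i := max_add_min (x i) (y i)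
    have h2 : ∑ j, N.relLiab j i * N.paymentIter (x ⊔ y) k j +
        ∑ j, N.relLiab j i * N.paymentIter (x ⊓ y) k j ≤
        ∑ j, N.relLiab j i * N.paymentIter x k j +
        ∑ j, N.relLiab j i * N.paymentIter y k j := by
      rw [← Finset.sum_add_distrib, ← Finset.sum_add_distrib]
      refine Finset.sum_le_sum fun j _ => ?_
      rw [← mul_add, ← mul_add]
      exact mul_le_mul_of_nonneg_left (ih j) (N.relLiab_nonneg j i)
    linarith

theorem paymentIter_concave (k : ℕ) (i : Fin n) :
    ConcaveOn ℝ Set.univ fun x => N.paymentIter x k i := by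
  induction k generalizing i with
  | zero => exact concaveOn_const _ convex_univ
  | succ k ih =>
    have hs : ConcaveOn ℝ Set.univ fun x : Fin n → ℝ =>
        ∑ j, N.relLiab j i * N.paymentIter x k j := by
      refine ⟨convex_univ, fun x _ y _ a b ha hb hab => ?_⟩
      simp only [smul_eq_mul, Finset.mul_sum]
      rw [← Finset.sum_add_distrib]
      refine Finset.sum_le_sum fun j _ => ?_
      have := (ih j).2 (Set.mem_univ x) (Set.mem_univ y) ha hb hab
      simp only [smul_eq_mul] at this
      have h2 := mul_le_mul_of_nonneg_left this (N.relLiab_nonneg j i)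
      linarith
    have hl : ConcaveOn ℝ Set.univ fun x : Fin n → ℝ => x i :=
      (LinearMap.proj i : (Fin n → ℝ) →ₗ[ℝ] ℝ).concaveOn convex_univ
    exact (concaveOn_const (N.pbar i) convex_univ).inf (hl.add hs)

theorem payment_le_pbar (x : Fin n → ℝ) (i : Fin n) : N.payment x i ≤ N.pbar i :=
  sub_le_self _ (le_max_right _ _)

theorem payment_nonneg {x : Fin n → ℝ} (hx : 0 ≤ x) (i : Fin n) : 0 ≤ N.payment x i :=
  ge_of_tendsto' (N.tendsto_paymentIter hx i) fun k => N.paymentIter_nonneg hx k i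

theorem payment_mono {x y : Fin n → ℝ} (hx : 0 ≤ x) (hxy : x ≤ y) :
    N.payment x ≤ N.payment y := fun i =>
  le_of_tendsto_of_tendsto' (N.tendsto_paymentIter hx i)
    (N.tendsto_paymentIter (hx.trans hxy) i) fun k => N.paymentIter_mono k i hxy

theorem payment_submodular {x y : Fin n → ℝ} (hx : 0 ≤ x) (hy : 0 ≤ y) (i : Fin n) :
    N.payment (x ⊔ y) i + N.payment (x ⊓ y) i ≤ N.payment x i + N.payment y i :=
  le_of_tendsto_of_tendsto'
    ((N.tendsto_paymentIter (hx.trans le_sup_left) i).add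
      (N.tendsto_paymentIter (le_inf hx hy) i))
    ((N.tendsto_paymentIter hx i).add (N.tendsto_paymentIter hy i))
    fun k => N.paymentIter_submodular k i x y

theorem payment_concave (i : Fin n) : ConcaveOn ℝ {x | 0 ≤ x} fun x => N.payment x i := by
  refine ⟨convex_Ici 0, fun x hx y hy a b ha hb hab => ?_⟩
  have hxy : 0 ≤ a • x + b • y := (convex_Ici (0 : Fin n → ℝ)) hx hy ha hb hab
  exact le_of_tendsto_of_tendsto'
    (((N.tendsto_paymentIter hx i).const_mul a).add ((N.tendsto_paymentIter hy i).const_mul b))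
    (N.tendsto_paymentIter hxy i)
    fun k => (N.paymentIter_concave k i).2 (Set.mem_univ x) (Set.mem_univ y) ha hb hab

theorem wealth_mono {x y : Fin n → ℝ} (hx : 0 ≤ x) (hxy : x ≤ y) :
    N.wealth x ≤ N.wealth y := fun i => by
  rw [N.wealth_eq hx, N.wealth_eq (hx.trans hxy)]
  refine sub_le_sub_right (add_le_add (hxy i) (Finset.sum_le_sum fun j _ =>
    mul_le_mul_of_nonneg_left (N.payment_mono hx hxy j) (N.relLiab_nonneg j i))) _

/-- A kernel vector v equals Πᵀ diag(z) v, so its ℓ¹ norm is at most κ < 1 times itself. -/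
theorem isUnit_one_sub_relLiab_mul_diagonal {z : Fin n → ℝ} (hz : ∀ i, |z i| ≤ 1) :
    IsUnit (1 - N.relLiabᵀ * Matrix.diagonal z).det := by
  obtain ⟨κ, hκ0, hκ1, hκ⟩ := N.exists_sum_relLiab_le
  rw [isUnit_iff_ne_zero]
  intro h0
  obtain ⟨v, hv, hMv⟩ := Matrix.exists_mulVec_eq_zero_iff.2 h0
  have hfix : ∀ i, v i = ∑ j, N.relLiab j i * (z j * v j) := fun i => by
    have := congrFun hMv i
    rw [Matrix.sub_mulVec, Matrix.one_mulVec, ← Matrix.mulVec_mulVec] at this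
    simp only [Pi.sub_apply, Pi.zero_apply, Matrix.mulVec, dotProduct, Matrix.transpose_apply,
      Matrix.diagonal_apply] at this
    simp only [ite_mul, zero_mul, Finset.sum_ite_eq, Finset.mem_univ, if_true] at this
    linarith
  have h1 := N.sum_abs_relLiab_mul_le hκ fun j => z j * v j
  simp only [← hfix] at h1
  have h2 : ∑ j, |z j * v j| ≤ ∑ j, |v j| := Finset.sum_le_sum fun j _ => by
    rw [abs_mul]
    exact mul_le_of_le_one_left (abs_nonneg _) (hz j)
  have hnn : 0 ≤ ∑ j, |v j| := Finset.sum_nonneg fun j _ => abs_nonneg _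
  have h3 : ∑ j, |v j| = 0 := by
    have := mul_le_mul_of_nonneg_left h2 hκ0
    nlinarith
  refine hv (funext fun j => ?_)
  have := (Finset.sum_eq_zero_iff_of_nonneg fun j _ => abs_nonneg (v j)).1 h3 j (Finset.mem_univ j)
  simpa using this

/-- With known default indicator `z`, the clearing wealths are an affine function of the
endowments. -/
theorem wealth_eq_Delta_sub_delta {x z : Fin n → ℝ} (hx : 0 ≤ x)
    (hz : ∀ i, z i = if N.wealth x i < 0 then 1 else 0) :
    N.wealth x = N.Delta z *ᵥ x - N.delta z := by
  have hz1 : ∀ i, |z i| ≤ 1 := fun i => by rw [hz]; split_ifs <;> simp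
  -- The negative part of the wealth V is -diag(z)V, because z marks exactly the banks with negative
  -- wealth.
  have hp : N.payment x = N.pbar + Matrix.diagonal z *ᵥ N.wealth x := by
    ext i
    rw [Pi.add_apply, Matrix.mulVec_diagonal, hz, payment]
    split_ifs with h
    · rw [max_eq_left (by linarith)]; ring
    · rw [max_eq_right (by linarith)]; ring
  have hV : N.wealth x = x + N.relLiabᵀ *ᵥ N.payment x - N.pbar := by
    ext i
    rw [N.wealth_eq hx]
    rfl
  have hM : (1 - N.relLiabᵀ * Matrix.diagonal z) *ᵥ N.wealth x =
      x - (1 - N.relLiabᵀ) *ᵥ N.pbar := by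
    rw [hp, Matrix.mulVec_add, Matrix.mulVec_mulVec] at hV
    rw [Matrix.sub_mulVec, Matrix.sub_mulVec, Matrix.one_mulVec, Matrix.one_mulVec]
    nth_rewrite 1 [hV]
    abel
  have hu := N.isUnit_one_sub_relLiab_mul_diagonal hz1
  rw [Delta, delta, ← Matrix.mulVec_sub, ← hM, Matrix.mulVec_mulVec, Matrix.nonsing_inv_mul _ hu,
    Matrix.one_mulVec]

end NetworkPricing.FinancialNetwork

/-! ### Comonotonic couplings minimize expectations of submodular functions. -/

section Comonotone

/-- A submodular function on `ℕⁿ` dominates a separable function that agrees with it on the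
diagonal. -/
theorem exists_separable_le_of_submodular {n : ℕ} (H : (Fin n → ℕ) → ℝ)
    (hH : ∀ u w, H (u ⊔ w) + H (u ⊓ w) ≤ H u + H w) :
    ∃ (c : ℝ) (g : Fin n → ℕ → ℝ), (∀ u, c + ∑ j, g j (u j) ≤ H u) ∧
      ∀ m, c + ∑ j, g j m = H fun _ => m := by
  -- The points w m 0, ..., w m n form a staircase from (m, ..., m) to (m+1, ..., m+1), raising one
  -- coordinate at a time. The increments of H along it define the separable minorant.
  set w : ℕ → ℕ → Fin n → ℕ := fun m k i => if (i : ℕ) < k then m + 1 else m with hw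
  set γ : ℕ → ℕ → ℝ := fun m k => H (w m (k + 1)) - H (w m k) with hγ
  set g : Fin n → ℕ → ℝ := fun j m => ∑ l ∈ Finset.range m, γ l j with hg
  have hg0 : ∀ j, g j 0 = 0 := fun j => by simp [hg]
  have hgs : ∀ j m, g j (m + 1) = g j m + γ m j := fun j m => by
    simp only [hg, Finset.sum_range_succ]
  have hdiag : ∀ m, H 0 + ∑ j, g j m = H fun _ => m := by
    intro m
    induction m with
    | zero => simp only [hg0, Finset.sum_const_zero, add_zero]; rfl
    | succ m ih =>
      simp only [hgs]
      rw [Finset.sum_add_distrib, ← add_assoc, ih, Fin.sum_univ_eq_sum_range (fun k => γ m k) n,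
        Finset.sum_range_sub (fun k => H (w m k))]
      have h1 : w m n = fun _ => m + 1 := funext fun i => by simp [hw]
      have h2 : w m 0 = fun _ => m := funext fun i => by simp [hw]
      rw [h1, h2]
      ring
  refine ⟨H 0, g, fun u => ?_, hdiag⟩
  induction hs : ∑ j, u j using Nat.strong_induction_on generalizing u with
  | _ s ih =>
    by_cases hu : u = 0
    · subst hu
      exact (hdiag 0).le
    · obtain ⟨j₀, hj₀⟩ : ∃ j, u j ≠ 0 := by
        by_contra! hcon
        exact hu (funext hcon)
      have : Nonempty (Fin n) := ⟨j₀⟩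
      obtain ⟨j₁, hj₁⟩ := Finite.exists_max u
      set F := Finset.univ.filter fun j => u j = u j₁ with hF
      have hFn : F.Nonempty := ⟨j₁, by simp [hF]⟩
      -- Lower the last coordinate at which u attains its maximum m+1. The result is the infimum of
      -- u and w m j, while their supremum is w m (j+1). Submodularity then says that H drops from u
      -- by at least the staircase increment, and induction on the coordinate sum finishes.
      set j := F.max' hFn with hj
      have hjF : u j = u j₁ := (Finset.mem_filter.1 (F.max'_mem hFn)).2
      have hlast : ∀ i, j < i → u i < u j₁ := fun i hi => by
        refine lt_of_le_of_ne (hj₁ i) fun heq => ?_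
        exact absurd (F.le_max' i (by simp [hF, heq])) (not_le.2 hi)
      obtain ⟨m, hm⟩ : ∃ m, u j₁ = m + 1 := Nat.exists_eq_succ_of_ne_zero
        (by have := hj₁ j₀; omega)
      set u' := Function.update u j m with hu'
      have hu'j : u' j = m := Function.update_self ..
      have hu'i : ∀ i, i ≠ j → u' i = u i := fun i hi => Function.update_of_ne hi ..
      have hinf : u ⊓ w m j = u' := funext fun i => by
        simp only [Pi.inf_apply, hw]
        by_cases hij : i = j
        · subst hij
          rw [hu'j, if_neg (lt_irrefl _), hjF, hm]
          simp
        · rw [hu'i i hij]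
          split_ifs with h
          · exact inf_eq_left.2 (by have := hj₁ i; omega)
          · have : j < i := lt_of_le_of_ne (not_lt.1 h) (Ne.symm hij)
            exact inf_eq_left.2 (by have := hlast i this; omega)
      have hsup : u ⊔ w m j = w m (j + 1) := funext fun i => by
        simp only [Pi.sup_apply, hw]
        by_cases hij : i = j
        · subst hij
          rw [if_neg (lt_irrefl _), if_pos (Nat.lt_succ_self _), hjF, hm]
          simp
        · have hne : (i : ℕ) ≠ j := fun h => hij (Fin.ext h)
          by_cases h : (i : ℕ) < j
          · rw [if_pos h, if_pos (by omega)]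
            exact sup_eq_right.2 (by have := hj₁ i; omega)
          · rw [if_neg h, if_neg (by omega)]
            have : j < i := lt_of_le_of_ne (not_lt.1 h) (Ne.symm hij)
            exact sup_eq_right.2 (by have := hlast i this; omega)
      have hsub := hH u (w m j)
      rw [hinf, hsup] at hsub
      have hsumg : ∑ i, g i (u i) = ∑ i, g i (u' i) + γ m j := by
        rw [← Finset.add_sum_erase _ _ (Finset.mem_univ j),
          ← Finset.add_sum_erase Finset.univ (fun i => g i (u' i)) (Finset.mem_univ j), hu'j, hjF,
          hm, hgs]
        have : ∑ i ∈ Finset.univ.erase j, g i (u i) = ∑ i ∈ Finset.univ.erase j, g i (u' i) :=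
          Finset.sum_congr rfl fun i hi => by rw [hu'i i (Finset.ne_of_mem_erase hi)]
        rw [this]
        ring
      have hlt : ∑ i, u' i < s := by
        rw [← hs]
        refine Finset.sum_lt_sum (fun i _ => ?_) ⟨j, Finset.mem_univ j, ?_⟩
        · by_cases hij : i = j
          · subst hij; rw [hu'j, hjF, hm]; exact Nat.le_succ m
          · rw [hu'i i hij]
        · rw [hu'j, hjF, hm]; exact Nat.lt_succ_self m
      have hrec := ih _ hlt u' rfl
      rw [hsumg]
      simp only [hγ]
      linarith

/-- The index of the cell of width `1 / M` containing `x`, counted from `-M` and cut off at `±M`. -/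
noncomputable def cellIndex (M : ℕ) (x : ℝ) : ℕ := ⌊(M : ℝ) * (min x M + M)⌋₊

/-- The left end point of a cell. -/
noncomputable def cellPoint (M k : ℕ) : ℝ := k / M - M

theorem measurable_cellIndex (M : ℕ) : Measurable (cellIndex M) := by
  unfold cellIndex
  exact Nat.measurable_floor.comp (by fun_prop)

theorem cellIndex_le (M : ℕ) (x : ℝ) : cellIndex M x ≤ 2 * M * M := by
  unfold cellIndex
  refine Nat.floor_le_of_le ?_
  push_cast
  have := min_le_right x (M : ℝ)
  have hM : (0 : ℝ) ≤ M := M.cast_nonneg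
  nlinarith

theorem cellPoint_mono (M : ℕ) : Monotone (cellPoint M) := fun k l h => by
  unfold cellPoint
  gcongr

theorem tendsto_cellPoint_cellIndex (x : ℝ) :
    Tendsto (fun M => cellPoint M (cellIndex M x)) atTop (𝓝 x) := by
  rw [tendsto_iff_dist_tendsto_zero]
  refine squeeze_zero' (Eventually.of_forall fun _ => dist_nonneg) ?_
    tendsto_one_div_atTop_nhds_zero_nat
  obtain ⟨M₀, hM₀⟩ := exists_nat_ge |x|
  filter_upwards [eventually_ge_atTop (M₀ + 1)] with M hM
  have hMx : |x| ≤ M := hM₀.trans (by exact_mod_cast (Nat.le_succ M₀).trans hM)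
  have hpos : (0 : ℝ) < M := by exact_mod_cast (Nat.succ_pos M₀).trans_le hM
  rw [abs_le] at hMx
  unfold cellPoint cellIndex
  rw [min_eq_left hMx.2]
  have h1 := Nat.floor_le (a := (M : ℝ) * (x + M)) (mul_nonneg hpos.le (by linarith))
  have h2 := Nat.lt_floor_add_one ((M : ℝ) * (x + M))
  set k : ℝ := ((⌊(M : ℝ) * (x + M)⌋₊ : ℕ) : ℝ)
  have h3 : k / M ≤ x + M := by rw [div_le_iff₀ hpos]; linarith
  have h4 : x + M ≤ k / M + 1 / M := by rw [← add_div, le_div_iff₀ hpos]; linarith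
  rw [Real.dist_eq, abs_le]
  constructor <;> linarith

variable {Ω : Type*} {m : MeasurableSpace Ω} {Q : Measure Ω} [IsProbabilityMeasure Q]

/-- Among all couplings of identical marginals, the comonotonic one minimizes the expectation of a
submodular function. -/
theorem integral_diagonal_le_of_submodular {n : ℕ} {H : (Fin n → ℝ) → ℝ} (hc : Continuous H)
    {b : ℝ} (hb : ∀ u, |H u| ≤ b) (hH : ∀ u w, H (u ⊔ w) + H (u ⊓ w) ≤ H u + H w)
    {U : Fin n → Ω → ℝ} {V : Ω → ℝ} (hU : ∀ j, Measurable (U j)) (hV : Measurable V)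
    (hlaw : ∀ j, Q.map (U j) = Q.map V) :
    ∫ ω, H (fun _ => V ω) ∂Q ≤ ∫ ω, H (fun j => U j ω) ∂Q := by
  -- After rounding to a grid there is a separable minorant with equality on the diagonal. Its
  -- expectation depends only on the marginals, hence is the same for both couplings.
  have hstep : ∀ M : ℕ, ∫ ω, H (fun _ => cellPoint M (cellIndex M (V ω))) ∂Q ≤
      ∫ ω, H (fun j => cellPoint M (cellIndex M (U j ω))) ∂Q := by
    intro M
    obtain ⟨c, g, hle, heq⟩ := exists_separable_le_of_submodular
      (fun u : Fin n → ℕ => H fun j => cellPoint M (u j)) (fun u w => by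
        have h := hH (fun j => cellPoint M (u j)) (fun j => cellPoint M (w j))
        convert h using 3
        · ext j
          exact (cellPoint_mono M).map_sup _ _
        · ext j
          exact (cellPoint_mono M).map_inf _ _)
    have hgm : ∀ j, Measurable fun x => g j (cellIndex M x) := fun j =>
      (measurable_of_countable (g j)).comp (measurable_cellIndex M)
    have hgb : ∀ j x, ‖g j (cellIndex M x)‖ ≤ ∑ k ∈ Finset.range (2 * M * M + 1), |g j k| :=
      fun j x => Finset.single_le_sum (f := fun k => |g j k|) (fun k _ => abs_nonneg _)
        (Finset.mem_range.2 (Nat.lt_succ_of_le (cellIndex_le M x)))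
    have hgi : ∀ j (X : Ω → ℝ), Measurable X → Integrable (fun ω => g j (cellIndex M (X ω))) Q :=
      fun j X hX => Integrable.of_bound ((hgm j).comp hX).aestronglyMeasurable _
        (ae_of_all _ fun ω => hgb j (X ω))
    have hsame : ∀ j, ∫ ω, g j (cellIndex M (U j ω)) ∂Q = ∫ ω, g j (cellIndex M (V ω)) ∂Q :=
      fun j => by
        rw [← integral_map (f := fun x => g j (cellIndex M x)) (hU j).aemeasurable
            (hgm j).aestronglyMeasurable, hlaw j,
          integral_map hV.aemeasurable (hgm j).aestronglyMeasurable]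
    calc ∫ ω, H (fun _ => cellPoint M (cellIndex M (V ω))) ∂Q
        = ∫ ω, (c + ∑ j, g j (cellIndex M (V ω))) ∂Q :=
          integral_congr_ae (ae_of_all _ fun ω => (heq (cellIndex M (V ω))).symm)
      _ = ∫ ω, (c + ∑ j, g j (cellIndex M (U j ω))) ∂Q := by
          rw [integral_add (integrable_const _) (integrable_finsetSum _ fun j _ => hgi j V hV),
            integral_add (integrable_const _)
              (integrable_finsetSum _ fun j _ => hgi j (U j) (hU j)),
            integral_finsetSum _ fun j _ => hgi j V hV,
            integral_finsetSum _ fun j _ => hgi j (U j) (hU j)]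
          simp only [hsame]
      _ ≤ _ := by
          refine integral_mono ((integrable_const _).add
            (integrable_finsetSum _ fun j _ => hgi j (U j) (hU j)))
            (Integrable.of_bound (C := b) (hc.measurable.comp (measurable_pi_lambda _ fun j => ?_)
              ).aestronglyMeasurable (ae_of_all _ fun ω => hb _)) fun ω => hle _
          exact (measurable_of_countable (cellPoint M)).comp
            ((measurable_cellIndex M).comp (hU j))
  -- The rounded points converge as the grid is refined, and H is bounded and continuous, so
  -- dominated convergence removes the rounding.
  have hlim : ∀ X : Fin n → Ω → ℝ, (∀ j, Measurable (X j)) →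
      Tendsto (fun M => ∫ ω, H (fun j => cellPoint M (cellIndex M (X j ω))) ∂Q) atTop
        (𝓝 (∫ ω, H (fun j => X j ω) ∂Q)) := fun X hX => by
    refine tendsto_integral_of_dominated_convergence (fun _ => b) (fun M => ?_)
      (integrable_const _) (fun M => ae_of_all _ fun ω => hb _) (ae_of_all _ fun ω => ?_)
    · refine (hc.measurable.comp (measurable_pi_lambda _ fun j => ?_)).aestronglyMeasurable
      exact (measurable_of_countable (cellPoint M)).comp ((measurable_cellIndex M).comp (hX j))
    · exact (hc.tendsto _).comp (tendsto_pi_nhds.2 fun j => tendsto_cellPoint_cellIndex (X j ω))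
  exact le_of_tendsto_of_tendsto' (hlim (fun _ => V) fun _ => hV) (hlim U hU) hstep

end Comonotone

/-! ### Default thresholds along the market curve. -/

section Threshold

variable {n : ℕ} (N : FinancialNetwork n) {s : Fin n → ℝ} (r : ℝ) {σM : ℝ} (T : ℝ)
  {z : Fin n → ℝ}

theorem marketMap_nonneg (y : ℝ≥0) (j : Fin n) : 0 ≤ marketMap r σM T z y j := by
  unfold marketMap
  positivity

theorem scaled_marketMap_nonneg (hs : ∀ i, 0 ≤ s i) (y : ℝ≥0) :
    0 ≤ fun j => s j * marketMap r σM T z y j := fun j =>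
  mul_nonneg (hs j) (marketMap_nonneg r T y j)

theorem scaled_marketMap_mono (hσM : 0 < σM) (hs : ∀ i, 0 ≤ s i) (hz : ∀ i, 0 ≤ z i) :
    Monotone fun (y : ℝ≥0) j => s j * marketMap r σM T z y j := fun y y' h j => by
  have hz' := div_nonneg (hz j) hσM.le
  have hy : (y : ℝ) ≤ y' := by exact_mod_cast h
  refine mul_le_mul_of_nonneg_left ?_ (hs j)
  exact mul_le_mul_of_nonneg_left (Real.rpow_le_rpow y.coe_nonneg hy hz') (Real.exp_pos _).le

theorem continuous_scaled_marketMap (hσM : 0 < σM) (hz : ∀ i, 0 ≤ z i) :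
    Continuous fun (y : ℝ≥0) j => s j * marketMap r σM T z y j := by
  refine continuous_pi fun j => ?_
  have hz' := div_nonneg (hz j) hσM.le
  have h := (Real.continuous_rpow_const hz').comp NNReal.continuous_coe
  exact continuous_const.mul (continuous_const.mul h)

/-- Bank `j` defaults exactly at the market prices below its threshold. -/
theorem wealth_neg_iff_lt_qStar (hσM : 0 < σM) (hs : ∀ i, 0 ≤ s i) (hz : ∀ i, 0 ≤ z i)
    (y : ℝ≥0) (j : Fin n) :
    N.wealth (fun j => s j * marketMap r σM T z y j) j < 0 ↔ (y : ℝ≥0∞) < qStar N s r σM T z j := by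
  have hmono : Monotone fun y : ℝ≥0 => N.wealth (fun j => s j * marketMap r σM T z y j) j :=
    fun y y' h => N.wealth_mono (scaled_marketMap_nonneg r T hs y)
      (scaled_marketMap_mono r T hσM hs hz h) j
  have hcont : Continuous fun y : ℝ≥0 => N.wealth (fun j => s j * marketMap r σM T z y j) j :=
    (continuous_apply j).comp (N.continuousOn_wealth.comp_continuous
      (continuous_scaled_marketMap r T hσM hz) fun y => scaled_marketMap_nonneg r T hs y)
  constructor
  · intro h
    -- By continuity default persists at some price y' > y. This makes y strictly smaller than the
    -- infimum, not merely at most equal to it.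
    have hev : ∀ᶠ y' : ℝ≥0 in 𝓝[>] y, N.wealth (fun j => s j * marketMap r σM T z y' j) j < 0 :=
      (hcont.tendsto y).eventually_lt_const h |>.filter_mono nhdsWithin_le_nhds
    obtain ⟨y', h1, h2⟩ := (hev.and self_mem_nhdsWithin).exists
    have h2' : y < y' := h2
    refine (ENNReal.coe_lt_coe.2 h2').trans_le (le_iInf₂ fun u hu => ENNReal.coe_le_coe.2 ?_)
    by_contra! hcon
    exact absurd (hu.trans (hmono hcon.le)) (not_le.2 h1)
  · intro h
    by_contra! hcon
    exact absurd (iInf₂_le y hcon) (not_le.2 h)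

variable (τ : Equiv.Perm (Fin n))

theorem ordered_succ_symm (v : Fin n → ℝ≥0∞) (j : Fin n) :
    ordered v τ ((τ.symm j : ℕ) + 1) = v j := by
  simp [ordered]

theorem ordered_antitone {v : Fin n → ℝ≥0∞} (h : Antitone fun k => v (τ k)) :
    Antitone (ordered v τ) := by
  refine antitone_nat_of_succ_le fun k => ?_
  cases k with
  | zero => exact le_top
  | succ k =>
    simp only [ordered]
    split_ifs with h1 h2
    · exact h (Fin.mk_le_mk.2 (Nat.le_succ k))
    · omega
    · exact zero_le
    · exact le_rfl

theorem ordered_succ_self (v : Fin n → ℝ≥0∞) : ordered v τ (n + 1) = 0 := by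
  simp [ordered]

/-- The default indicator between two consecutive thresholds. -/
theorem firstBanks_eq_of_between {v : Fin n → ℝ≥0∞} (h : Antitone fun k => v (τ k)) {k : ℕ}
    {y : ℝ≥0∞} (h1 : ordered v τ (k + 1) ≤ y) (h2 : y < ordered v τ k) (j : Fin n) :
    firstBanks τ k j = if y < v j then 1 else 0 := by
  have hanti := ordered_antitone τ h
  unfold firstBanks
  rw [← ordered_succ_symm τ v j]
  by_cases hk : (τ.symm j : ℕ) < k
  · rw [if_pos hk, if_pos (h2.trans_le (hanti hk))]
  · rw [if_neg hk, if_neg (not_lt.2 ((hanti (by omega)).trans h1))]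

/-- Indicator of the market prices below a threshold. -/
noncomputable def below (v : ℝ≥0∞) (y : ℝ≥0) : ℝ := if (y : ℝ≥0∞) < v then 1 else 0

/-- The payment of a bank as a piecewise affine function of the endowments along the market. -/
theorem payment_marketMap_eq (hσM : 0 < σM) (hs : ∀ i, 0 ≤ s i) (hz : ∀ i, 0 ≤ z i)
    (h : Antitone fun k => qStar N s r σM T z (τ k)) (y : ℝ≥0) (i : Fin n) :
    N.payment (fun j => s j * marketMap r σM T z y j) i = N.pbar i +
      ∑ k ∈ Finset.Icc ((τ.symm i : ℕ) + 1) n,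
        (below (ordered (qStar N s r σM T z) τ k) y -
          below (ordered (qStar N s r σM T z) τ (k + 1)) y) *
        ((N.Delta (firstBanks τ k) *ᵥ fun j => s j * marketMap r σM T z y j) i -
          N.delta (firstBanks τ k) i) := by
  set x : Fin n → ℝ := fun j => s j * marketMap r σM T z y j with hx
  have hx0 : 0 ≤ x := scaled_marketMap_nonneg r T hs y
  set v := ordered (qStar N s r σM T z) τ with hv
  -- The difference of indicators is nonzero only if v (k+1) ≤ y < v k. Then exactly the first k
  -- banks default and the affine formula gives the true wealth.
  have hterm : ∀ k, (below (v k) y - below (v (k + 1)) y) *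
        ((N.Delta (firstBanks τ k) *ᵥ x) i - N.delta (firstBanks τ k) i) =
      (below (v k) y - below (v (k + 1)) y) * N.wealth x i := fun k => by
    have hle : v (k + 1) ≤ v k := ordered_antitone τ h (Nat.le_succ k)
    unfold below
    by_cases h1 : (y : ℝ≥0∞) < v (k + 1)
    · rw [if_pos h1, if_pos (h1.trans_le hle)]
      ring
    · by_cases h2 : (y : ℝ≥0∞) < v k
      · have hV := N.wealth_eq_Delta_sub_delta (z := firstBanks τ k) hx0 fun j => by
          rw [firstBanks_eq_of_between τ h (not_lt.1 h1) h2]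
          simp only [← wealth_neg_iff_lt_qStar N r T hσM hs hz y j, hx]
        rw [congrFun hV i, Pi.sub_apply]
      · rw [if_neg h1, if_neg h2]
        ring
  -- The differences telescope, and the last indicator vanishes because v (n+1) = 0. With a the
  -- position of bank i, what remains is the indicator of its own default, and multiplied by the
  -- wealth this is minus the negative part.
  have hsum : ∀ a ≤ n, ∑ k ∈ Finset.Icc (a + 1) n, (below (v k) y - below (v (k + 1)) y) =
      below (v (a + 1)) y := fun a ha => by
    have h1 := Finset.sum_Ico_sub (fun k => below (v k) y) (show a + 1 ≤ n + 1 by omega)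
    rw [← Finset.Ico_add_one_right_eq_Icc]
    have h2 : below (v (n + 1)) y = 0 := by
      rw [hv, ordered_succ_self]
      simp [below]
    rw [h2] at h1
    rw [← neg_inj, ← Finset.sum_neg_distrib]
    simpa using h1
  simp only [hterm]
  rw [← Finset.sum_mul, hsum _ (τ.symm i).2.le, hv, ordered_succ_symm]
  unfold FinancialNetwork.payment below
  have hiff := wealth_neg_iff_lt_qStar N r T hσM hs hz y i
  by_cases h1 : N.wealth x i < 0
  · rw [if_pos (hiff.1 h1), max_eq_left (by linarith)]
    ring
  · rw [if_neg (fun h2 => h1 (hiff.2 h2)), max_eq_right (by linarith)]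
    ring

end Threshold

/-! ### Lognormal expectations below a price threshold. -/

section GaussianPrice

/-- The scalar form of `d1`. -/
noncomputable def dScalar (r σM T z : ℝ) (v : ℝ≥0∞) : EReal :=
  (ENNReal.log (1 / v) + (((r - 1 / 2 * (σM - 2 * z) * σM) * T : ℝ) : EReal)) /
    ((σM * Real.sqrt T : ℝ) : EReal)

theorem d2_eq_dScalar (r σM T : ℝ) (v : ℝ≥0∞) : d2 r σM T v = dScalar r σM T 0 v := by
  unfold d2 dScalar
  congr 5
  ring

/-- After tilting by exp(zw), W̃_T has the law of √T x + zT with x standard normal. Solving the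
price inequality for x gives the bound -d, and the thresholds 0 and ∞ match the conventions at
infinity. -/
theorem Phi_neg_dScalar {r σM T z : ℝ} (hσM : 0 < σM) (hT : 0 < T) (v : ℝ≥0∞) :
    Phi (-dScalar r σM T z v) = (gaussianReal 0 1).real
      {x | ENNReal.ofReal (Real.exp ((r - σM ^ 2 / 2) * T + σM * (√T * x + z * T))) < v} := by
  have hsT : 0 < √T := Real.sqrt_pos.2 hT
  have hden : (0 : EReal) < ((σM * √T : ℝ) : EReal) := by
    exact_mod_cast mul_pos hσM hsT
  unfold Phi dScalar
  rcases eq_or_ne v 0 with rfl | h0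
  · rw [ENNReal.div_zero one_ne_zero, ENNReal.log_top, EReal.top_add_coe,
      EReal.top_div_of_pos_ne_top hden (EReal.coe_ne_top _)]
    simp
  rcases eq_or_ne v ⊤ with rfl | htop
  · rw [ENNReal.div_top, ENNReal.log_zero, EReal.bot_add,
      EReal.bot_div_of_pos_ne_top hden (EReal.coe_ne_top _)]
    simp
  obtain ⟨c, hc, rfl⟩ : ∃ c : ℝ, 0 < c ∧ v = ENNReal.ofReal c :=
    ⟨v.toReal, ENNReal.toReal_pos h0 htop, (ENNReal.ofReal_toReal htop).symm⟩
  rw [one_div, ENNReal.log_inv, ENNReal.log_ofReal_of_pos hc, ← EReal.coe_neg, ← EReal.coe_add,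
    ← EReal.coe_div, ← EReal.coe_neg]
  set d : ℝ := -((-Real.log c + (r - 1 / 2 * (σM - 2 * z) * σM) * T) / (σM * √T)) with hd
  have hset : {x : ℝ | ENNReal.ofReal (Real.exp ((r - σM ^ 2 / 2) * T + σM * (√T * x + z * T))) <
      ENNReal.ofReal c} = Set.Iio d := by
    ext x
    rw [Set.mem_ofPred_eq, ENNReal.ofReal_lt_ofReal_iff hc, ← Real.lt_log_iff_exp_lt hc,
      Set.mem_Iio, hd, ← neg_div, lt_div_iff₀ (mul_pos hσM hsT)]
    constructor <;> intro h <;> nlinarith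
  have hset2 : {y : ℝ | (y : EReal) ≤ (d : EReal)} = Set.Iic d := by
    ext x
    simp
  rw [hset, hset2]
  -- The price inequality is strict whereas Φ uses a closed half-line; the Gaussian law has no
  -- atoms.
  have := nullSingletonClass_gaussianReal (μ := 0) (v := 1) one_ne_zero
  exact measureReal_congr Iio_ae_eq_Iic.symm

/-- Gaussian expectation of a lognormal variable below a threshold of the market price. -/
theorem integral_below_mul_exp {r σM z : ℝ} {T : ℝ≥0} (hσM : 0 < σM) (hT : 0 < T) (v : ℝ≥0∞) :
    ∫ w, (if ENNReal.ofReal (Real.exp ((r - σM ^ 2 / 2) * T + σM * w)) < v then (1 : ℝ) else 0) *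
      Real.exp ((r - z ^ 2 / 2) * T + z * w) ∂gaussianReal 0 T =
      Real.exp (r * T) * Phi (-dScalar r σM T z v) := by
  have hTr : (0 : ℝ) < T := by exact_mod_cast hT
  set S : Set ℝ := {w | ENNReal.ofReal (Real.exp ((r - σM ^ 2 / 2) * T + σM * w)) < v} with hS
  have hSm : MeasurableSet S := measurableSet_lt (by fun_prop) measurable_const
  have h1 : ∀ w : ℝ, (if ENNReal.ofReal (Real.exp ((r - σM ^ 2 / 2) * T + σM * w)) < v
      then (1 : ℝ) else 0) * Real.exp ((r - z ^ 2 / 2) * T + z * w) =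
      Real.exp ((r - z ^ 2 / 2) * T) * (Real.exp (z * w) * S.indicator 1 w) := fun w => by
    rw [Real.exp_add ((r - z ^ 2 / 2) * T)]
    simp only [Set.indicator, hS, Set.mem_ofPred_eq, Pi.one_apply]
    ring
  simp_rw [h1]
  rw [integral_const_mul, integral_exp_mul_gaussianReal, integral_indicator_one hSm,
    Phi_neg_dScalar hσM hTr]
  have hmap : gaussianReal (0 + T * z) T =
      (gaussianReal 0 1).map (fun x => √(T : ℝ) * x + z * T) := by
    have h2 : (fun x => √(T : ℝ) * x + z * T) = (fun x => x + z * T) ∘ fun x => √(T : ℝ) * x := rfl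
    rw [h2, ← Measure.map_map (by fun_prop) (by fun_prop), gaussianReal_map_const_mul,
      gaussianReal_map_add_const]
    congr 1
    · ring
    · ext
      simp
  rw [hmap, map_measureReal_apply (by fun_prop) hSm, ← mul_assoc, ← Real.exp_add]
  congr 2
  ring

end GaussianPrice

/-! ### Change of measure at the horizon. -/

section RiskNeutral

variable {Ω : Type*} {m : MeasurableSpace Ω} {P : Measure Ω}

theorem map_withDensity_comp {E : Type*} [MeasurableSpace E] {f : Ω → E} (hf : Measurable f)
    {g : E → ℝ≥0∞} (hg : Measurable g) :
    (P.withDensity fun ω => g (f ω)).map f = (P.map f).withDensity g := by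
  ext s hs
  rw [Measure.map_apply hf hs, withDensity_apply _ (hf hs), withDensity_apply _ hs,
    setLIntegral_map hs hg hf]

variable {W : ℝ≥0 → Ω → ℝ} {r μM σM : ℝ} {T : ℝ≥0}

/-- Under the risk-neutral measure, the shifted terminal value of `W` is centred Gaussian, and
independent of everything that is independent of `W` under `P`, with unchanged law. -/
theorem map_riskNeutral_prod [IsProbabilityMeasure P] {E : Type*} [MeasurableSpace E] {X : Ω → E}
    (hW : Measurable (W T))
    (hX : Measurable X) (hlaw : P.map (W T) = gaussianReal 0 T) (hind : IndepFun (W T) X P) :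
    (riskNeutral P W r μM σM T).map (fun ω => (wTilde W r μM σM T ω, X ω)) =
      (gaussianReal 0 T).prod (P.map X) := by
  set θ := (μM - r) / σM with hθ
  have hprob : IsProbabilityMeasure (P.map X) := Measure.isProbabilityMeasure_map hX.aemeasurable
  -- The density of Q as a function of W_T, written in the form of the tilting formula with mean 0
  -- and parameter -θ. It does not involve X, so the product structure and the law of X survive.
  set g : ℝ → ℝ≥0∞ := fun x => ENNReal.ofReal (Real.exp ((-θ) * x - 0 * (-θ) - T * (-θ) ^ 2 / 2))
    with hg
  have hgm : Measurable g := by fun_prop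
  have hWX : Measurable fun ω => (W T ω, X ω) := hW.prodMk hX
  have h1 : riskNeutral P W r μM σM T = P.withDensity fun ω => (fun p : ℝ × E => g p.1) (W T ω, X ω)
      := by
    unfold riskNeutral
    congr 1
    ext ω
    simp only [hg, ← hθ]
    congr 2
    ring
  have h2 : (riskNeutral P W r μM σM T).map (fun ω => (W T ω, X ω)) =
      (gaussianReal (-(θ * T)) T).prod (P.map X) := by
    rw [h1, map_withDensity_comp (g := fun p : ℝ × E => g p.1) hWX (hgm.comp measurable_fst),
      (indepFun_iff_map_prod_eq_prod_map_map hW.aemeasurable hX.aemeasurable).1 hind, hlaw,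
      ← prod_withDensity_left hgm, gaussianReal_withDensity_exp]
    congr 2
    ring
  have h3 : (fun ω => (wTilde W r μM σM T ω, X ω)) =
      Prod.map (fun x => x + θ * T) id ∘ fun ω => (W T ω, X ω) := rfl
  rw [h3, ← Measure.map_map (by fun_prop) hWX, h2,
    ← Measure.map_prod_map _ _ (by fun_prop) measurable_id, gaussianReal_map_add_const,
    Measure.map_id]
  congr 2
  ring

theorem riskNeutral_absolutelyContinuous : riskNeutral P W r μM σM T ≪ P :=
  withDensity_absolutelyContinuous _ _

end RiskNeutral

/-! ### Integrability of payments and the two bounds. -/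

section Payments

variable {n : ℕ} (N : FinancialNetwork n) {Ω : Type*} {m : MeasurableSpace Ω} {Q : Measure Ω}

theorem integrable_payment [IsFiniteMeasure Q] {X : Ω → Fin n → ℝ} (hX : Measurable X)
    (h0 : ∀ ω, 0 ≤ X ω) (i : Fin n) : Integrable (fun ω => N.payment (X ω) i) Q := by
  -- Continuity of the payments is known only on the nonnegative orthant; composing with positive
  -- parts extends it to the whole space and so yields measurability.
  have hc : Continuous fun x : Fin n → ℝ => N.payment (fun j => max (x j) 0) i :=
    (continuous_apply i).comp (N.continuousOn_payment.comp_continuous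
      (by fun_prop) fun x j => le_max_right _ _)
  refine Integrable.of_bound (C := N.pbar i) ?_ (ae_of_all _ fun ω => ?_)
  · refine (hc.measurable.comp hX).aestronglyMeasurable.congr (ae_of_all _ fun ω => ?_)
    have h : (fun j => max (X ω j) 0) = X ω := funext fun j => max_eq_left (h0 ω j)
    simp only [Function.comp, h]
  · rw [Real.norm_eq_abs, abs_of_nonneg (N.payment_nonneg (h0 ω) i)]
    exact N.payment_le_pbar _ i

theorem debtPrice_eq (s : Fin n → ℝ) (r T : ℝ) (Y : Ω → Fin n → ℝ) (i : Fin n) :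
    debtPrice N Q s r T Y i = Real.exp (-r * T) / N.pbar i *
      ∫ ω, N.payment (fun j => s j * Y ω j) i ∂Q := by
  unfold debtPrice
  rw [← integral_const_mul]
  congr 1
  ext ω
  ring

theorem debtPrice_congr {s : Fin n → ℝ} {r T : ℝ} {Y Z : Ω → Fin n → ℝ} (h : Y =ᵐ[Q] Z)
    (i : Fin n) : debtPrice N Q s r T Y i = debtPrice N Q s r T Z i :=
  integral_congr_ae (by filter_upwards [h] with ω hω; rw [hω])

theorem debtPrice_le_of_integral_le {s : Fin n → ℝ} {r T : ℝ} {Y Z : Ω → Fin n → ℝ} {i : Fin n}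
    (h : ∫ ω, N.payment (fun j => s j * Y ω j) i ∂Q ≤
      ∫ ω, N.payment (fun j => s j * Z ω j) i ∂Q) :
    debtPrice N Q s r T Y i ≤ debtPrice N Q s r T Z i := by
  rw [debtPrice_eq, debtPrice_eq]
  exact mul_le_mul_of_nonneg_left h (div_nonneg (Real.exp_pos _).le (N.pbar_pos i).le)

/-- Comonotonic lognormal endowments give the lowest expected payments. -/
theorem integral_payment_diagonal_le [IsProbabilityMeasure Q] {s : Fin n → ℝ}
    (hs : ∀ i, 0 ≤ s i) (a σ : Fin n → ℝ) (hσ : ∀ i, 0 ≤ σ i) {U : Fin n → Ω → ℝ} {V : Ω → ℝ}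
    (hU : ∀ j, Measurable (U j)) (hV : Measurable V) (hlaw : ∀ j, Q.map (U j) = Q.map V)
    (i : Fin n) :
    ∫ ω, N.payment (fun j => s j * Real.exp (a j + σ j * V ω)) i ∂Q ≤
      ∫ ω, N.payment (fun j => s j * Real.exp (a j + σ j * U j ω)) i ∂Q := by
  set e : (Fin n → ℝ) → Fin n → ℝ := fun u j => s j * Real.exp (a j + σ j * u j) with he
  have he0 : ∀ u, 0 ≤ e u := fun u j => mul_nonneg (hs j) (Real.exp_pos _).le
  have hem : ∀ j, Monotone fun x : ℝ => s j * Real.exp (a j + σ j * x) := fun j x y h =>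
    mul_le_mul_of_nonneg_left (Real.exp_le_exp.2 (by
      have := mul_le_mul_of_nonneg_left h (hσ j); linarith)) (hs j)
  have hec : Continuous e := by fun_prop
  refine integral_diagonal_le_of_submodular (H := fun u => N.payment (e u) i) (b := N.pbar i)
    ((continuous_apply i).comp (N.continuousOn_payment.comp_continuous hec he0))
    (fun u => ?_) (fun u w => ?_) hU hV hlaw
  · rw [abs_of_nonneg (N.payment_nonneg (he0 u) i)]
    exact N.payment_le_pbar _ i
  -- Coordinatewise nondecreasing maps commute with suprema and infima, so submodularity passes from
  -- endowments to Gaussian coordinates.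
  · have h1 : e (u ⊔ w) = e u ⊔ e w := funext fun j => (hem j).map_sup _ _
    have h2 : e (u ⊓ w) = e u ⊓ e w := funext fun j => (hem j).map_inf _ _
    rw [h1, h2]
    exact N.payment_submodular (he0 u) (he0 w) i

/-- Averaging out independent multiplicative noise raises expected payments. -/
theorem integral_payment_mul_le {E F : Type*} [MeasurableSpace E] [MeasurableSpace F]
    {μ : Measure E} {ν : Measure F} [IsProbabilityMeasure μ] [IsProbabilityMeasure ν]
    {f : E → Fin n → ℝ} {g : F → Fin n → ℝ} (hf : Measurable f) (hg : Measurable g)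
    (hf0 : ∀ x, 0 ≤ f x) (hg0 : ∀ y, 0 ≤ g y) (hgi : ∀ j, Integrable (fun y => g y j) ν)
    (hg1 : ∀ j, ∫ y, g y j ∂ν = 1) (i : Fin n) :
    ∫ p, N.payment (fun j => f p.1 j * g p.2 j) i ∂μ.prod ν ≤ ∫ x, N.payment (f x) i ∂μ := by
  have hm : Measurable fun p : E × F => (fun j => f p.1 j * g p.2 j) :=
    measurable_pi_lambda _ fun j => ((measurable_pi_apply j).comp (hf.comp measurable_fst)).mul
      ((measurable_pi_apply j).comp (hg.comp measurable_snd))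
  have hint := integrable_payment N (Q := μ.prod ν) hm
    (fun p j => mul_nonneg (hf0 p.1 j) (hg0 p.2 j)) i
  rw [integral_prod _ hint]
  refine integral_mono hint.integral_prod_left (integrable_payment N hf hf0 i) fun x => ?_
  have hmx : Measurable fun y : F => (fun j => f x j * g y j) :=
    measurable_pi_lambda _ fun j => ((measurable_pi_apply j).comp hg).const_mul _
  have h0 : ∀ y : F, 0 ≤ fun j => f x j * g y j := fun y j => mul_nonneg (hf0 x j) (hg0 y j)
  have hI : ∀ j, Integrable (fun y => f x j * g y j) ν := fun j => (hgi j).const_mul _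
  -- Jensen's inequality in the noise y with the market state x fixed; the mean of the endowments is
  -- f x, because each noise factor has mean 1.
  have hJ := (N.payment_concave i).le_map_integral (μ := ν) (f := fun y j => f x j * g y j)
    (((continuous_apply i).continuousOn).comp N.continuousOn_payment fun _ _ => Set.mem_univ _)
    isClosed_Ici (ae_of_all _ h0) (Integrable.of_eval hI) (integrable_payment N hmx h0 i)
  refine hJ.trans (le_of_eq ?_)
  congr 2
  ext j
  rw [eval_integral hI, integral_const_mul, hg1, mul_one]

end Payments

/-! ### Closed form for endowments driven by one Gaussian variable. -/

section LognormalPrices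

variable {n : ℕ} {Ω : Type*} {m : MeasurableSpace Ω} {Q : Measure Ω}

theorem marketMap_exp {r σM T : ℝ} (hσM : 0 < σM) (z : Fin n → ℝ) (w : ℝ) (j : Fin n) :
    marketMap r σM T z (Real.exp ((r - σM ^ 2 / 2) * T + σM * w)) j =
      Real.exp ((r - z j ^ 2 / 2) * T + z j * w) := by
  unfold marketMap
  rw [← Real.exp_mul, ← Real.exp_add]
  congr 1
  field_simp
  ring

theorem integral_map_gaussianReal {G : Ω → ℝ} {T : ℝ≥0} (hG : Measurable G)
    (hlaw : Q.map G = gaussianReal 0 T) {f : ℝ → ℝ} (hf : Measurable f) :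
    ∫ ω, f (G ω) ∂Q = ∫ w, f w ∂gaussianReal 0 T := by
  rw [← hlaw, integral_map hG.aemeasurable hf.aestronglyMeasurable]

theorem integrable_exp_add_mul {G : Ω → ℝ} {T : ℝ≥0} (hG : Measurable G)
    (hlaw : Q.map G = gaussianReal 0 T) (a c : ℝ) :
    Integrable (fun ω => Real.exp (a + c * G ω)) Q := by
  have h := integrable_exp_mul_gaussianReal (μ := 0) (v := T) c
  rw [← hlaw, integrable_map_measure (by fun_prop) hG.aemeasurable] at h
  refine (h.const_mul (Real.exp a)).congr (ae_of_all _ fun ω => ?_)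
  simp only [Function.comp, Real.exp_add]

theorem integral_exp_sq_add_mul {G : Ω → ℝ} {T : ℝ≥0} (hG : Measurable G)
    (hlaw : Q.map G = gaussianReal 0 T) (c : ℝ) :
    ∫ ω, Real.exp (-(c ^ 2 / 2) * T + c * G ω) ∂Q = 1 := by
  rw [integral_map_gaussianReal hG hlaw (f := fun w => Real.exp (-(c ^ 2 / 2) * T + c * w))
    (by fun_prop)]
  have h := integral_exp_mul_gaussianReal (fun _ => 1) 0 c T
  simp only [mul_one, integral_const, probReal_univ, smul_eq_mul] at h
  simp_rw [Real.exp_add]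
  rw [integral_const_mul, h, ← Real.exp_add]
  simp
  ring

/-- Closed form of the debt price for lognormal endowments driven by one Gaussian variable. -/
theorem debtPrice_lognormal_eq_closedForm [IsProbabilityMeasure Q] (N : FinancialNetwork n)
    {s : Fin n → ℝ} {r σM : ℝ} {T : ℝ≥0} {z : Fin n → ℝ} (hσM : 0 < σM) (hT : 0 < T)
    (hs : ∀ i, 0 ≤ s i) (hz : ∀ i, 0 ≤ z i) {G : Ω → ℝ} (hG : Measurable G)
    (hlaw : Q.map G = gaussianReal 0 T) (τ : Equiv.Perm (Fin n))
    (h : Antitone fun k => qStar N s r σM T z (τ k)) (i : Fin n) :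
    debtPrice N Q s r T (fun ω j => Real.exp ((r - z j ^ 2 / 2) * T + z j * G ω)) i =
      closedForm N s r σM T z τ i := by
  -- The market price at the horizon, as a function of the driving Gaussian variable.
  set y : Ω → ℝ≥0 := fun ω => (Real.exp ((r - σM ^ 2 / 2) * T + σM * G ω)).toNNReal with hy
  set X : Ω → Fin n → ℝ := fun ω j => Real.exp ((r - z j ^ 2 / 2) * T + z j * G ω) with hX
  set v := ordered (qStar N s r σM T z) τ with hv
  have hXy : ∀ ω j, marketMap r σM T z (y ω) j = X ω j := fun ω j => by
    rw [hy, Real.coe_toNNReal _ (Real.exp_pos _).le, marketMap_exp hσM]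
  have hbm : ∀ u, Measurable fun ω => below u (y ω) := fun u => by
    refine Measurable.ite (measurableSet_lt ?_ measurable_const) measurable_const measurable_const
    exact measurable_coe_nnreal_ennreal.comp (by fun_prop)
  have hb1 : ∀ u ω, |below u (y ω)| ≤ 1 := fun u ω => by
    unfold below; split_ifs <;> simp
  have hXi : ∀ j, Integrable (fun ω => X ω j) Q := fun j => integrable_exp_add_mul hG hlaw _ _
  have hbi : ∀ u, Integrable (fun ω => below u (y ω)) Q := fun u =>
    Integrable.of_bound (hbm u).aestronglyMeasurable 1 (ae_of_all _ (hb1 u))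
  have hbXi : ∀ u j, Integrable (fun ω => below u (y ω) * X ω j) Q := fun u j =>
    (hXi j).bdd_mul (hbm u).aestronglyMeasurable (ae_of_all _ (hb1 u))
  have hbX : ∀ u j, ∫ ω, below u (y ω) * X ω j ∂Q =
      Real.exp (r * T) * Phi (-d1 r σM T z u j) := fun u j => by
    have h1 := integral_below_mul_exp (r := r) (z := z j) hσM hT u
    rw [← integral_map_gaussianReal hG hlaw (f := fun w =>
      (if ENNReal.ofReal (Real.exp ((r - σM ^ 2 / 2) * T + σM * w)) < u then (1 : ℝ) else 0) *
      Real.exp ((r - z j ^ 2 / 2) * T + z j * w)) (Measurable.mul (Measurable.ite (measurableSet_lt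
        (by fun_prop) measurable_const) measurable_const measurable_const) (by fun_prop))] at h1
    exact h1
  have hb : ∀ u, ∫ ω, below u (y ω) ∂Q = Phi (-d2 r σM T u) := fun u => by
    have h1 := integral_below_mul_exp (r := r) (z := 0) hσM hT u
    simp only [zero_mul, add_zero, ne_eq, OfNat.ofNat_ne_zero, not_false_eq_true, zero_pow,
      zero_div, sub_zero] at h1
    rw [integral_mul_const, mul_comm, ← d2_eq_dScalar] at h1
    rw [← mul_left_cancel₀ (Real.exp_pos _).ne' h1,
      ← integral_map_gaussianReal hG hlaw (f := fun w =>
        (if ENNReal.ofReal (Real.exp ((r - σM ^ 2 / 2) * T + σM * w)) < u then (1 : ℝ) else 0))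
        (Measurable.ite (measurableSet_lt (by fun_prop) measurable_const) measurable_const
          measurable_const)]
    rfl
  set D : ℕ → Fin n → ℝ := fun k j => N.Delta (firstBanks τ k) i j with hD
  have hDv : ∀ k f, (N.Delta (firstBanks τ k) *ᵥ f) i = ∑ j, D k j * f j := fun k f => rfl
  have hpay : ∀ ω, N.payment (fun j => s j * X ω j) i = N.pbar i +
      ∑ k ∈ Finset.Icc ((τ.symm i : ℕ) + 1) n,
        (∑ j, D k j * s j *
            (below (v k) (y ω) * X ω j - below (v (k + 1)) (y ω) * X ω j) -
          N.delta (firstBanks τ k) i * (below (v k) (y ω) - below (v (k + 1)) (y ω))) := fun ω => by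
    have h1 := payment_marketMap_eq N r T τ hσM hs hz h (y ω) i
    simp only [hXy] at h1
    rw [h1]
    congr 1
    refine Finset.sum_congr rfl fun k _ => ?_
    rw [mul_sub, hDv, Finset.mul_sum]
    congr 1
    · exact Finset.sum_congr rfl fun j _ => by ring
    · ring
  have hterm0 : ∀ k j, Integrable (fun ω => D k j * s j *
      (below (v k) (y ω) * X ω j - below (v (k + 1)) (y ω) * X ω j)) Q := fun k j =>
    ((hbXi _ j).sub (hbXi _ j)).const_mul _
  have hterm1 : ∀ k, Integrable (fun ω => ∑ j, D k j * s j *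
      (below (v k) (y ω) * X ω j - below (v (k + 1)) (y ω) * X ω j)) Q := fun k =>
    integrable_finsetSum _ fun j _ => hterm0 k j
  have hterm2 : ∀ k, Integrable (fun ω => N.delta (firstBanks τ k) i *
      (below (v k) (y ω) - below (v (k + 1)) (y ω))) Q := fun k =>
    ((hbi _).sub (hbi _)).const_mul _
  have hterm : ∀ k, Integrable (fun ω => ∑ j, D k j * s j *
      (below (v k) (y ω) * X ω j - below (v (k + 1)) (y ω) * X ω j) -
      N.delta (firstBanks τ k) i * (below (v k) (y ω) - below (v (k + 1)) (y ω))) Q := fun k =>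
    (hterm1 k).sub (hterm2 k)
  rw [debtPrice_eq]
  change _ * ∫ ω, N.payment (fun j => s j * X ω j) i ∂Q = _
  simp_rw [hpay]
  rw [integral_add (integrable_const _) (integrable_finsetSum _ fun k _ => hterm k),
    integral_finsetSum _ fun k _ => hterm k]
  -- Discounting cancels the growth factor of the lognormal terms, so only the terms with δ keep a
  -- discount factor.
  have hE : Real.exp (-r * T) * Real.exp (r * T) = 1 := by
    rw [← Real.exp_add]; simp
  have hk : ∀ k, ∫ ω, (∑ j, D k j * s j *
            (below (v k) (y ω) * X ω j - below (v (k + 1)) (y ω) * X ω j) -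
          N.delta (firstBanks τ k) i * (below (v k) (y ω) - below (v (k + 1)) (y ω))) ∂Q =
      Real.exp (r * T) * ((N.Delta (firstBanks τ k) *ᵥ
          (fun j => s j * (Phi (-d1 r σM T z (v k) j) - Phi (-d1 r σM T z (v (k + 1)) j)))) i) -
        N.delta (firstBanks τ k) i * (Phi (-d2 r σM T (v k)) - Phi (-d2 r σM T (v (k + 1)))) :=
    fun k => by
      rw [integral_sub (hterm1 k) (hterm2 k), integral_const_mul,
        integral_sub (hbi _) (hbi _), hb, hb,
        integral_finsetSum _ fun j _ => hterm0 k j]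
      congr 1
      rw [hDv, Finset.mul_sum]
      refine Finset.sum_congr rfl fun j _ => ?_
      rw [integral_const_mul, integral_sub (hbXi _ j) (hbXi _ j), hbX, hbX]
      ring
  simp only [hk]
  unfold closedForm
  simp only [← hv]
  have hp := (N.pbar_pos i).ne'
  rw [integral_const, probReal_univ, one_smul, mul_add, div_mul_cancel₀ _ hp]
  congr 1
  rw [div_eq_mul_inv, mul_comm (Real.exp _), mul_assoc, one_div]
  congr 1
  rw [Finset.mul_sum]
  refine Finset.sum_congr rfl fun k _ => ?_
  rw [mul_sub, ← mul_assoc, hE, one_mul]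

end LognormalPrices

/-! ### The market model and the main theorem. -/

section MarketModel

variable {n : ℕ} {Ω : Type*} {m : MeasurableSpace Ω}

theorem isComonotonic_etaHat {Q : Measure Ω} {W : ℝ≥0 → Ω → ℝ} {r μM σM : ℝ} {T : ℝ≥0}
    (hG : Measurable (wTilde W r μM σM T)) (hlaw : Q.map (wTilde W r μM σM T) = gaussianReal 0 T)
    {z : Fin n → ℝ} (hz : ∀ i, 0 ≤ z i) : IsComonotonic Q (etaHat W r μM σM T z) := by
  set f : ℝ → Fin n → ℝ := fun w i => Real.exp ((r - z i ^ 2 / 2) * T + z i * w) with hf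
  have hfm : Measurable f := by fun_prop
  have he : etaHat W r μM σM T z = f ∘ wTilde W r μM σM T := rfl
  refine ⟨he ▸ (hfm.comp hG).aemeasurable, gaussianReal 0 T, f, inferInstance, fun x y h i => ?_, ?_⟩
  · have := mul_le_mul_of_nonneg_left h (hz i)
    exact Real.exp_le_exp.2 (by linarith)
  · rw [he, ← Measure.map_map hfm hG, hlaw]

theorem map_linear_comb_gaussianReal {Q : Measure Ω} {G B : Ω → ℝ} {T : ℝ≥0}
    (hG : Measurable G) (hB : Measurable B) (hGl : Q.map G = gaussianReal 0 T)
    (hBl : Q.map B = gaussianReal 0 T) (hind : IndepFun G B Q) {b c : ℝ} (hbc : b ^ 2 + c ^ 2 = 1) :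
    Q.map (fun ω => b * G ω + c * B ω) = gaussianReal 0 T := by
  have h1 : Q.map (fun ω => b * G ω) = gaussianReal 0 (NNReal.mk (b ^ 2) (sq_nonneg b) * T) := by
    have h := gaussianReal_map_const_mul (μ := 0) (v := T) b
    rwa [← hGl, Measure.map_map (by fun_prop) hG, mul_zero] at h
  have h2 : Q.map (fun ω => c * B ω) = gaussianReal 0 (NNReal.mk (c ^ 2) (sq_nonneg c) * T) := by
    have h := gaussianReal_map_const_mul (μ := 0) (v := T) c
    rwa [← hBl, Measure.map_map (by fun_prop) hB, mul_zero] at h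
  have h3 := gaussianReal_add_gaussianReal_of_indepFun
    (hind.comp (φ := fun x => b * x) (ψ := fun x => c * x) (by fun_prop) (by fun_prop)) h1 h2
  rw [add_zero, ← add_mul] at h3
  have h4 : NNReal.mk (b ^ 2) (sq_nonneg b) + NNReal.mk (c ^ 2) (sq_nonneg c) = 1 := by
    ext
    simpa [NNReal.coe_mk] using hbc
  rw [h4, one_mul] at h3
  exact h3

end MarketModel

theorem lemma5p5 {n : ℕ} (N : FinancialNetwork n)
    {Ω : Type*} {m : MeasurableSpace Ω} (P : Measure Ω) [IsProbabilityMeasure P]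
    (r μM σM : ℝ) (hr : 0 ≤ r) (hσM : 0 < σM) (T : ℝ≥0) (hT : 0 < T)
    (s β γ : Fin n → ℝ) (hs : ∀ i, 0 ≤ s i) (hβ : ∀ i, 0 ≤ β i)
    (W : ℝ≥0 → Ω → ℝ) (B : Fin n → ℝ≥0 → Ω → ℝ)
    (hW : IsBrownianReal W P) (hB : ∀ i, IsBrownianReal (B i) P)
    (hWB : IndepFun (fun ω t => W t ω) (fun ω i t => B i t ω) P)
    (q : ℝ≥0 → Ω → ℝ) (hq : SolvesLinearSDE P μM ![σM] ![W] q)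
    (η : Fin n → ℝ≥0 → Ω → ℝ)
    (hη : ∀ i, SolvesLinearSDE P (r + β i * (μM - r)) ![β i * σM, γ i] ![W, B i] (η i))
    (Q : Measure Ω) (hQ : Q = riskNeutral P W r μM σM T) :
    -- the three debt prices are expectations of integrable variables under a probability measure
    IsProbabilityMeasure Q ∧
    (∀ i, Integrable (fun ω => N.payment (fun j => s j * η j T ω) i) Q) ∧
    (∀ z i, Integrable (fun ω => etaHat (n := n) W r μM σM T z ω i) Q) ∧
    (∀ z : Fin n → ℝ, (∀ i, 0 ≤ z i) → ∀ i,
      Integrable (fun ω => N.payment (fun j => s j * etaHat W r μM σM T z ω j) i) Q) ∧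
    -- lower and upper bounds
    (∀ i, debtPrice N Q s r T (etaHat W r μM σM T (firmVol β γ σM)) i
          ≤ debtPrice N Q s r T (fun ω j => η j T ω) i ∧
        debtPrice N Q s r T (fun ω j => η j T ω) i
          ≤ debtPrice N Q s r T (etaHat W r μM σM T (fun j => β j * σM)) i) ∧
    -- both expressions for the comonotonic endowments agree
    (∀ z : Fin n → ℝ, ∀ᵐ ω ∂P, etaHat W r μM σM T z ω = marketMap r σM T z (q T ω)) ∧
    -- the version with volatilities `σ` is the comonotonic version of `η_T`
    IsComonotonic Q (etaHat W r μM σM T (firmVol β γ σM)) ∧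
    (∀ i, IdentDistrib (fun ω => etaHat W r μM σM T (firmVol β γ σM) ω i) (η i T) Q Q) ∧
    -- the version with volatilities `β σM` is comonotonic and is the conditional expectation
    -- of `η_T` given `q_T`
    IsComonotonic Q (etaHat W r μM σM T (fun j => β j * σM)) ∧
    (∀ i, (fun ω => etaHat W r μM σM T (fun j => β j * σM) ω i)
      =ᵐ[Q] Q[η i T | MeasurableSpace.comap (q T) inferInstance]) ∧
    -- closed form, for every listing of the banks in descending order of the thresholds
    (∀ z : Fin n → ℝ, (∀ i, 0 ≤ z i) →
      ∀ τ : Equiv.Perm (Fin n), Antitone (fun k => qStar N s r σM T z (τ k)) →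
      ∀ i, debtPrice N Q s r T (etaHat W r μM σM T z) i = closedForm N s r σM T z τ i) := by
  have hσ : ∀ i, 0 ≤ firmVol β γ σM i := fun i => Real.sqrt_nonneg _
  have hβσ : ∀ i, 0 ≤ β i * σM := fun i => mul_nonneg (hβ i) hσM.le
  have hσsq : ∀ i, firmVol β γ σM i ^ 2 = (β i * σM) ^ 2 + γ i ^ 2 := fun i => by
    rw [firmVol, Real.sq_sqrt (by positivity), mul_pow]
  obtain ⟨hqm, hWm, hqe⟩ := hq.ae_eq_exp_of_single hW hT
  -- The equations may be posed for different filtrations, so only the terminal formulas are kept;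
  -- the independence needed below comes from `hWB`.
  have hηe := fun i => (hη i).ae_eq_exp_of_pair hW (hB i) (fun t u =>
    hWB.comp (φ := fun w : ℝ≥0 → ℝ => w u - w t) (ψ := fun b : Fin n → ℝ≥0 → ℝ => b i u - b i t)
      (by fun_prop) (by fun_prop)) hT
  have hBm : Measurable fun ω i => B i T ω := measurable_pi_lambda _ fun i => (hηe i).2.1
  have hWBT : IndepFun (W T) (fun ω i => B i T ω) P :=
    hWB.comp (φ := fun w : ℝ≥0 → ℝ => w T) (ψ := fun (b : Fin n → ℝ≥0 → ℝ) i => b i T)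
      (by fun_prop) (by fun_prop)
  have hlawP := fun i => ((hB i).hasLaw_eval T).map_eq
  set G : Ω → ℝ := wTilde W r μM σM T with hG
  set X : Ω → Fin n → ℝ := fun ω i => B i T ω with hX
  have hGm : Measurable G := hWm.add_const _
  have hprod : Q.map (fun ω => (G ω, X ω)) = (gaussianReal 0 T).prod (P.map X) := by
    rw [hQ]
    exact map_riskNeutral_prod hWm hBm (hW.hasLaw_eval T).map_eq hWBT
  have hPX : IsProbabilityMeasure (P.map X) := Measure.isProbabilityMeasure_map hBm.aemeasurable
  have hGX : Measurable fun ω => (G ω, X ω) := hGm.prodMk hBm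
  have hQprob : IsProbabilityMeasure Q := by
    have h : IsProbabilityMeasure (Q.map fun ω => (G ω, X ω)) := by rw [hprod]; infer_instance
    exact (Measure.isProbabilityMeasure_map_iff hGX.aemeasurable).1 h
  have hGl : Q.map G = gaussianReal 0 T := by
    have h := Measure.map_map (μ := Q) measurable_fst hGX
    rw [hprod, ← Measure.fst, Measure.fst_prod] at h
    exact h.symm
  have hXl : Q.map X = P.map X := by
    have h := Measure.map_map (μ := Q) measurable_snd hGX
    rw [hprod, ← Measure.snd, Measure.snd_prod] at h
    exact h.symm
  have hind : IndepFun G X Q := by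
    rw [indepFun_iff_map_prod_eq_prod_map_map hGm.aemeasurable hBm.aemeasurable, hprod, hGl, hXl]
  have hindi : ∀ i, IndepFun G (B i T) Q := fun i => hind.comp measurable_id (measurable_pi_apply i)
  have hBl : ∀ i, Q.map (B i T) = gaussianReal 0 T := fun i => by
    have h1 := Measure.map_map (μ := Q) (measurable_pi_apply i) hBm
    have h2 := Measure.map_map (μ := P) (measurable_pi_apply i) hBm
    rw [hXl, h2] at h1
    rw [← hlawP i]
    exact h1.symm
  have hac : Q ≪ P := hQ ▸ riskNeutral_absolutelyContinuous
  have hWG : ∀ ω, σM * W T ω = σM * G ω - (μM - r) * T := fun ω => by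
    rw [hG, wTilde]
    field_simp
    ring
  have hqG : ∀ᵐ ω ∂P, q T ω = Real.exp ((r - σM ^ 2 / 2) * T + σM * G ω) := by
    filter_upwards [hqe] with ω hω
    rw [hω, hWG]
    ring_nf
  have hηG : ∀ i, ∀ᵐ ω ∂Q, η i T ω = Real.exp
      ((r - firmVol β γ σM i ^ 2 / 2) * T + (β i * σM * G ω + γ i * B i T ω)) := fun i => by
    refine hac.ae_le ?_
    filter_upwards [(hηe i).2.2] with ω hω
    rw [hω, hσsq]
    have := hWG ω
    congr 1
    linear_combination β i * this
  have hmarket : ∀ z : Fin n → ℝ, ∀ᵐ ω ∂P,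
      etaHat W r μM σM T z ω = marketMap r σM T z (q T ω) := fun z => by
    filter_upwards [hqG] with ω hω
    ext j
    rw [hω, marketMap_exp hσM]
    rfl
  set V : Ω → Fin n → ℝ := fun ω j => Real.exp
    ((r - firmVol β γ σM j ^ 2 / 2) * T + (β j * σM * G ω + γ j * B j T ω)) with hV
  have hηV : (fun ω j => η j T ω) =ᵐ[Q] V := by
    filter_upwards [ae_all_iff.2 hηG] with ω hω
    exact funext hω
  have hBim : ∀ i, Measurable (B i T) := fun i => (hηe i).2.1
  have hVm : Measurable V := by fun_prop
  have hetam : ∀ z : Fin n → ℝ, Measurable (etaHat W r μM σM T z) := fun z =>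
    measurable_pi_lambda _ fun i => (((hGm.const_mul (z i))).const_add _).exp
  -- Gaussian variables `U j` with `σ_j U_j = β_j σM W̃_T + γ_j B^j_T`
  set U : Fin n → Ω → ℝ := fun j => if firmVol β γ σM j = 0 then G else
    fun ω => β j * σM / firmVol β γ σM j * G ω + γ j / firmVol β γ σM j * B j T ω with hU
  have hUm : ∀ j, Measurable (U j) := fun j => by
    simp only [hU]
    split_ifs
    · exact hGm
    · exact (hGm.const_mul _).add ((hBim j).const_mul _)
  have hUl : ∀ j, Q.map (U j) = gaussianReal 0 T := fun j => by
    simp only [hU]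
    split_ifs with h0
    · exact hGl
    · refine map_linear_comb_gaussianReal hGm (hBim j) hGl (hBl j) (hindi j) ?_
      rw [div_pow, div_pow, ← add_div, ← hσsq, div_self (pow_ne_zero 2 h0)]
  have hUσ : ∀ j ω, firmVol β γ σM j * U j ω = β j * σM * G ω + γ j * B j T ω := fun j ω => by
    simp only [hU]
    split_ifs with h0
    -- If σ_j = 0 then both loadings vanish and U j is multiplied by 0, so any variable of law
    -- N(0,T) may serve as U j.
    · have h1 := hσsq j
      rw [h0, zero_pow two_ne_zero] at h1
      have h2 : β j * σM = 0 := by nlinarith [sq_nonneg (β j * σM), sq_nonneg (γ j)]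
      have h3 : γ j = 0 := by nlinarith [sq_nonneg (β j * σM), sq_nonneg (γ j)]
      rw [h0, h2, h3]
      ring
    · field_simp
  have hVU : V = fun ω j => Real.exp
      ((r - firmVol β γ σM j ^ 2 / 2) * T + firmVol β γ σM j * U j ω) := by
    simp only [hV, hUσ]
  have hnoise : ∀ i, Integrable (fun ω => Real.exp (-(γ i ^ 2 / 2) * T + γ i * B i T ω)) Q :=
    fun i => integrable_exp_add_mul (hBim i) (hBl i) _ _
  have hnoise1 : ∀ i, ∫ ω, Real.exp (-(γ i ^ 2 / 2) * T + γ i * B i T ω) ∂Q = 1 :=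
    fun i => integral_exp_sq_add_mul (hBim i) (hBl i) _
  -- Since σ_j² = (β_j σM)² + γ_j², the exponent splits into a market part and an independent factor
  -- of mean 1. Both the upper bound and the conditional expectation rest on this.
  have hVfac : ∀ ω j, V ω j = etaHat W r μM σM T (fun j => β j * σM) ω j *
      Real.exp (-(γ j ^ 2 / 2) * T + γ j * B j T ω) := fun ω j => by
    simp only [hV, etaHat, hσsq]
    rw [← Real.exp_add]
    congr 1
    rw [← hG]
    ring
  have hetai : ∀ (z : Fin n → ℝ) i, Integrable (fun ω => etaHat (n := n) W r μM σM T z ω i) Q :=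
    fun z i => integrable_exp_add_mul hGm hGl _ _
  refine ⟨hQprob, fun i => ?_, hetai, fun z _ i => ?_, fun i => ⟨?_, ?_⟩, hmarket,
    isComonotonic_etaHat hGm hGl hσ, fun i => ?_, isComonotonic_etaHat hGm hGl hβσ, fun i => ?_,
    fun z hz τ hτ i => debtPrice_lognormal_eq_closedForm N hσM hT hs hz hGm hGl τ hτ i⟩
  · have h := integrable_payment N (Q := Q) (X := fun ω j => s j * V ω j)
      (measurable_pi_lambda _ fun j => ((measurable_pi_apply j).comp hVm).const_mul _)
      (fun ω j => mul_nonneg (hs j) (Real.exp_pos _).le) i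
    refine h.congr ?_
    filter_upwards [hηV] with ω hω
    rw [← hω]
  · exact integrable_payment N
      (measurable_pi_lambda _ fun j => ((measurable_pi_apply j).comp (hetam z)).const_mul _)
      (fun ω j => mul_nonneg (hs j) (Real.exp_pos _).le) i
  · rw [debtPrice_congr N hηV, hVU]
    exact debtPrice_le_of_integral_le N (integral_payment_diagonal_le N hs
      (fun j => (r - firmVol β γ σM j ^ 2 / 2) * T) (firmVol β γ σM) hσ hUm hGm
      (fun j => (hUl j).trans hGl.symm) i)
  · rw [debtPrice_congr N hηV]
    refine debtPrice_le_of_integral_le N ?_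
    set f : ℝ → Fin n → ℝ := fun w j =>
      s j * Real.exp ((r - (β j * σM) ^ 2 / 2) * T + β j * σM * w) with hf
    set g : (Fin n → ℝ) → Fin n → ℝ := fun b j => Real.exp (-(γ j ^ 2 / 2) * T + γ j * b j) with hg
    have hfm : Measurable f := by fun_prop
    have hgm : Measurable g := by fun_prop
    have hf0 : ∀ w, 0 ≤ f w := fun w j => mul_nonneg (hs j) (Real.exp_pos _).le
    have hg0 : ∀ b, 0 ≤ g b := fun b j => (Real.exp_pos _).le
    have hgj : ∀ j, Measurable fun b => g b j := fun j => (measurable_pi_apply j).comp hgm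
    have hQX : IsProbabilityMeasure (Q.map X) := hXl ▸ hPX
    have key := integral_payment_mul_le N (μ := gaussianReal 0 T) (ν := Q.map X)
      hfm hgm hf0 hg0
      (fun j => (integrable_map_measure (hgj j).aestronglyMeasurable hBm.aemeasurable).2 (hnoise j))
      (fun j => (integral_map hBm.aemeasurable (hgj j).aestronglyMeasurable).trans (hnoise1 j)) i
    have hm : Measurable fun p : ℝ × (Fin n → ℝ) => (fun j => f p.1 j * g p.2 j) := by fun_prop
    have e1 : ∫ ω, N.payment (fun j => s j * V ω j) i ∂Q =
        ∫ p, N.payment (fun j => f p.1 j * g p.2 j) i ∂(gaussianReal 0 T).prod (Q.map X) := by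
      have hi := (integrable_payment N (Q := (gaussianReal 0 T).prod (P.map X)) hm
        (fun p j => mul_nonneg (hf0 p.1 j) (hg0 p.2 j)) i).aestronglyMeasurable
      rw [← hprod] at hi
      rw [hXl, ← hprod, integral_map hGX.aemeasurable hi]
      refine integral_congr_ae (ae_of_all _ fun ω => ?_)
      simp only [hVfac, hf, hg, etaHat, mul_assoc]
      rfl
    have e2 : ∫ ω, N.payment (fun j => s j * etaHat W r μM σM T (fun j => β j * σM) ω j) i ∂Q =
        ∫ w, N.payment (f w) i ∂gaussianReal 0 T := by
      have hi := (integrable_payment N (Q := gaussianReal 0 T) hfm hf0 i).aestronglyMeasurable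
      rw [← hGl] at hi ⊢
      rw [integral_map hGm.aemeasurable hi]
      rfl
    rw [e1, e2]
    exact key
  · set a : ℝ → ℝ := fun x => Real.exp
      ((r - firmVol β γ σM i ^ 2 / 2) * T + firmVol β γ σM i * x) with ha
    have ham : Measurable a := by fun_prop
    have h1 : (fun ω => etaHat W r μM σM T (firmVol β γ σM) ω i) = a ∘ G := rfl
    have h2 : η i T =ᵐ[Q] a ∘ U i := by
      filter_upwards [hηG i] with ω hω
      rw [hω, ← hUσ]
      rfl
    refine ⟨h1 ▸ (ham.comp hGm).aemeasurable, (hηe i).1.aemeasurable, ?_⟩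
    rw [h1, Measure.map_congr h2, ← Measure.map_map ham hGm, ← Measure.map_map ham (hUm i),
      hGl, hUl]
  · set F : Ω → ℝ := fun ω => marketMap r σM T (fun j => β j * σM) (q T ω) i with hF
    set ξ : Ω → ℝ := fun ω => Real.exp (-(γ i ^ 2 / 2) * T + γ i * B i T ω) with hξ
    set mq : MeasurableSpace Ω := MeasurableSpace.comap (q T) inferInstance with hmq
    have hle : mq ≤ m := hqm.comap_le
    have hqmq : Measurable[mq] (q T) := comap_measurable _
    have hFm : StronglyMeasurable[mq] F := by
      refine Measurable.stronglyMeasurable ?_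
      exact (hqmq.pow_const _).const_mul _
    have hFe : (fun ω => etaHat W r μM σM T (fun j => β j * σM) ω i) =ᵐ[Q] F := by
      filter_upwards [hac.ae_le (hmarket fun j => β j * σM)] with ω hω
      rw [hω]
    have hηF : η i T =ᵐ[Q] F * ξ := by
      filter_upwards [hηG i, hFe] with ω h1 h2
      rw [h1, Pi.mul_apply, ← h2]
      exact hVfac ω i
    have hVi : Integrable (F * ξ) Q := by
      have h := integrable_exp_add_mul (hUm i) (hUl i)
        ((r - firmVol β γ σM i ^ 2 / 2) * T) (firmVol β γ σM i)
      refine h.congr ?_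
      filter_upwards [hηF, hηG i] with ω h1 h2
      rw [← h1, h2, hUσ]
    have hξm : StronglyMeasurable[MeasurableSpace.comap (B i T) inferInstance] ξ := by
      have h : Measurable[MeasurableSpace.comap (B i T) inferInstance] (B i T) :=
        comap_measurable _
      exact Measurable.stronglyMeasurable (((h.const_mul _).const_add _).exp)
    -- Almost surely q_T is a function of W̃_T, so it inherits the independence from B^i_T.
    -- Conditioning on q_T then keeps the factor `F` and replaces `ξ` by its mean 1.
    have hindq : Indep (MeasurableSpace.comap (B i T) inferInstance) mq Q := by
      have h1 : IndepFun (q T) (B i T) Q := by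
        refine ((hindi i).comp (φ := fun x => Real.exp ((r - σM ^ 2 / 2) * T + σM * x))
          (ψ := id) (by fun_prop) measurable_id).congr ?_ (ae_of_all _ fun _ => rfl)
        filter_upwards [hac.ae_le hqG] with ω hω
        rw [hω]
        rfl
      exact ((IndepFun_iff_Indep _ _ _).1 h1).symm
    have h1 := condExp_congr_ae (m := mq) hηF
    have h2 := condExp_mul_of_stronglyMeasurable_left hFm hVi (hnoise i)
    have h3 := condExp_indep_eq (hBim i).comap_le hle hξm hindq
    filter_upwards [h1, h2, h3, hFe] with ω e1 e2 e3 e4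
    rw [e1, e2, Pi.mul_apply, e3, e4, hnoise1, mul_one]
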